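/- **Setting.** Let $\mathbb F$ be a finite field with $q$ elements, $\mathcal C$ a smooth projective geometrically irreducible curve over $\mathbb F$, $\infty$ a closed point of $\mathcal C$, $A=H^0(\mathcal C\setminus\{\infty\},\mathcal O)$, $K$ its fraction field, $K_\infty$ the completion of $K$ at $\infty$, $\mathbb C_\infty$ the completion of an algebraic closure of $K_\infty$, and $\ell:A\to\mathbb C_\infty$ the inclusion. Tensor products are over $\mathbb F$. Let $\mathfrak X=(\operatorname{Spec}A\otimes\mathbb C_\infty)^{\mathrm{rig}}$ with its strong Grothendieck topology, $\mathcal O_{\mathfrak X}$ its structure sheaf, and $\mathcal M_{\mathfrak X}$ its sheaf of meromorphic functions. Let $\tau:\mathfrak X\to\mathfrak X$ be the $A$-linear Frobenius, which on points $x:A\to\mathbb C_\infty$ is $x\mapsto \mathrm{Frob}_q\circ x$. An admissible open $\mathfrak U$ is *costable* if $\mathfrak U\subseteq\tau\mathfrak U$; costable admissible opens and admissible coverings by them form the *costable site* ${}^\tau\underline{\mathfrak X}$. For $\mathfrak U$ costable, $f\mapsto f^{(1)}$ is the composite $\mathcal M_{\mathfrak X}(\mathfrak U)\to\mathcal M_{\mathfrak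 X}(\tau\mathfrak U)\to\mathcal M_{\mathfrak X}(\mathfrak U)$ of the twist (on functions, $f^{(1)}(\tau x)=f(x)^q$) and restriction, and $f^{(j)}$ is its $j$-th iterate. Let $\mathcal L\subseteq\mathcal M_{\mathfrak X}$ be a sub-$\mathcal O_{\mathfrak X}$-module sheaf that contains $\mathcal O_{\mathfrak X}$ and is *costable*: $\mathcal L(\mathfrak U)^{(1)}\subseteq\mathcal L(\mathfrak U)$ for every costable $\mathfrak U$ (for instance $\mathcal L=\mathcal O_{\mathfrak X}$). Let $E$ be an Anderson $A$-module of dimension $d$ over $\mathbb C_\infty$: an $A$-module scheme, isomorphic to $\mathbb G_a^d$ as an $\mathbb F$-vector space scheme, such that $\partial a-\ell(a)$ is nilpotent on $\operatorname{Lie}_E(\mathbb C_\infty)$ for all $a\in A$. A *choice of coordinates* is an isomorphism $\kappa:E\to\mathbb G_a^d$ of $\mathbb F$-vector space schemes. For $b\in A$ write $\varphi_\kappa(b)=\sum_j B_j\tau^j\in\operatorname{Mat}_d(\mathbb C_\infty\{\tau\})$ for the action of $b$ on $E$ in the coordinates $\kappa$. A matrix $\sum_j P_j\tau^j$ acts on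 $\mathcal L(\mathfrak U)^d$ ($\mathfrak U$ costable) by $G\mapsto\sum_jP_jG^{(j)}$. Consider pairs $(\mathcal E,\iota)$ of a sheaf $\mathcal E$ of $A\otimes A$-modules on ${}^\tau\underline{\mathfrak X}$ and a family of $A\otimes A$-linear maps $\iota(\mathfrak U):A\otimes E(\mathbb C_\infty)\to\mathcal E(\mathfrak U)$. An *identification of $\mathcal E$ for $\kappa$* is a family of isomorphisms of $A$-modules $\kappa(\mathfrak U):\mathcal E(\mathfrak U)\to\mathcal L(\mathfrak U)^d$ ($A$ acting on $\mathcal E(\mathfrak U)$ through $a\otimes1$), compatible with restriction maps, such that $\kappa(\mathfrak U)((1\otimes b)e)=\varphi_\kappa(b)\cdot\kappa(\mathfrak U)(e)$ for $b\in A$, and such that $$\begin{array}{ccc}(A\otimes\mathbb C_\infty)^d&\xrightarrow{\ \kappa^{-1}\ }&A\otimes E(\mathbb C_\infty)\\ \downarrow&&\downarrow{\scriptstyle\iota(\mathfrak U)}\\ \mathcal L(\mathfrak U)^d&\xrightarrow{\ \kappa(\mathfrak U)^{-1}\ }&\mathcal E(\mathfrak U)\end{array}$$ is a pushout square of $A$-modules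 (the left arrow being the canonical map). Call $(\mathcal E,\iota)$ *a sheaf of $E$-valued functions for $\mathcal L$* if it admits an identification for every $\kappa$. A *coherent system* for $(\mathcal E,\iota)$ is a choice of an identification for each $\kappa$ such that $\kappa'(\mathfrak U)=(\kappa'\kappa^{-1})\cdot\kappa(\mathfrak U)$ for all $\kappa,\kappa',\mathfrak U$, where $\kappa'\kappa^{-1}\in\operatorname{GL}_d(\mathbb C_\infty\{\tau\})$. **Proposition.** 1. There exists a sheaf $(\mathcal E(\mathcal L),\iota)$ of $E$-valued functions for $\mathcal L$. 2. For every such pair, any identification for one $\kappa$ extends to a unique coherent system. 3. (Uniqueness up to canonical isomorphism.) If $(\mathcal E,\iota)$ and $(\mathcal E',\iota')$ are two such pairs with coherent systems $(\kappa(\mathfrak U))$ and $(\kappa(\mathfrak U)')$, there is a unique isomorphism $f:\mathcal E\to\mathcal E'$ of sheaves of $A\otimes A$-modules with $f\circ\iota=\iota'$ and $\kappa(\mathfrak U)'\circ f=\kappa(\mathfrak U)$ for all $\kappa$ and $\mathfrak U$. 4. (Unit disk.) The uniform structure on $A\otimes E(\mathbb C_\infty)$ deduced through $\kappa$ from the Gauss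 norm $\|f\|=\inf\{\max_i|c_i| : f=\sum_i a_i\otimes c_i\}$ on $A\otimes\mathbb C_\infty$ does not depend on $\kappa$, and every element of $A\otimes A$ acts uniformly continuously for it; let $A\hat\otimes E(\mathbb C_\infty)$ be the completion. Let $\mathfrak D=\operatorname{Sp}(A\hat\otimes\mathbb C_\infty)=\{x:|x(a)|\le1\ \forall a\in A\}$ be the unit disk, which is costable. For every pair $(\mathcal E,\iota)$ as above and every identification for some $\kappa$, there is a unique $A\otimes A$-linear injection $c:A\hat\otimes E(\mathbb C_\infty)\to\mathcal E(\mathfrak D)$ which extends $\iota(\mathfrak D)$ and whose image is the submodule of $\mathcal E(\mathfrak D)$ corresponding to $\mathcal O_{\mathfrak X}(\mathfrak D)^d\subseteq\mathcal L(\mathfrak D)^d$. In particular, if $\mathcal L(\mathfrak D)=\mathcal O_{\mathfrak X}(\mathfrak D)$ (e.g. $\mathcal L=\mathcal O_{\mathfrak X}$), then $c$ is an isomorphism $A\hat\otimes E(\mathbb C_\infty)\cong\mathcal E(\mathfrak D)$. -/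

import Mathlib

open scoped TensorProduct
open CategoryTheory

universe u

noncomputable section

namespace CostableSite

/-! ## Affinoid varieties as zero loci in polydiscs -/

section Affinoid

variable {C : Type u} [NormedField C]

/-- The function `f` on `Z ⊆ Cⁿ` is a uniform limit on `Z` of polynomial functions. -/
def IsPolyLimit {n : ℕ} (Z : Set (Fin n → C)) (f : Z → C) : Prop :=
  ∀ ε : ℝ, 0 < ε → ∃ p : MvPolynomial (Fin n) C, ∀ z : Z, ‖f z - MvPolynomial.eval z.1 p‖ ≤ ε

variable (C) in
/-- The closed unit polydisc of dimension `n`. -/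
def polydisc (n : ℕ) : Set (Fin n → C) := {z | ∀ i, ‖z i‖ ≤ 1}

variable (C) in
/-- A (reduced) affinoid variety over the algebraically closed field `C`, given by its points:
the common zero locus, in a closed unit polydisc, of a set of elements of the Tate algebra.
(Over an algebraically closed complete field the Gauss norm on `C[t₁,…,tₙ]` is the supremum norm on
the polydisc, so the Tate algebra is the algebra of uniform limits of polynomials.) -/
structure AffinoidSet where
  dim : ℕ
  carrier : Set (Fin dim → C)
  isAnalytic : ∃ I : Set (polydisc C dim → C), (∀ f ∈ I, IsPolyLimit (polydisc C dim) f) ∧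
    carrier = {z | ∃ h : z ∈ polydisc C dim, ∀ f ∈ I, f ⟨z, h⟩ = 0}

theorem AffinoidSet.norm_le (Z : AffinoidSet C) {z : Fin Z.dim → C} (hz : z ∈ Z.carrier)
    (i : Fin Z.dim) : ‖z i‖ ≤ 1 := by
  obtain ⟨I, -, hI⟩ := Z.isAnalytic
  rw [hI] at hz
  exact hz.1 i

theorem exists_eval_bound {n : ℕ} (p : MvPolynomial (Fin n) C) :
    ∃ M : ℝ, 0 ≤ M ∧ ∀ z : Fin n → C, (∀ i, ‖z i‖ ≤ 1) → ‖MvPolynomial.eval z p‖ ≤ M := by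
  induction p using MvPolynomial.induction_on with
  | C a => exact ⟨‖a‖, norm_nonneg _, fun z _ => by simp⟩
  | add p q hp hq =>
    obtain ⟨M, hM, h⟩ := hp
    obtain ⟨N, hN, k⟩ := hq
    refine ⟨M + N, by positivity, fun z hz => ?_⟩
    rw [map_add]
    exact (norm_add_le _ _).trans (add_le_add (h z hz) (k z hz))
  | mul_X p i hp =>
    obtain ⟨M, hM, h⟩ := hp
    refine ⟨M, hM, fun z hz => ?_⟩
    rw [map_mul, MvPolynomial.eval_X, norm_mul]
    exact (mul_le_mul (h z hz) (hz i) (norm_nonneg _) hM).trans (by simp)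

theorem IsPolyLimit.add {n : ℕ} {Z : Set (Fin n → C)} {f g : Z → C} (hf : IsPolyLimit Z f)
    (hg : IsPolyLimit Z g) : IsPolyLimit Z (f + g) := by
  intro ε hε
  obtain ⟨p, hp⟩ := hf (ε / 2) (by positivity)
  obtain ⟨r, hr⟩ := hg (ε / 2) (by positivity)
  refine ⟨p + r, fun z => ?_⟩
  have : (f + g) z - MvPolynomial.eval z.1 (p + r) =
      (f z - MvPolynomial.eval z.1 p) + (g z - MvPolynomial.eval z.1 r) := by
    simp only [Pi.add_apply, map_add]; ring
  rw [this]
  linarith [norm_add_le (f z - MvPolynomial.eval z.1 p) (g z - MvPolynomial.eval z.1 r), hp z, hr z]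

theorem IsPolyLimit.mul {n : ℕ} {Z : Set (Fin n → C)} (hZ : ∀ z ∈ Z, ∀ i, ‖z i‖ ≤ 1)
    {f g : Z → C} (hf : IsPolyLimit Z f) (hg : IsPolyLimit Z g) : IsPolyLimit Z (f * g) := by
  intro ε hε
  obtain ⟨p₁, hp₁⟩ := hf 1 one_pos
  obtain ⟨M, hM, hpM⟩ := exists_eval_bound p₁
  obtain ⟨r, hr⟩ := hg (ε / (2 * (M + 1))) (by positivity)
  obtain ⟨N, hN, hrN⟩ := exists_eval_bound r
  obtain ⟨p, hp⟩ := hf (ε / (2 * (N + 1))) (by positivity)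
  refine ⟨p * r, fun z => ?_⟩
  have e : (f * g) z - MvPolynomial.eval z.1 (p * r) =
      f z * (g z - MvPolynomial.eval z.1 r) +
        (f z - MvPolynomial.eval z.1 p) * MvPolynomial.eval z.1 r := by
    simp only [Pi.mul_apply, map_mul]; ring
  have hfz : ‖f z‖ ≤ M + 1 := by
    have := norm_add_le (f z - MvPolynomial.eval z.1 p₁) (MvPolynomial.eval z.1 p₁)
    rw [sub_add_cancel] at this
    linarith [hp₁ z, hpM z.1 (hZ z.1 z.2)]
  have h1 : ‖f z * (g z - MvPolynomial.eval z.1 r)‖ ≤ ε / 2 := by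
    rw [norm_mul]
    calc _ ≤ (M + 1) * (ε / (2 * (M + 1))) :=
          mul_le_mul hfz (hr z) (norm_nonneg _) (by positivity)
      _ = ε / 2 := by field_simp
  have h2 : ‖(f z - MvPolynomial.eval z.1 p) * MvPolynomial.eval z.1 r‖ ≤ ε / 2 := by
    rw [norm_mul]
    calc _ ≤ (ε / (2 * (N + 1))) * (N + 1) :=
          mul_le_mul (hp z) ((hrN z.1 (hZ z.1 z.2)).trans (by linarith)) (norm_nonneg _)
            (by positivity)
      _ = ε / 2 := by field_simp
  rw [e]
  linarith [norm_add_le (f z * (g z - MvPolynomial.eval z.1 r))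
    ((f z - MvPolynomial.eval z.1 p) * MvPolynomial.eval z.1 r)]

/-- The affinoid algebra of `Z`, as an algebra of functions: the uniform closure of the polynomial
functions. (For a reduced affinoid algebra the supremum norm is complete and equivalent to every
residue norm, so this is the image of the Tate algebra.) -/
def AffinoidSet.functions (Z : AffinoidSet C) : Subalgebra C (Z.carrier → C) where
  carrier := {f | IsPolyLimit Z.carrier f}
  mul_mem' hf hg := hf.mul (fun _ hz => Z.norm_le hz) hg
  add_mem' hf hg := hf.add hg
  algebraMap_mem' c := fun ε hε => ⟨MvPolynomial.C c, fun z => by simpa using hε.le⟩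

/-- Rational subdomains: for an algebra `B` of functions on `S`, the subsets
`{s | |f₁(s)|, …, |fₙ(s)| ≤ |g(s)|}` with `f₁, …, fₙ, g ∈ B` generating the unit ideal of `B`. -/
def IsRational {S : Type u} (B : Subalgebra C (S → C)) (V : Set S) : Prop :=
  ∃ (n : ℕ) (f : Fin n → B) (g : B),
    Ideal.span (insert g (Set.range f)) = ⊤ ∧
      V = {s | ∀ i, ‖(f i : S → C) s‖ ≤ ‖(g : S → C) s‖}

theorem isRational_univ {S : Type u} (B : Subalgebra C (S → C)) : IsRational B Set.univ :=
  ⟨0, Fin.elim0, 1, by simp, by ext; simp⟩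

end Affinoid

/-! ## The rigid analytic variety `𝔛` -/

section Space

variable (F A C : Type u) [Field F] [CommRing A] [Algebra F A] [NormedField C] [Algebra F C]

/-- The points of `𝔛 = (Spec A ⊗ C)^rig`: the maximal ideals of `A ⊗ C`, that is (`C` being
algebraically closed) the `F`-algebra morphisms `A → C`. -/
abbrev Point := A →ₐ[F] C

variable {F A C}

/-- Morphisms from an affinoid variety `Z` to `𝔛`; they correspond to the morphisms of `C`-algebras
from `A ⊗ C` to the affinoid algebra of `Z`. -/
def IsMorphism (Z : AffinoidSet C) (φ : Z.carrier → Point F A C) : Prop :=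
  ∀ a : A, (fun z => φ z a) ∈ Z.functions

/-- The ring `𝒪_𝔛(U)` of analytic functions: the functions on the points of `U` whose pullback under
every morphism `Z → 𝔛` from an affinoid variety, with image in `U`, is analytic on `Z`. -/
def holSubalgebra (U : Set (Point F A C)) : Subalgebra C (U → C) where
  carrier := {f | ∀ (Z : AffinoidSet C) (φ : Z.carrier → Point F A C), IsMorphism Z φ →
    ∀ h : ∀ z, φ z ∈ U, (fun z => f ⟨φ z, h z⟩) ∈ Z.functions}
  mul_mem' hf hg := fun Z φ hφ h => Z.functions.mul_mem (hf Z φ hφ h) (hg Z φ hφ h)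
  add_mem' hf hg := fun Z φ hφ h => Z.functions.add_mem (hf Z φ hφ h) (hg Z φ hφ h)
  algebraMap_mem' c := fun Z _ _ _ => Z.functions.algebraMap_mem c

/-- The degree of `a ∈ A`, i.e. `-[F_∞ : F] · v_∞(a) = dim_F (A / a A)` for `a ≠ 0`
(and `0` for `a = 0`). -/
def degree (F : Type u) {A : Type u} [Field F] [CommRing A] [Algebra F A] (a : A) : ℕ :=
  open Classical in if a = 0 then 0 else Module.finrank F (A ⧸ Ideal.span {a})

/-- The affinoid subspace `𝔛_ρ`, `ρ = |c|`, of `𝔛`. -/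
def closedDisc (c : C) : Set (Point F A C) := {x | ∀ a : A, ‖x a‖ ≤ ‖c‖ ^ degree F a}

/-- The rational subdomains of `𝔛`: those of the spaces `𝔛_ρ`, `ρ ∈ |Cˣ|`. -/
def IsRationalSubdomain (V : Set (Point F A C)) : Prop :=
  ∃ c : C, c ≠ 0 ∧ ∃ W : Set (closedDisc (F := F) (A := A) c),
    IsRational (holSubalgebra (closedDisc c)) W ∧ V = Subtype.val '' W

/-- The finiteness condition of the strong Grothendieck topology: for every morphism `φ : Z → 𝔛`
from an affinoid variety with image in `U`, the family `(φ⁻¹(V))`, `V ∈ 𝒱`, is refined by a finite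
covering of `Z` by rational subdomains. -/
def IsAdmissibleFamily (U : Set (Point F A C)) (𝒱 : Set (Set (Point F A C))) : Prop :=
  ∀ (Z : AffinoidSet C) (φ : Z.carrier → Point F A C), IsMorphism Z φ → (∀ z, φ z ∈ U) →
    ∃ 𝒲 : Set (Set Z.carrier), 𝒲.Finite ∧ (∀ W ∈ 𝒲, IsRational Z.functions W) ∧
      ⋃₀ 𝒲 = Set.univ ∧ ∀ W ∈ 𝒲, ∃ V ∈ 𝒱, ∀ z ∈ W, φ z ∈ V

/-- Admissible open subsets of `𝔛` for the strong Grothendieck topology. -/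
def IsAdmissible (U : Set (Point F A C)) : Prop :=
  ∃ 𝒱 : Set (Set (Point F A C)), (∀ V ∈ 𝒱, IsRationalSubdomain V) ∧ ⋃₀ 𝒱 = U ∧
    IsAdmissibleFamily U 𝒱

variable (F A C) in
/-- The category `Cat 𝔛` of admissible opens of `𝔛` (with inclusions as morphisms). -/
structure AdmOpen where
  carrier : Set (Point F A C)
  isAdmissible : IsAdmissible carrier

instance : PartialOrder (AdmOpen F A C) :=
  PartialOrder.lift AdmOpen.carrier (by rintro ⟨U, _⟩ ⟨V, _⟩ rfl; rfl)

/-- Admissible coverings `Cov 𝔛`. -/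
def IsAdmissibleCovering (U : AdmOpen F A C) (𝒰 : Set (AdmOpen F A C)) : Prop :=
  (∀ V ∈ 𝒰, V ≤ U) ∧ (⋃ V ∈ 𝒰, V.carrier) = U.carrier ∧
    IsAdmissibleFamily U.carrier (AdmOpen.carrier '' 𝒰)

/-- The ring `𝒪_𝔛(U)` as a type. -/
def Hol (U : Set (Point F A C)) : Type u := holSubalgebra U

instance (U : Set (Point F A C)) : CommRing (Hol U) :=
  inferInstanceAs (CommRing (holSubalgebra U))

instance (U : Set (Point F A C)) : Algebra C (Hol U) :=
  inferInstanceAs (Algebra C (holSubalgebra U))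

instance (U : Set (Point F A C)) : Algebra F (Hol U) :=
  ((algebraMap C (Hol U)).comp (algebraMap F C)).toAlgebra

instance (U : Set (Point F A C)) : IsScalarTower F C (Hol U) :=
  IsScalarTower.of_algebraMap_eq fun _ => rfl

/-- The `A`-algebra structure of `𝒪_𝔛(U)`: an element `a` of `A` is viewed as the function
`x ↦ x(a)`. -/
instance (U : Set (Point F A C)) : Algebra A (Hol U) :=
  RingHom.toAlgebra
    { toFun := fun a => ⟨fun x => x.1 a, fun _ _ hφ _ => hφ a⟩
      map_one' := Subtype.ext (funext fun x => map_one x.1)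
      map_mul' := fun a b => Subtype.ext (funext fun x => map_mul x.1 a b)
      map_zero' := Subtype.ext (funext fun x => map_zero x.1)
      map_add' := fun a b => Subtype.ext (funext fun x => map_add x.1 a b) }

instance (U : Set (Point F A C)) : IsScalarTower F A (Hol U) :=
  IsScalarTower.of_algebraMap_eq fun r => Subtype.ext (funext fun x => (x.1.commutes r).symm)

/-- The value of an analytic function at a point. -/
def Hol.eval {U : Set (Point F A C)} (f : Hol U) (x : Point F A C) (hx : x ∈ U) : C := f.1 ⟨x, hx⟩

theorem Hol.ext {U : Set (Point F A C)} {f g : Hol U} (h : ∀ x hx, f.eval x hx = g.eval x hx) :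
    f = g :=
  Subtype.ext (funext fun x => h x.1 x.2)

/-- The restriction maps of `𝒪_𝔛`. -/
def Hol.res {V U : AdmOpen F A C} (h : V ≤ U) : Hol U.carrier →+* Hol V.carrier where
  toFun f := ⟨fun x => f.1 ⟨x.1, h x.2⟩, fun Z φ hφ hV => f.2 Z φ hφ fun z => h (hV z)⟩
  map_one' := rfl
  map_mul' _ _ := rfl
  map_zero' := rfl
  map_add' _ _ := rfl

/-- The canonical map `A ⊗ C → 𝒪_𝔛(U)`. -/
def Hol.ofTensor (U : Set (Point F A C)) : A ⊗[F] C →ₐ[A] Hol U :=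
  Algebra.TensorProduct.lift (Algebra.ofId A (Hol U)) ((Algebra.ofId C (Hol U)).restrictScalars F)
    fun _ _ => Commute.all _ _

/-- The functions on `U` which remain non-zero-divisors on every smaller admissible open. As the
restriction maps of `𝒪_𝔛` between affinoid subdomains are flat, these are the non-zero-divisors of
`𝒪_𝔛(U)`. -/
def regular (U : AdmOpen F A C) : Submonoid (Hol U.carrier) where
  carrier := {b | ∀ (V : AdmOpen F A C) (h : V ≤ U), Hol.res h b ∈ nonZeroDivisors (Hol V.carrier)}
  one_mem' := fun V h => by rw [map_one]; exact one_mem _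
  mul_mem' := fun ha hb V h => by rw [map_mul]; exact mul_mem (ha V h) (hb V h)

/-- The ring `ℳ_𝔛(U)` of meromorphic functions on `U`: the total ring of fractions of `𝒪_𝔛(U)`. -/
def Mer (U : AdmOpen F A C) : Type u := Localization (regular U)

instance (U : AdmOpen F A C) : CommRing (Mer U) :=
  inferInstanceAs (CommRing (Localization (regular U)))

instance (U : AdmOpen F A C) : Algebra (Hol U.carrier) (Mer U) :=
  inferInstanceAs (Algebra (Hol U.carrier) (Localization (regular U)))

instance (U : AdmOpen F A C) : IsLocalization (regular U) (Mer U) :=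
  inferInstanceAs (IsLocalization (regular U) (Localization (regular U)))

instance (U : AdmOpen F A C) : Algebra A (Mer U) :=
  ((algebraMap (Hol U.carrier) (Mer U)).comp (algebraMap A (Hol U.carrier))).toAlgebra

instance (U : AdmOpen F A C) : IsScalarTower A (Hol U.carrier) (Mer U) :=
  IsScalarTower.of_algebraMap_eq fun _ => rfl

instance (U : AdmOpen F A C) : Algebra C (Mer U) :=
  ((algebraMap (Hol U.carrier) (Mer U)).comp (algebraMap C (Hol U.carrier))).toAlgebra

instance (U : AdmOpen F A C) : IsScalarTower C (Hol U.carrier) (Mer U) :=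
  IsScalarTower.of_algebraMap_eq fun _ => rfl

theorem regular_le_comap {V U : AdmOpen F A C} (h : V ≤ U) :
    regular U ≤ (regular V).comap (Hol.res h) :=
  fun _ hb W hW => hb W (hW.trans h)

/-- The restriction maps of `ℳ_𝔛`. -/
def Mer.res {V U : AdmOpen F A C} (h : V ≤ U) : Mer U →+* Mer V :=
  IsLocalization.map (Mer V) (Hol.res h) (regular_le_comap h)

end Space

/-! ## The Frobenius twist -/

section Twist

variable {F A C : Type u} [Field F] [CommRing A] [Algebra F A] [NormedField C] [Algebra F C]

/-- The automorphism `σ` transforms the absolute value into a power of it. -/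
def IsNormPower (σ : C ≃ₐ[F] C) : Prop := ∃ s : ℝ, 0 < s ∧ ∀ c : C, ‖σ c‖ = ‖c‖ ^ s

theorem IsNormPower.symm {σ : C ≃ₐ[F] C} (hσ : IsNormPower σ) : IsNormPower σ.symm := by
  obtain ⟨s, hs, h⟩ := hσ
  refine ⟨s⁻¹, inv_pos.2 hs, fun c => ?_⟩
  have := h (σ.symm c)
  rw [σ.apply_symm_apply] at this
  rw [this, ← Real.rpow_mul (norm_nonneg _), mul_inv_cancel₀ hs.ne', Real.rpow_one]

theorem IsNormPower.norm_le_iff {σ : C ≃ₐ[F] C} (hσ : IsNormPower σ) (a b : C) :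
    ‖σ a‖ ≤ ‖σ b‖ ↔ ‖a‖ ≤ ‖b‖ := by
  obtain ⟨s, hs, h⟩ := hσ
  rw [h, h]
  exact Real.rpow_le_rpow_iff (norm_nonneg _) (norm_nonneg _) hs

theorem IsNormPower.norm_le_one_iff {σ : C ≃ₐ[F] C} (hσ : IsNormPower σ) (a : C) :
    ‖σ a‖ ≤ 1 ↔ ‖a‖ ≤ 1 := by
  have := hσ.norm_le_iff a 1
  rwa [map_one, norm_one] at this

theorem IsPolyLimit.twist {σ : C ≃ₐ[F] C} (hσ : IsNormPower σ) {n : ℕ} {Z Z' : Set (Fin n → C)}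
    {f : Z → C} {f' : Z' → C} (hf : IsPolyLimit Z f)
    (h : ∀ z' : Z', ∃ z : Z, (∀ i, z'.1 i = σ (z.1 i)) ∧ f' z' = σ (f z)) : IsPolyLimit Z' f' := by
  intro ε hε
  obtain ⟨s, hs, hn⟩ := hσ
  obtain ⟨p, hp⟩ := hf (ε ^ s⁻¹) (Real.rpow_pos_of_pos hε _)
  refine ⟨p.map (σ : C →+* C), fun z' => ?_⟩
  obtain ⟨z, hz, hz'⟩ := h z'
  have e : MvPolynomial.eval z'.1 (p.map (σ : C →+* C)) = σ (MvPolynomial.eval z.1 p) := by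
    have : z'.1 = fun i => σ (z.1 i) := funext hz
    rw [this, MvPolynomial.eval_map]
    exact (MvPolynomial.eval₂_comp_left (σ : C →+* C) (RingHom.id C) z.1 p).symm
  rw [hz', e, ← map_sub, hn]
  calc _ ≤ (ε ^ s⁻¹) ^ s := Real.rpow_le_rpow (norm_nonneg _) (hp z) hs.le
    _ = ε := by rw [← Real.rpow_mul hε.le, inv_mul_cancel₀ hs.ne', Real.rpow_one]

/-- The image of an affinoid variety under the coordinatewise action of `σ`. -/
def AffinoidSet.twist (σ : C ≃ₐ[F] C) (hσ : IsNormPower σ) (Z : AffinoidSet C) :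
    AffinoidSet C where
  dim := Z.dim
  carrier := {z | (fun i => σ.symm (z i)) ∈ Z.carrier}
  isAnalytic := by
    obtain ⟨I, hI, hZ⟩ := Z.isAnalytic
    have key : ∀ z : Fin Z.dim → C, z ∈ polydisc C Z.dim →
        (fun i => σ.symm (z i)) ∈ polydisc C Z.dim :=
      fun z hz i => (hσ.symm.norm_le_one_iff _).2 (hz i)
    refine ⟨(fun f (z : polydisc C Z.dim) =>
      σ (f ⟨fun i => σ.symm (z.1 i), key z.1 z.2⟩)) '' I, ?_, ?_⟩
    · rintro _ ⟨f, hf, rfl⟩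
      exact (hI f hf).twist hσ fun z' =>
        ⟨⟨fun i => σ.symm (z'.1 i), key z'.1 z'.2⟩, fun i => by simp, rfl⟩
    · ext z
      rw [Set.mem_ofPred_eq, hZ]
      constructor
      · rintro ⟨h, hz⟩
        refine ⟨fun i => ?_, ?_⟩
        · exact (hσ.symm.norm_le_one_iff _).1 (h i)
        · rintro _ ⟨f, hf, rfl⟩
          simp [hz f hf]
      · rintro ⟨h, hz⟩
        refine ⟨key z h, fun f hf => ?_⟩
        simpa using hz _ ⟨f, hf, rfl⟩

theorem IsRational.twist {σ : C ≃ₐ[F] C} (hσ : IsNormPower σ) {S S' : Type u}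
    {B : Subalgebra C (S → C)} {B' : Subalgebra C (S' → C)} (e : S' → S)
    (h : ∀ f ∈ B, (fun s => σ (f (e s))) ∈ B') {V : Set S} (hV : IsRational B V) :
    IsRational B' (e ⁻¹' V) := by
  obtain ⟨n, f, g, hfg, rfl⟩ := hV
  let T : B →+* B' :=
    { toFun := fun b => ⟨fun s => σ (b.1 (e s)), h b.1 b.2⟩
      map_one' := Subtype.ext (funext fun _ => map_one σ)
      map_mul' := fun a b => Subtype.ext (funext fun _ => map_mul σ _ _)
      map_zero' := Subtype.ext (funext fun _ => map_zero σ)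
      map_add' := fun a b => Subtype.ext (funext fun _ => map_add σ _ _) }
  refine ⟨n, fun i => T (f i), T g, ?_, ?_⟩
  · have := congrArg (Ideal.map T) hfg
    rw [Ideal.map_span, Ideal.map_top, Set.image_insert_eq, ← Set.range_comp] at this
    exact this
  · ext s
    exact forall_congr' fun i => (hσ.norm_le_iff _ _).symm

/-- The action of `σ` on the points of `𝔛`. -/
def Point.twist (σ : C ≃ₐ[F] C) (x : Point F A C) : Point F A C := (σ : C →ₐ[F] C).comp x

theorem Point.twist_apply (σ : C ≃ₐ[F] C) (x : Point F A C) (a : A) :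
    Point.twist σ x a = σ (x a) := rfl

theorem Point.twist_twist_symm (σ : C ≃ₐ[F] C) (x : Point F A C) :
    Point.twist σ (Point.twist σ.symm x) = x :=
  AlgHom.ext fun a => σ.apply_symm_apply (x a)

theorem Point.twist_symm_twist (σ : C ≃ₐ[F] C) (x : Point F A C) :
    Point.twist σ.symm (Point.twist σ x) = x :=
  AlgHom.ext fun a => σ.symm_apply_apply (x a)

/-- The conjugate by `σ` of a map from an affinoid variety to `𝔛`. -/
def twistMap (σ : C ≃ₐ[F] C) (hσ : IsNormPower σ) (Z : AffinoidSet C)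
    (φ : Z.carrier → Point F A C) (w : (Z.twist σ hσ).carrier) : Point F A C :=
  Point.twist σ (φ ⟨fun i => σ.symm (w.1 i), w.2⟩)

theorem IsMorphism.twist {σ : C ≃ₐ[F] C} (hσ : IsNormPower σ) {Z : AffinoidSet C}
    {φ : Z.carrier → Point F A C} (hφ : IsMorphism Z φ) :
    IsMorphism (Z.twist σ hσ) (twistMap σ hσ Z φ) := fun a =>
  IsPolyLimit.twist hσ (n := Z.dim) (Z := Z.carrier) (f := fun z => φ z a) (hφ a) fun z' =>
    ⟨⟨fun i => σ.symm (z'.1 i), z'.2⟩, fun _ => by simp, rfl⟩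

/-- The map from `Z` to its conjugate by `σ⁻¹`. -/
def untwist (σ : C ≃ₐ[F] C) (hσ : IsNormPower σ) (Z : AffinoidSet C) (z : Z.carrier) :
    (Z.twist σ.symm hσ.symm).carrier :=
  ⟨fun i => σ.symm (z.1 i), by
    change (fun i => σ.symm.symm (σ.symm (z.1 i))) ∈ Z.carrier
    simp⟩

theorem twistMap_untwist (σ : C ≃ₐ[F] C) (hσ : IsNormPower σ) (Z : AffinoidSet C)
    (φ : Z.carrier → Point F A C) (z : Z.carrier) :
    twistMap σ.symm hσ.symm Z φ (untwist σ hσ Z z) = Point.twist σ.symm (φ z) := by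
  unfold twistMap untwist
  simp

theorem functions_untwist (σ : C ≃ₐ[F] C) (hσ : IsNormPower σ) (Z : AffinoidSet C)
    {f : (Z.twist σ.symm hσ.symm).carrier → C} (hf : f ∈ (Z.twist σ.symm hσ.symm).functions) :
    (fun z => σ (f (untwist σ hσ Z z))) ∈ Z.functions :=
  IsPolyLimit.twist hσ (n := Z.dim) (Z := (Z.twist σ.symm hσ.symm).carrier) (f := f) hf fun z' =>
    ⟨untwist σ hσ Z z', fun _ => (σ.apply_symm_apply _).symm, rfl⟩

/-- The semilinear map `f ↦ σ ∘ f ∘ σ⁻¹` on analytic functions. -/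
def Hol.twist (σ : C ≃ₐ[F] C) (hσ : IsNormPower σ) {U U' : Set (Point F A C)}
    (h : ∀ x ∈ U', Point.twist σ.symm x ∈ U) : Hol U →+* Hol U' where
  toFun f := ⟨fun x => σ (f.1 ⟨Point.twist σ.symm x.1, h x.1 x.2⟩), fun Z φ hφ hU => by
    have h1 : ∀ w, twistMap σ.symm hσ.symm Z φ w ∈ U := fun w => h _ (hU _)
    have h2 := functions_untwist σ hσ Z (f.2 _ _ (hφ.twist hσ.symm) h1)
    convert h2 using 4 with z
    simp only [twistMap_untwist]⟩
  map_one' := Subtype.ext (funext fun _ => map_one σ)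
  map_mul' _ _ := Subtype.ext (funext fun _ => map_mul σ _ _)
  map_zero' := Subtype.ext (funext fun _ => map_zero σ)
  map_add' _ _ := Subtype.ext (funext fun _ => map_add σ _ _)

theorem mem_closedDisc_twist {σ : C ≃ₐ[F] C} (hσ : IsNormPower σ) (c : C) (x : Point F A C) :
    Point.twist σ.symm x ∈ closedDisc c ↔ x ∈ closedDisc (σ c) := by
  refine forall_congr' fun a => ?_
  rw [← norm_pow, ← norm_pow, Point.twist_apply, ← map_pow]
  rw [← hσ.norm_le_iff, σ.apply_symm_apply]

theorem IsRationalSubdomain.twist {σ : C ≃ₐ[F] C} (hσ : IsNormPower σ) {V : Set (Point F A C)}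
    (hV : IsRationalSubdomain V) : IsRationalSubdomain (Point.twist σ.symm ⁻¹' V) := by
  obtain ⟨c, hc, W, hW, rfl⟩ := hV
  refine ⟨σ c, by simpa using hc, _, hW.twist hσ (S' := closedDisc (F := F) (A := A) (σ c))
    (fun x => ⟨Point.twist σ.symm x.1, (mem_closedDisc_twist hσ c x.1).2 x.2⟩)
    (fun f hf => (Hol.twist σ hσ (fun x hx => (mem_closedDisc_twist hσ c x).2 hx) ⟨f, hf⟩).2), ?_⟩
  ext x
  constructor
  · rintro ⟨y, hy, hyx⟩
    refine ⟨⟨x, (mem_closedDisc_twist hσ c x).1 (hyx ▸ y.2)⟩, ?_, rfl⟩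
    rw [Set.mem_preimage]
    convert hy
    exact hyx.symm
  · rintro ⟨y, hy, rfl⟩
    exact ⟨_, hy, rfl⟩

theorem IsAdmissibleFamily.twist {σ : C ≃ₐ[F] C} (hσ : IsNormPower σ) {U : Set (Point F A C)}
    {𝒱 : Set (Set (Point F A C))} (h : IsAdmissibleFamily U 𝒱) :
    IsAdmissibleFamily (Point.twist σ.symm ⁻¹' U) (Set.preimage (Point.twist σ.symm) '' 𝒱) := by
  intro Z φ hφ hU
  obtain ⟨𝒲, hfin, hrat, hun, href⟩ := h _ _ (hφ.twist hσ.symm) (fun w => hU _)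
  refine ⟨Set.preimage (untwist σ hσ Z) '' 𝒲, hfin.image _, ?_, ?_, ?_⟩
  · rintro _ ⟨W, hW, rfl⟩
    exact (hrat W hW).twist hσ _ fun f hf => functions_untwist σ hσ Z hf
  · rw [Set.eq_univ_iff_forall]
    intro z
    obtain ⟨W, hW, hz⟩ := (Set.eq_univ_iff_forall.1 hun) (untwist σ hσ Z z)
    exact ⟨_, ⟨W, hW, rfl⟩, hz⟩
  · rintro _ ⟨W, hW, rfl⟩
    obtain ⟨V, hV, hWV⟩ := href W hW
    refine ⟨_, ⟨V, hV, rfl⟩, fun z hz => ?_⟩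
    have := hWV _ hz
    rwa [twistMap_untwist] at this

theorem IsAdmissible.twist {σ : C ≃ₐ[F] C} (hσ : IsNormPower σ) {U : Set (Point F A C)}
    (hU : IsAdmissible U) : IsAdmissible (Point.twist σ.symm ⁻¹' U) := by
  obtain ⟨𝒱, hrat, rfl, hadm⟩ := hU
  refine ⟨Set.preimage (Point.twist σ.symm) '' 𝒱, ?_, ?_, hadm.twist hσ⟩
  · rintro _ ⟨V, hV, rfl⟩
    exact (hrat V hV).twist hσ
  · ext x
    simp

theorem Hol.twist_mem_regular {σ : C ≃ₐ[F] C} (hσ : IsNormPower σ) (U : AdmOpen F A C)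
    (h : ∀ x ∈ U.carrier, Point.twist σ.symm x ∈ U.carrier) :
    regular U ≤ (regular U).comap (Hol.twist σ hσ h) := by
  intro b hb V hV
  let V' : AdmOpen F A C := ⟨Point.twist σ.symm.symm ⁻¹' V.carrier, V.isAdmissible.twist hσ.symm⟩
  have hmem : ∀ x ∈ V.carrier, Point.twist σ.symm x ∈ V'.carrier := fun x hx => by
    change Point.twist σ.symm.symm (Point.twist σ.symm x) ∈ V.carrier
    rwa [Point.twist_symm_twist]
  have hV' : V' ≤ U := fun x hx => by
    have := h _ (hV hx)
    rwa [Point.twist_twist_symm σ.symm x] at this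
  have hreg := hb V' hV'
  rw [mem_nonZeroDivisors_iff_right] at hreg ⊢
  intro g hg
  let g' : Hol V'.carrier := Hol.twist σ.symm hσ.symm (fun x hx => hx) g
  have hg' : g' = 0 := by
    refine hreg g' (Hol.ext fun x hx => ?_)
    have e := congrArg (fun f : Hol V.carrier => σ.symm (f.eval (Point.twist σ.symm.symm x) hx)) hg
    change σ.symm (g.eval _ _ * σ (b.1 ⟨Point.twist σ.symm (Point.twist σ.symm.symm x), _⟩))
      = σ.symm 0 at e
    change σ.symm (g.eval _ _) * b.1 ⟨x, _⟩ = 0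
    rw [map_mul, σ.symm_apply_apply, map_zero] at e
    convert e
    exact (Point.twist_twist_symm σ.symm x).symm
  refine Hol.ext fun x hx => ?_
  have e := congrArg (fun f : Hol V'.carrier => σ (f.eval (Point.twist σ.symm x) (hmem x hx))) hg'
  change σ (σ.symm (g.1 ⟨Point.twist σ.symm.symm (Point.twist σ.symm x), _⟩)) = σ 0 at e
  rw [σ.apply_symm_apply, map_zero] at e
  change g.1 ⟨x, hx⟩ = 0
  convert e
  exact (Point.twist_twist_symm σ x).symm

end Twist

/-! ## The costable site -/

section Costable

variable (F A C : Type u) [Field F] [Fintype F] [CommRing A] [Algebra F A] [NormedField C]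
  [IsAlgClosed C] [Algebra F C]

/-- The `q`-Frobenius automorphism of `C`, where `q = #F`. -/
def frob : C ≃ₐ[F] C :=
  AlgEquiv.ofBijective (FiniteField.frobeniusAlgHom F C)
    ⟨(FiniteField.frobeniusAlgHom F C).toRingHom.injective, fun x => by
      obtain ⟨z, hz⟩ := IsAlgClosed.exists_pow_nat_eq x (Fintype.card_pos (α := F))
      exact ⟨z, hz⟩⟩

variable {F C} in
theorem frob_apply (c : C) : frob F C c = c ^ Fintype.card F := rfl

theorem isNormPower_frob : IsNormPower (frob F C) :=
  ⟨Fintype.card F, by exact_mod_cast Fintype.card_pos, fun c => by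
    rw [frob_apply, norm_pow, Real.rpow_natCast]⟩

/-- The category `Cat^τ 𝔛` of costable admissible opens: those with `U ⊆ τ U`, where `τ` sends a
point `x : A → C` to `Frob ∘ x` (if `A = F[t]`, the point `t = θ` is sent to `t = θ ^ q`). -/
structure CostableOpen extends AdmOpen F A C where
  costable : carrier ⊆ Point.twist (frob F C) '' carrier

variable {F A C}

instance : PartialOrder (CostableOpen F A C) :=
  PartialOrder.lift CostableOpen.toAdmOpen (by rintro ⟨U, _⟩ ⟨V, _⟩ rfl; rfl)

theorem CostableOpen.twist_symm_mem (U : CostableOpen F A C) :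
    ∀ x ∈ U.carrier, Point.twist (frob F C).symm x ∈ U.carrier := fun x hx => by
  obtain ⟨y, hy, rfl⟩ := U.costable hx
  rwa [Point.twist_symm_twist]

/-- The map `f ↦ f⁽¹⁾` on `𝒪_𝔛(U)`: the composite of `𝒪_𝔛(U) → 𝒪_𝔛(τ U)`,
`f ↦ (τ x ↦ f(x) ^ q)`, with the restriction to `U ⊆ τ U`. -/
def Hol.frobTwist (U : CostableOpen F A C) : Hol U.carrier →+* Hol U.carrier :=
  Hol.twist (frob F C) (isNormPower_frob F C) U.twist_symm_mem

theorem Hol.frobTwist_eval (U : CostableOpen F A C) (f : Hol U.carrier) (x : Point F A C)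
    (hx : x ∈ U.carrier) (hx' : Point.twist (frob F C) x ∈ U.carrier) :
    (Hol.frobTwist U f).eval (Point.twist (frob F C) x) hx' = f.eval x hx ^ Fintype.card F := by
  have e : (⟨Point.twist (frob F C).symm (Point.twist (frob F C) x), U.twist_symm_mem _ hx'⟩ :
      U.carrier) = ⟨x, hx⟩ := Subtype.ext (Point.twist_symm_twist _ x)
  exact congrArg (fun y => f.1 y ^ Fintype.card F) e

/-- The map `f ↦ f⁽¹⁾` on `ℳ_𝔛(U)`. -/
def Mer.frobTwist (U : CostableOpen F A C) : Mer U.toAdmOpen →+* Mer U.toAdmOpen :=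
  IsLocalization.map (Mer U.toAdmOpen) (Hol.frobTwist U)
    (Hol.twist_mem_regular (isNormPower_frob F C) U.toAdmOpen U.twist_symm_mem)

/-- Costable coverings `Cov^τ 𝔛`: admissible coverings of a costable admissible open by costable
admissible opens. -/
def IsCostableCovering (U : CostableOpen F A C) (𝒰 : Set (CostableOpen F A C)) : Prop :=
  IsAdmissibleCovering U.toAdmOpen (CostableOpen.toAdmOpen '' 𝒰)

/-- Sheaves of `R`-modules on the costable site: presheaves on `Cat^τ 𝔛` satisfying the sheaf axiom
for all coverings in `Cov^τ 𝔛`. -/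
def IsCostableSheaf {R : Type u} [CommRing R] (ℰ : (CostableOpen F A C)ᵒᵖ ⥤ ModuleCat.{u} R) :
    Prop :=
  ∀ (U : CostableOpen F A C) (𝒰 : Set (CostableOpen F A C)), IsCostableCovering U 𝒰 →
    Presieve.IsSheafFor (ℰ ⋙ forget (ModuleCat.{u} R)) (X := U) (fun V _ => V ∈ 𝒰)

variable (F A C) in
/-- The affinoid unit disk `𝔇 = 𝔛_1`. -/
def disk : CostableOpen F A C where
  carrier := closedDisc 1
  isAdmissible := by
    refine ⟨{closedDisc 1}, ?_, by simp, ?_⟩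
    · rintro _ rfl
      exact ⟨1, one_ne_zero, Set.univ, isRational_univ _, by simp⟩
    · intro Z φ _ hU
      exact ⟨{Set.univ}, Set.finite_singleton _, by rintro _ rfl; exact isRational_univ _, by simp,
        by rintro _ rfl; exact ⟨_, rfl, fun z _ => hU z⟩⟩
  costable := fun x hx => by
    refine ⟨Point.twist (frob F C).symm x, ?_, Point.twist_twist_symm _ x⟩
    rw [mem_closedDisc_twist (isNormPower_frob F C), map_one]
    exact hx

end Costable

/-! ## Effective fractional ideal sheaves -/

section Sheaves

variable (F A C : Type u) [Field F] [Fintype F] [CommRing A] [Algebra F A] [NormedField C]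
  [Algebra F C]

/-- A sub-`𝒪_𝔛`-module sheaf `𝓛` of `ℳ_𝔛` (for the strong Grothendieck topology) that contains
`𝒪_𝔛`. -/
structure FractionalSheaf where
  sections : ∀ U : AdmOpen F A C, Submodule (Hol U.carrier) (Mer U)
  res_mem : ∀ {V U : AdmOpen F A C} (h : V ≤ U) (m : Mer U), m ∈ sections U →
    Mer.res h m ∈ sections V
  glue : ∀ (U : AdmOpen F A C) (𝒰 : Set (AdmOpen F A C)) (h𝒰 : IsAdmissibleCovering U 𝒰)
    (s : ∀ V : 𝒰, Mer V.1), (∀ V, s V ∈ sections V.1) →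
    (∀ (V V' : 𝒰) (W : AdmOpen F A C) (hW : W ≤ V.1) (hW' : W ≤ V'.1),
      Mer.res hW (s V) = Mer.res hW' (s V')) →
    ∃! m : Mer U, m ∈ sections U ∧ ∀ V : 𝒰, Mer.res (h𝒰.1 V.1 V.2) m = s V
  effective : ∀ (U : AdmOpen F A C) (f : Hol U.carrier),
    algebraMap (Hol U.carrier) (Mer U) f ∈ sections U

variable {F A C}

/-- `𝓛` is costable: `𝓛(U)⁽¹⁾ ⊆ 𝓛(U)` for all costable `U`. -/
def FractionalSheaf.IsCostable [IsAlgClosed C] (L : FractionalSheaf F A C) : Prop :=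
  ∀ (U : CostableOpen F A C) (m : Mer U.toAdmOpen), m ∈ L.sections U.toAdmOpen →
    Mer.frobTwist U m ∈ L.sections U.toAdmOpen

/-- The `A`-linear map `(A ⊗ C)^d → 𝓛(U)^d`. -/
def FractionalSheaf.ofTensor (L : FractionalSheaf F A C) (d : ℕ) (U : AdmOpen F A C) :
    (Fin d → A ⊗[F] C) →ₗ[A] (Fin d → L.sections U) where
  toFun f i := ⟨algebraMap (Hol U.carrier) (Mer U) (Hol.ofTensor U.carrier (f i)),
    L.effective U _⟩
  map_add' f g := by
    ext i
    simp
  map_smul' a f := by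
    ext i
    simp only [Pi.smul_apply, map_smul, RingHom.id_apply, Submodule.coe_smul_of_tower]
    rw [Algebra.smul_def, map_mul, ← IsScalarTower.algebraMap_apply, Algebra.smul_def]

end Sheaves

/-! ## Anderson modules -/

section Anderson

variable {F A C : Type u} [Field F] [Fintype F] [CommRing A] [Algebra F A] [NormedField C]
  [Algebra F C]

variable (F) in
/-- A choice of coordinates `κ : E ≅ 𝔾ₐ^d`: an isomorphism of `F`-vector space schemes over `C`,
that is an `F`-linear isomorphism `E(R) ≅ R^d`, natural in the `C`-algebra `R`. -/
structure Coordinates (E : CommAlgCat.{u} C ⥤ ModuleCat.{u} A) (d : ℕ) where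
  equiv : ∀ R : CommAlgCat.{u} C, E.obj R ≃+ (Fin d → R)
  map_smul : ∀ (R : CommAlgCat.{u} C) (r : F) (v : E.obj R),
    equiv R (algebraMap F A r • v) = algebraMap F C r • equiv R v
  natural : ∀ {R S : CommAlgCat.{u} C} (f : R ⟶ S) (v : E.obj R) (i : Fin d),
    equiv S (E.map f v) i = f (equiv R v i)

/-- An Anderson `A`-module of dimension `d` over `C` with characteristic morphism `ℓ : A → C`:
an `A`-module scheme `E` (given by its functor of points) such that
* `E` is isomorphic to `𝔾ₐ^d` as an `F`-vector space scheme (in particular `E` is representable);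
* for all `a ∈ A`, the endomorphism `∂a - ℓ(a)` of `Lie_E(C) = ker (E(C[ε]) → E(C))` is nilpotent,
  where `∂a` is the action of `a`, and `c ∈ C` acts through the morphism `ε ↦ c ε` of `C[ε]`. -/
structure AndersonModule (ℓ : A →ₐ[F] C) (d : ℕ) where
  functor : CommAlgCat.{u} C ⥤ ModuleCat.{u} A
  exists_coordinates : Nonempty (Coordinates F functor d)
  nilpotent : ∀ a : A, ∃ n : ℕ, ∀ v : functor.obj (CommAlgCat.of C (DualNumber C)),
    functor.map (CommAlgCat.ofHom (TrivSqZeroExt.fstHom C C C)) v = 0 →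
      ((LinearMap.lsmul A (functor.obj (CommAlgCat.of C (DualNumber C))) a -
        (functor.map (CommAlgCat.ofHom
          (TrivSqZeroExt.map (LinearMap.lsmul C C (ℓ a))))).hom) ^ n) v = 0

variable {ℓ : A →ₐ[F] C} {d : ℕ}

/-- The `A`-module `E(C)`. -/
def AndersonModule.Points (E : AndersonModule ℓ d) : Type u := E.functor.obj (CommAlgCat.of C C)

instance (E : AndersonModule ℓ d) : AddCommGroup E.Points :=
  inferInstanceAs (AddCommGroup (E.functor.obj (CommAlgCat.of C C)))

instance (E : AndersonModule ℓ d) : Module A E.Points :=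
  inferInstanceAs (Module A (E.functor.obj (CommAlgCat.of C C)))

instance (E : AndersonModule ℓ d) : Module F E.Points := Module.compHom _ (algebraMap F A)

instance (E : AndersonModule ℓ d) : IsScalarTower F A E.Points :=
  IsScalarTower.of_algebraMap_smul fun _ _ => rfl

/-- The tensor product `A ⊗ E(C)` over `F`. -/
def AndersonModule.Tensor (E : AndersonModule ℓ d) : Type u := A ⊗[F] E.Points

instance (E : AndersonModule ℓ d) : AddCommGroup E.Tensor :=
  inferInstanceAs (AddCommGroup (A ⊗[F] E.Points))

/-- The `A ⊗ A`-module structure of `A ⊗ E(C)`: `(a ⊗ b) • (x ⊗ e) = a x ⊗ b e`. -/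
instance (E : AndersonModule ℓ d) : Module (A ⊗[F] A) E.Tensor :=
  Module.compHom (A ⊗[F] E.Points)
    ((Module.endTensorEndAlgHom (R := F) (S := F) (A := F) (M := A) (N := E.Points)).comp
      (Algebra.TensorProduct.map (Algebra.lmul F A) (Algebra.lsmul F F E.Points))).toRingHom

/-- The pure tensor `a ⊗ e`. -/
def AndersonModule.tmul (E : AndersonModule ℓ d) (a : A) (e : E.Points) : E.Tensor :=
  (a ⊗ₜ[F] e : A ⊗[F] E.Points)

theorem AndersonModule.tmul_smul_tmul (E : AndersonModule ℓ d) (a b x : A) (e : E.Points) :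
    (a ⊗ₜ[F] b : A ⊗[F] A) • E.tmul x e = E.tmul (a * x) (b • e) := rfl

theorem AndersonModule.tensor_induction (E : AndersonModule ℓ d) {p : E.Tensor → Prop}
    (h0 : p 0) (h1 : ∀ a e, p (E.tmul a e)) (h2 : ∀ v w, p v → p w → p (v + w)) (v : E.Tensor) :
    p v :=
  TensorProduct.induction_on (motive := p) v h0 h1 h2

variable {E : AndersonModule ℓ d}

/-- The coordinates on `C`-points, as an `F`-linear isomorphism. -/
def Coordinates.points (κ : Coordinates F E.functor d) : E.Points ≃ₗ[F] (Fin d → C) :=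
  { κ.equiv (CommAlgCat.of C C) with
    map_smul' := fun r v => by
      have := κ.map_smul (CommAlgCat.of C C) r v
      rw [algebraMap_smul] at this
      exact this }

/-- The isomorphism `A ⊗ E(C) ≅ (A ⊗ C)^d` induced by `κ`. -/
def Coordinates.tensor (κ : Coordinates F E.functor d) : E.Tensor ≃+ (Fin d → A ⊗[F] C) :=
  ((TensorProduct.AlgebraTensorModule.congr (LinearEquiv.refl A A) κ.points).trans
    (TensorProduct.piRight F A A fun _ : Fin d => C)).toAddEquiv

theorem Coordinates.tensor_tmul (κ : Coordinates F E.functor d) (a : A) (e : E.Points)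
    (i : Fin d) : κ.tensor (E.tmul a e) i = a ⊗ₜ[F] κ.points e i := rfl

theorem Coordinates.tensor_smul (κ : Coordinates F E.functor d) (a : A) (v : E.Tensor) :
    κ.tensor ((a ⊗ₜ[F] (1 : A) : A ⊗[F] A) • v) = a • κ.tensor v := by
  induction v using E.tensor_induction with
  | h0 => rw [smul_zero, map_zero, smul_zero]
  | h1 x e =>
    rw [AndersonModule.tmul_smul_tmul, one_smul]
    ext i
    rw [Pi.smul_apply, Coordinates.tensor_tmul, Coordinates.tensor_tmul, TensorProduct.smul_tmul',
      smul_eq_mul]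
  | h2 v w hv hw => rw [smul_add, map_add, hv, hw, map_add, smul_add]

/-- The restriction of an `A ⊗ A`-module to an `A`-module through `a ↦ a ⊗ 1`. -/
abbrev restrictLeft (F A : Type u) [Field F] [CommRing A] [Algebra F A] :
    ModuleCat.{u} (A ⊗[F] A) ⥤ ModuleCat.{u} A :=
  ModuleCat.restrictScalars (Algebra.TensorProduct.includeLeftRingHom : A →+* A ⊗[F] A)

/-- The `A`-linear map `κ⁻¹ : (A ⊗ C)^d → A ⊗ E(C)`. -/
def Coordinates.invHom (κ : Coordinates F E.functor d) :
    ModuleCat.of A (Fin d → A ⊗[F] C) ⟶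
      (restrictLeft F A).obj (ModuleCat.of (A ⊗[F] A) E.Tensor) :=
  ModuleCat.ofHom (Y := (restrictLeft F A).obj (ModuleCat.of (A ⊗[F] A) E.Tensor))
    { toFun := fun f => κ.tensor.symm f
      map_add' := fun f g => map_add κ.tensor.symm f g
      map_smul' := fun a f => by
        change κ.tensor.symm (a • f) = (a ⊗ₜ[F] (1 : A)) • κ.tensor.symm f
        rw [AddEquiv.symm_apply_eq, Coordinates.tensor_smul, AddEquiv.apply_symm_apply] }

variable (C) in
/-- A matrix `∑ Pⱼ τʲ` of size `d` of `τ`-polynomials over `C`. -/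
abbrev TauMatrix (d : ℕ) : Type u := ℕ →₀ Matrix (Fin d) (Fin d) C

/-- The matrix `P = ∑ Pⱼ τʲ` represents the endomorphism `ψ` of `𝔾ₐ^d`, i.e.
`ψ(v) = ∑ Pⱼ v^(qʲ)` on `R`-points, for all `C`-algebras `R`. -/
def TauMatrix.Represents (F : Type u) [Fintype F] (P : TauMatrix C d)
    (ψ : ∀ R : CommAlgCat.{u} C, (Fin d → R) → (Fin d → R)) : Prop :=
  ∀ (R : CommAlgCat.{u} C) (v : Fin d → R) (i : Fin d),
    ψ R v i = P.sum fun j M => ∑ k, algebraMap C R (M i k) * v k ^ (Fintype.card F) ^ j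

/-- The endomorphism `φ_κ(b)` of `𝔾ₐ^d` by which `b ∈ A` acts on `E` in the coordinates `κ`. -/
def Coordinates.action (κ : Coordinates F E.functor d) (b : A) (R : CommAlgCat.{u} C)
    (v : Fin d → R) : Fin d → R :=
  κ.equiv R (b • (κ.equiv R).symm v)

/-- The automorphism `κ' ∘ κ⁻¹` of `𝔾ₐ^d`. -/
def Coordinates.change (κ κ' : Coordinates F E.functor d) (R : CommAlgCat.{u} C)
    (v : Fin d → R) : Fin d → R :=
  κ'.equiv R ((κ.equiv R).symm v)

/-- The action `G ↦ ∑ Pⱼ G⁽ʲ⁾` of a matrix of `τ`-polynomials on vectors of meromorphic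
functions on a costable admissible open. -/
def TauMatrix.act [IsAlgClosed C] (P : TauMatrix C d) (U : CostableOpen F A C)
    (G : Fin d → Mer U.toAdmOpen) : Fin d → Mer U.toAdmOpen :=
  fun i => P.sum fun j M => ∑ k, M i k • (Mer.frobTwist U)^[j] (G k)

end Anderson

/-! ## `E(C)`-valued functions -/

section EValued

variable {F A C : Type u} [Field F] [Fintype F] [CommRing A] [Algebra F A] [NormedField C]
  [IsAlgClosed C] [Algebra F C] {ℓ : A →ₐ[F] C} {d : ℕ}

/-- A pair consisting of a presheaf `ℰ` of `A ⊗ A`-modules on the costable site and of a family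
`ι(U) : A ⊗ E(C) → ℰ(U)` of `A ⊗ A`-linear maps. -/
structure EPair (E : AndersonModule ℓ d) where
  presheaf : (CostableOpen F A C)ᵒᵖ ⥤ ModuleCat.{u} (A ⊗[F] A)
  ι : ∀ U : CostableOpen F A C,
    ModuleCat.of (A ⊗[F] A) E.Tensor ⟶ presheaf.obj (Opposite.op U)

variable {E : AndersonModule ℓ d}

/-- Identifications of `ℰ` with `𝓛^d` for the choice of coordinates `κ`: isomorphisms of `A`-modules
`κ(U) : ℰ(U) ≅ 𝓛(U)^d` fitting in a pushout square of `A`-modules with `κ⁻¹`, `ι(U)` and the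
canonical map `(A ⊗ C)^d → 𝓛(U)^d`; they are compatible with restrictions, and
they are `A ⊗ A`-linear when `1 ⊗ b` acts on `𝓛(U)^d` through `φ_κ(b)`. -/
structure Comparison (L : FractionalSheaf F A C) (P : EPair E) (κ : Coordinates F E.functor d) where
  iso : ∀ U : CostableOpen F A C, (restrictLeft F A).obj (P.presheaf.obj (Opposite.op U)) ≅
    ModuleCat.of A (Fin d → L.sections U.toAdmOpen)
  isPushout : ∀ U : CostableOpen F A C,
    IsPushout κ.invHom (ModuleCat.ofHom (L.ofTensor d U.toAdmOpen))
      ((restrictLeft F A).map (P.ι U)) (iso U).inv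
  res_iso : ∀ {V U : CostableOpen F A C} (h : V ≤ U) (e : P.presheaf.obj (Opposite.op U))
    (i : Fin d),
    ((iso V).hom (P.presheaf.map (homOfLE h).op e) i : Mer V.toAdmOpen) =
      Mer.res h ((iso U).hom e i : Mer U.toAdmOpen)
  iso_smul : ∀ (b : A) (M : TauMatrix C d), M.Represents F (κ.action b) →
    ∀ (U : CostableOpen F A C) (e : P.presheaf.obj (Opposite.op U)) (i : Fin d),
      ((iso U).hom (((1 : A) ⊗ₜ[F] b : A ⊗[F] A) • e) i : Mer U.toAdmOpen) =
        M.act U (fun k => ((iso U).hom e k : Mer U.toAdmOpen)) i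

/-- `(ℰ, ι)` is a sheaf of `E(C)`-valued functions with respect to `𝓛`. -/
def IsEValuedSheaf (L : FractionalSheaf F A C) (P : EPair E) : Prop :=
  IsCostableSheaf P.presheaf ∧ ∀ κ : Coordinates F E.functor d, Nonempty (Comparison L P κ)

/-- A family of identifications of `ℰ` with `𝓛^d`, one for each choice of coordinates, such that
the identifications for `κ` and `κ'` differ by the action of `κ' ∘ κ⁻¹`. -/
structure ComparisonSystem (L : FractionalSheaf F A C) (P : EPair E) where
  comparison : ∀ κ : Coordinates F E.functor d, Comparison L P κ
  coherent : ∀ (κ κ' : Coordinates F E.functor d) (M : TauMatrix C d),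
    M.Represents F (κ.change κ') →
      ∀ (U : CostableOpen F A C) (e : P.presheaf.obj (Opposite.op U)) (i : Fin d),
        (((comparison κ').iso U).hom e i : Mer U.toAdmOpen) =
          M.act U (fun k => (((comparison κ).iso U).hom e k : Mer U.toAdmOpen)) i

end EValued

/-! ## The completed tensor product `A ⊗̂ E(C)` -/

section Completion

variable {F A C : Type u} [Field F] [CommRing A] [Algebra F A] [NormedField C] [Algebra F C]

/-- `f ∈ A ⊗ C` is a finite sum of tensors `aᵢ ⊗ cᵢ` with `max |cᵢ| ≤ r`. -/
def HasRepresentation (f : A ⊗[F] C) (r : ℝ) : Prop :=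
  0 ≤ r ∧ ∃ (n : ℕ) (a : Fin n → A) (c : Fin n → C), f = ∑ i, a i ⊗ₜ[F] c i ∧ ∀ i, ‖c i‖ ≤ r

theorem exists_hasRepresentation (f : A ⊗[F] C) : ∃ r, HasRepresentation f r := by
  induction f using TensorProduct.induction_on with
  | zero => exact ⟨0, le_rfl, 0, Fin.elim0, Fin.elim0, by simp, fun i => i.elim0⟩
  | tmul a c => exact ⟨‖c‖, norm_nonneg _, 1, fun _ => a, fun _ => c, by simp, fun _ => le_rfl⟩
  | add f g hf hg =>
    obtain ⟨r, hr, n, a, c, rfl, hc⟩ := hf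
    obtain ⟨s, hs, m, b, e, rfl, he⟩ := hg
    refine ⟨max r s, hr.trans (le_max_left _ _), n + m, Fin.append a b, Fin.append c e, ?_, ?_⟩
    · simp [Fin.sum_univ_add]
    · intro i
      refine Fin.addCases (fun j => ?_) (fun j => ?_) i
      · rw [Fin.append_left]; exact (hc j).trans (le_max_left _ _)
      · rw [Fin.append_right]; exact (he j).trans (le_max_right _ _)

theorem HasRepresentation.add {f g : A ⊗[F] C} {r s : ℝ} (hf : HasRepresentation f r)
    (hg : HasRepresentation g s) : HasRepresentation (f + g) (r + s) := by
  obtain ⟨hr, n, a, c, rfl, hc⟩ := hf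
  obtain ⟨hs, m, b, e, rfl, he⟩ := hg
  refine ⟨by positivity, n + m, Fin.append a b, Fin.append c e, by simp [Fin.sum_univ_add], ?_⟩
  intro i
  refine Fin.addCases (fun j => ?_) (fun j => ?_) i
  · rw [Fin.append_left]; linarith [hc j]
  · rw [Fin.append_right]; linarith [he j]

theorem HasRepresentation.neg {f : A ⊗[F] C} {r : ℝ} (hf : HasRepresentation f r) :
    HasRepresentation (-f) r := by
  obtain ⟨hr, n, a, c, rfl, hc⟩ := hf
  exact ⟨hr, n, a, fun i => -c i, by simp [TensorProduct.tmul_neg], by simpa using hc⟩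

/-- The Gauss norm `‖f‖ = inf (max |cᵢ|)` on `A ⊗ C`, the infimum being over all representations
`f = ∑ aᵢ ⊗ cᵢ`. -/
def gaussNorm (f : A ⊗[F] C) : ℝ := sInf {r | HasRepresentation f r}

theorem bddBelow_hasRepresentation (f : A ⊗[F] C) : BddBelow {r | HasRepresentation f r} :=
  ⟨0, fun _ h => h.1⟩

variable (F A C) in
/-- The Gauss norm as a seminorm on the additive group `A ⊗ C`. -/
def gaussSeminorm : AddGroupSeminorm (A ⊗[F] C) where
  toFun := gaussNorm
  map_zero' := le_antisymm
    (csInf_le (bddBelow_hasRepresentation _)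
      ⟨le_rfl, 0, Fin.elim0, Fin.elim0, by simp, fun i => i.elim0⟩)
    (Real.sInf_nonneg fun _ h => h.1)
  add_le' f g := by
    refine le_of_forall_pos_lt_add fun ε hε => ?_
    obtain ⟨r, hr, hr'⟩ := exists_lt_of_csInf_lt (exists_hasRepresentation f)
      (lt_add_of_pos_right (gaussNorm f) (half_pos hε))
    obtain ⟨s, hs, hs'⟩ := exists_lt_of_csInf_lt (exists_hasRepresentation g)
      (lt_add_of_pos_right (gaussNorm g) (half_pos hε))
    have : gaussNorm (f + g) ≤ r + s :=
      csInf_le (bddBelow_hasRepresentation _) (HasRepresentation.add hr hs)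
    linarith
  neg' f := by
    unfold gaussNorm
    congr 1
    ext r
    exact ⟨fun h => by simpa using HasRepresentation.neg h, fun h => HasRepresentation.neg h⟩

variable (F A C) in
/-- `A ⊗ C` with the Gauss norm. -/
def GaussTensor : Type u := A ⊗[F] C

instance : SeminormedAddCommGroup (GaussTensor F A C) :=
  AddGroupSeminorm.toSeminormedAddCommGroup (E := A ⊗[F] C) (gaussSeminorm F A C)

variable {ℓ : A →ₐ[F] C} {d : ℕ} {E : AndersonModule ℓ d}

/-- `A ⊗ E(C)` with the metric obtained from the Gauss norm (and the maximum norm on `(A ⊗ C)^d`)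
through the coordinates `κ`. -/
def Coordinates.MetricTensor (_ : Coordinates F E.functor d) : Type u := E.Tensor

instance (κ : Coordinates F E.functor d) : AddCommGroup κ.MetricTensor :=
  inferInstanceAs (AddCommGroup E.Tensor)

instance (κ : Coordinates F E.functor d) : SeminormedAddCommGroup κ.MetricTensor :=
  SeminormedAddCommGroup.induced κ.MetricTensor (Fin d → GaussTensor F A C)
    (κ.tensor.toAddMonoidHom : E.Tensor →+ (Fin d → A ⊗[F] C))

/-- The uniform structure on `A ⊗ E(C)` defined by the metric attached to `κ`. -/
@[reducible]
def Coordinates.uniformSpace (κ : Coordinates F E.functor d) : UniformSpace E.Tensor :=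
  inferInstanceAs (UniformSpace κ.MetricTensor)

/-- The completion `A ⊗̂ E(C)` of `A ⊗ E(C)`. -/
abbrev Coordinates.CompletedTensor (κ : Coordinates F E.functor d) : Type u :=
  UniformSpace.Completion κ.MetricTensor

/-- The canonical map `A ⊗ E(C) → A ⊗̂ E(C)`. -/
def Coordinates.toCompletion (κ : Coordinates F E.functor d) (v : E.Tensor) : κ.CompletedTensor :=
  UniformSpace.Completion.coe' (show κ.MetricTensor from v)

/-- Multiplication by `r ∈ A ⊗ A` on `A ⊗ E(C)`. -/
def Coordinates.mulMap (κ : Coordinates F E.functor d) (r : A ⊗[F] A) (v : κ.MetricTensor) :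
    κ.MetricTensor :=
  r • (show E.Tensor from v)

variable [Fintype F] [IsAlgClosed C]

/-- The additive map `c : A ⊗̂ E(C) → ℰ(𝔇)` extends `ι(𝔇)`, is `A ⊗ A`-linear (for the action on the
completion obtained by continuity), is injective, and its image corresponds to
`𝒪_𝔛(𝔇)^d ⊆ 𝓛(𝔇)^d` under the identification of `ℰ(𝔇)` with `𝓛(𝔇)^d`. -/
structure IsDiskMap {L : FractionalSheaf F A C} {P : EPair E} {κ : Coordinates F E.functor d}
    (m : Comparison L P κ)
    (c : κ.CompletedTensor →+ P.presheaf.obj (Opposite.op (disk F A C))) : Prop where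
  extends_ι : ∀ v : E.Tensor, c (κ.toCompletion v) = P.ι (disk F A C) v
  map_smul : ∀ (r : A ⊗[F] A) (x : κ.CompletedTensor),
    c (UniformSpace.Completion.map (κ.mulMap r) x) = r • c x
  injective : Function.Injective c
  range_eq : Set.range c = {e | ∀ i, ∃ f : Hol (disk F A C).carrier,
    algebraMap (Hol (disk F A C).carrier) (Mer (disk F A C).toAdmOpen) f =
      ((m.iso (disk F A C)).hom e i : Mer (disk F A C).toAdmOpen)}

end Completion

/-! ## The base curve and the field `ℂ_∞` -/

section Base

/-- `A` is the ring `H⁰(𝒞 ∖ {∞}, 𝒪)` of a smooth projective geometrically irreducible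
curve `𝒞` over `F` with a closed point `∞`; that is, `Spec A` is a smooth geometrically integral
affine curve over `F`, and `∞` is the only place of its function field `K` which does not come from
a point of `Spec A`. The places are given by their valuation rings (every valuation ring of `K`
contains the finite field `F`). -/
structure IsPuncturedCurve (F A : Type u) {K : Type u} [Field F] [CommRing A] [Algebra F A]
    [Field K] [Algebra A K] (place : ValuationSubring K) : Prop where
  smooth : Algebra.Smooth F A
  dim_eq_one : ringKrullDim A = 1
  geometrically_integral : IsDomain (AlgebraicClosure F ⊗[F] A)
  place_iff : ∀ V : ValuationSubring K,
    (V ≠ ⊤ ∧ ¬ ∀ a : A, algebraMap A K a ∈ V) ↔ V = place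

/-- `C`, with `ℓ : A → C`, is the completion `ℂ_∞` of an algebraic closure of the completion `K_∞`
of `K` at `∞`. Here `C` is assumed to be a complete algebraically closed field for a
non-archimedean absolute value; the condition is that the absolute value induces the place `∞` on
`K`, and that the elements of `C` algebraic over the closure `K_∞` of `K` in `C` are dense. -/
structure IsCInfty {F A K C : Type u} [Field F] [CommRing A] [Algebra F A] [Field K] [Algebra A K]
    [NormedField C] [CompleteSpace C] [IsAlgClosed C] [IsUltrametricDist C] [Algebra F C]
    (place : ValuationSubring K) (ℓ : A →ₐ[F] C) : Prop where
  exists_embedding : ∃ j : K →+* C, (∀ a, j (algebraMap A K a) = ℓ a) ∧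
    (∀ x : K, ‖j x‖ ≤ 1 ↔ x ∈ place) ∧
    Dense {x : C | IsAlgebraic j.fieldRange.topologicalClosure x}

end Base

end CostableSite

end

open CostableSite

/-! Work in coordinates. A natural `F`-linear endomorphism of `𝔾ₐ^d` is given by exactly one matrix
of twisted polynomials: its value at the generic point over `C[X]` yields polynomials, and
additivity together with `F`-homogeneity leaves only the exponents `qʲ` (`exists_represents`,
`TauMatrix.Represents.unique`). Consequently `φ_κ` is a ring homomorphism, the matrices `κ'κ⁻¹`
satisfy the cocycle relation, and they intertwine `φ_κ` with `φ_κ'`. Such matrices act wherever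
there is an additive `q`-semilinear `τ`: on `A ⊗ C`, on analytic functions, on meromorphic
functions, on `𝓛(U)`. The canonical maps between these modules respect the actions
(`TauMatrix.apply_map`).

A pair is then obtained from `𝓛^d`, with `1 ⊗ b` acting through `φ_κ(b)`. It is a sheaf because `𝓛`
is one and costable opens are stable under intersection. Since `κ⁻¹` and `κ(U)⁻¹` are isomorphisms,
the pushout condition only says that `ι` is the canonical map in coordinates. Transport by `κ'κ⁻¹`
extends one identification to a coherent system, and an isomorphism compatible with the systems is
forced by a single `κ`.

On the unit disk the Gauss norm is the supremum norm (`norm_toDisk`), and points with values in the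
algebraic closure of `F` already compute it. Values at these points are zero or roots of unity. By
the Nullstellensatz for `AlgebraicClosure F ⊗ A`, the vectors of values of finitely many basis
elements of `A` span, so the coefficients of a tensor are recovered from its values with multipliers
of norm at most one. The disk is itself an affinoid zero locus, so `A ⊗ C` is dense in its complete
algebra. The completion is therefore `𝒪(𝔇)^d`, and linearity extends by continuity.

Uniqueness of `c` needs another argument, as `c` is not assumed continuous. For a point `x` over the
algebraic closure of `F` with ideal `𝔪`, every function on the disk is the sum of an element of `A ⊗
C` and an element of `𝔪 𝒪(𝔇)` (`Hol.exists_decomposition`). The difference of two candidates kills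
`A ⊗ E(C)` and has values in `𝒪(𝔇)^d`, so by linearity those values vanish at `x`. This holds for
all such `x`, and a function vanishing at all of them is zero. -/

noncomputable section

namespace CostableSite

/-! ## Matrices of twisted polynomials -/

section TauAction

variable {C : Type u} [NormedField C] {d : ℕ} {R S : Type*} [AddCommGroup R] [Module C R]
  [AddCommGroup S] [Module C S]

/-- The action `v ↦ ∑ Pⱼ τʲ(v)` of a matrix of twisted polynomials on `Rᵈ`, for a self-map `τ` of a
vector space `R`. -/
def TauMatrix.apply (P : TauMatrix C d) (τ : R → R) (v : Fin d → R) : Fin d → R :=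
  fun i => P.sum fun j M => ∑ k, M i k • τ^[j] (v k)

theorem TauMatrix.apply_add_left (P Q : TauMatrix C d) (τ : R → R) (v : Fin d → R) :
    (P + Q).apply τ v = P.apply τ v + Q.apply τ v := by
  funext i
  refine Finsupp.sum_add_index' (fun j => by simp) (fun j M N => ?_)
  simp [add_smul, Finset.sum_add_distrib]

theorem TauMatrix.apply_single (n : ℕ) (M : Matrix (Fin d) (Fin d) C) (τ : R → R) (v : Fin d → R)
    (i : Fin d) :
    TauMatrix.apply (Finsupp.single n M) τ v i = ∑ k, M i k • τ^[n] (v k) :=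
  Finsupp.sum_single_index (by simp)

theorem TauMatrix.apply_one (τ : R → R) (v : Fin d → R) :
    TauMatrix.apply (Finsupp.single 0 (1 : Matrix (Fin d) (Fin d) C)) τ v = v := by
  funext i
  simp [TauMatrix.apply_single, Matrix.one_apply]

theorem TauMatrix.apply_add_right (P : TauMatrix C d) (τ : R →+ R) (v w : Fin d → R) :
    P.apply τ (v + w) = P.apply τ v + P.apply τ w := by
  funext i
  simp [TauMatrix.apply, Finsupp.sum, Finset.sum_add_distrib, iterate_map_add]

theorem TauMatrix.apply_zero_right (P : TauMatrix C d) (τ : R →+ R) : P.apply τ 0 = 0 := by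
  simpa using P.apply_add_right τ 0 0

/-- This transports the action between modules: restriction maps, the inclusion of `𝓛` in `ℳ` and
the map from `A ⊗ C` to functions are all `C`-linear and commute with `τ`. -/
theorem TauMatrix.apply_map (P : TauMatrix C d) {τ : R → R} {τ' : S → S} (h : R →ₗ[C] S)
    (hτ : ∀ r, h (τ r) = τ' (h r)) (v : Fin d → R) (i : Fin d) :
    h (P.apply τ v i) = P.apply τ' (fun k => h (v k)) i := by
  have : ∀ (j : ℕ) (r : R), h (τ^[j] r) = τ'^[j] (h r) := fun j r =>
    (Function.Semiconj.iterate_right (show Function.Semiconj h τ τ' from hτ) j) r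
  simp [TauMatrix.apply, Finsupp.sum, this]

theorem iterate_smul_of_semilinear {q : ℕ} {τ : R → R} (hτ : ∀ (c : C) r, τ (c • r) = c ^ q • τ r)
    (n : ℕ) (c : C) (r : R) : τ^[n] (c • r) = c ^ q ^ n • τ^[n] r := by
  induction n generalizing c r with
  | zero => simp
  | succ n ih => rw [Function.iterate_succ_apply, hτ, ih, ← pow_mul, ← pow_succ', 
      Function.iterate_succ_apply]

theorem iterate_map_finset_sum (τ : R →+ R) (n : ℕ) {ι : Type*} (s : Finset ι) (f : ι → R) :
    τ^[n] (∑ l ∈ s, f l) = ∑ l ∈ s, τ^[n] (f l) := by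
  induction n generalizing f with
  | zero => simp
  | succ n ih => simp only [Function.iterate_succ_apply, map_sum, ih]

/-- The product of matrices of twisted polynomials, where `τ c = c ^ q τ`. -/
def TauMatrix.comp (q : ℕ) (P Q : TauMatrix C d) : TauMatrix C d :=
  P.sum fun i M => Q.sum fun j N => Finsupp.single (i + j) (M * N.map (· ^ q ^ i))

/-- `TauMatrix.apply` as an additive map of the matrix. -/
def TauMatrix.applyHom (τ : R → R) (v : Fin d → R) : TauMatrix C d →+ (Fin d → R) where
  toFun P := P.apply τ v
  map_zero' := rfl
  map_add' P Q := TauMatrix.apply_add_left P Q τ v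

/-- Moving a scalar `c` across `τⁿ` turns it into `c ^ qⁿ`, which is the twist of the entries of `N`
in `TauMatrix.comp`. Additivity and semilinearity of `τ` suffice, so the product rule holds in every
module used below. -/
theorem TauMatrix.apply_comp {q : ℕ} (P Q : TauMatrix C d) (τ : R →+ R)
    (hτ : ∀ (c : C) r, τ (c • r) = c ^ q • τ r) (v : Fin d → R) :
    (TauMatrix.comp q P Q).apply τ v = P.apply τ (Q.apply τ v) := by
  change TauMatrix.applyHom τ v _ = _
  funext i
  rw [TauMatrix.comp, Finsupp.sum, map_sum, Finset.sum_apply]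
  refine Finset.sum_congr rfl fun n _ => ?_
  rw [Finsupp.sum, map_sum, Finset.sum_apply]
  have : ∀ k, τ^[n] (Q.apply τ v k) =
      ∑ m ∈ Q.support, ∑ l, (Q m k l) ^ q ^ n • τ^[n + m] (v l) := fun k => by
    simp only [TauMatrix.apply, Finsupp.sum, iterate_map_finset_sum,
      iterate_smul_of_semilinear hτ, Function.iterate_add_apply]
  simp only [this, Finset.smul_sum]
  rw [Finset.sum_comm]
  refine Finset.sum_congr rfl fun m _ => ?_
  change TauMatrix.apply _ τ v i = _
  rw [TauMatrix.apply_single, Finset.sum_comm]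
  refine Finset.sum_congr rfl fun l _ => ?_
  simp [Matrix.mul_apply, Finset.sum_smul, mul_smul]

end TauAction

/-! ### Endomorphisms of `𝔾ₐ^d` as matrices of twisted polynomials -/

section Represents

open Polynomial

variable {F C : Type u} [Field F] [Fintype F] [NormedField C] [Algebra F C] {d : ℕ}

variable (F) in
/-- The `q`-power map on a `C`-algebra, where `q = #F`. -/
def powCard (R : Type*) [CommRing R] [Algebra C R] : R →+* R :=
  letI : Algebra F R := ((algebraMap C R).comp (algebraMap F C)).toAlgebra
  (FiniteField.frobeniusAlgHom F R).toRingHom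

theorem powCard_apply {R : Type*} [CommRing R] [Algebra C R] (r : R) :
    powCard F (C := C) R r = r ^ Fintype.card F := rfl

theorem powCard_iterate {R : Type*} [CommRing R] [Algebra C R] (n : ℕ) (r : R) :
    (powCard F (C := C) R)^[n] r = r ^ Fintype.card F ^ n := by
  induction n generalizing r with
  | zero => simp
  | succ n ih => rw [Function.iterate_succ_apply, ih, powCard_apply, ← pow_mul, ← pow_succ']

theorem powCard_smul {R : Type*} [CommRing R] [Algebra C R] (c : C) (r : R) :
    powCard F (C := C) R (c • r) = c ^ Fintype.card F • powCard F (C := C) R r := by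
  simp only [powCard_apply, _root_.smul_pow]

theorem TauMatrix.represents_iff {P : TauMatrix C d}
    {ψ : ∀ R : CommAlgCat.{u} C, (Fin d → R) → (Fin d → R)} :
    P.Represents F ψ ↔ ∀ (R : CommAlgCat.{u} C) (v : Fin d → R),
      ψ R v = P.apply (powCard F (C := C) R) v := by
  refine forall_congr' fun R => forall_congr' fun v => ?_
  rw [funext_iff]
  refine forall_congr' fun i => ?_
  simp only [TauMatrix.apply, powCard_iterate, Algebra.smul_def]

theorem TauMatrix.Represents.comp {P Q : TauMatrix C d}
    {ψ χ : ∀ R : CommAlgCat.{u} C, (Fin d → R) → (Fin d → R)} (hP : P.Represents F ψ)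
    (hQ : Q.Represents F χ) :
    (TauMatrix.comp (Fintype.card F) P Q).Represents F fun R v => ψ R (χ R v) := by
  rw [TauMatrix.represents_iff] at *
  intro R v
  rw [hP, hQ]
  exact (TauMatrix.apply_comp P Q (powCard F (C := C) R).toAddMonoidHom powCard_smul v).symm

theorem TauMatrix.Represents.add {P Q : TauMatrix C d}
    {ψ χ : ∀ R : CommAlgCat.{u} C, (Fin d → R) → (Fin d → R)} (hP : P.Represents F ψ)
    (hQ : Q.Represents F χ) : (P + Q).Represents F fun R v => ψ R v + χ R v := by
  rw [TauMatrix.represents_iff] at *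
  intro R v
  rw [hP, hQ, TauMatrix.apply_add_left]

theorem TauMatrix.represents_one :
    TauMatrix.Represents F (Finsupp.single 0 (1 : Matrix (Fin d) (Fin d) C)) fun _ v => v := by
  rw [TauMatrix.represents_iff]
  exact fun R v => (TauMatrix.apply_one _ v).symm

theorem TauMatrix.represents_smul (r : F) :
    TauMatrix.Represents F
      (Finsupp.single 0 (algebraMap F C r • (1 : Matrix (Fin d) (Fin d) C)))
      fun _ v => algebraMap F C r • v := by
  rw [TauMatrix.represents_iff]
  intro R v
  funext i
  simp only [TauMatrix.apply_single, Matrix.smul_apply, Matrix.one_apply, smul_eq_mul, mul_ite,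
    mul_one, mul_zero, ite_smul, zero_smul, Finset.sum_ite_eq, Finset.mem_univ, if_true,
    Function.iterate_zero, id_eq, Pi.smul_apply]

/-- Evaluating at the vector `X eₖ` over `C[X]` gives `∑ⱼ (Pⱼ)ᵢₖ X^(qʲ)`. The exponents are distinct
because `q > 1`, so each entry is a coefficient. -/
theorem TauMatrix.Represents.unique {P Q : TauMatrix C d}
    {ψ : ∀ R : CommAlgCat.{u} C, (Fin d → R) → (Fin d → R)} (hP : P.Represents F ψ)
    (hQ : Q.Represents F ψ) : P = Q := by
  have key : ∀ P : TauMatrix C d, P.Represents F ψ → ∀ (j : ℕ) (i k : Fin d), P j i k =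
      (ψ (CommAlgCat.of C C[X]) (Pi.single k X) i : C[X]).coeff (Fintype.card F ^ j) := by
    intro P hP j i k
    rw [hP]
    have hq : Function.Injective fun j : ℕ => Fintype.card F ^ j :=
      Nat.pow_right_injective Fintype.one_lt_card
    have : ∀ (n : ℕ) (M : Matrix (Fin d) (Fin d) C), (∑ l, algebraMap C C[X] (M i l) *
        (Pi.single k X : Fin d → C[X]) l ^ Fintype.card F ^ n) =
        Polynomial.C (M i k) * X ^ Fintype.card F ^ n := fun n M => by
      rw [Finset.sum_eq_single k]
      · simp
      · intro l _ hl
        rw [Pi.single_eq_of_ne hl, zero_pow (pow_pos Fintype.card_pos _).ne', mul_zero]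
      · simp
    change _ = Polynomial.coeff (P.sum fun n M => ∑ l, algebraMap C C[X] (M i l) *
        (Pi.single k X : Fin d → C[X]) l ^ Fintype.card F ^ n) _
    simp only [this]
    rw [Finsupp.sum, Polynomial.finsetSum_coeff]
    simp only [coeff_C_mul, coeff_X_pow, hq.eq_iff]
    by_cases hj : j ∈ P.support
    · rw [Finset.sum_eq_single j]
      · simp
      · intro n _ hn
        simp [hn.symm]
      · exact fun h => absurd hj h
    · rw [Finset.sum_eq_zero]
      · simp [Finsupp.notMem_support_iff.1 hj]
      · intro n hn
        have : j ≠ n := fun h => hj (h ▸ hn)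
        simp [this]
  refine Finsupp.ext fun j => Matrix.ext fun i k => ?_
  rw [key P hP, key Q hQ]

/-- Substituting multiples of `X` lets additivity and homogeneity be read one exponent at a time. -/
theorem aeval_C_mul_X_coeff {R : Type*} [CommRing R] [Algebra C R] (g : C[X]) (r : R) (n : ℕ) :
    (aeval (Polynomial.C r * X : R[X]) g).coeff n = algebraMap C R (g.coeff n) * r ^ n := by
  have : aeval (Polynomial.C r * X : R[X]) g =
      (g.map (algebraMap C R)).comp (Polynomial.C r * X) := by
    rw [Polynomial.comp, eval₂_map, aeval_def]
    rfl
  rw [this, comp_C_mul_X_coeff, coeff_map]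

/-- Write `n = pᵉ m` with `p ∤ m`. Then `(1 + X)ⁿ = (1 + X^(pᵉ))ᵐ` has the coefficient `m ≠ 0` at
`X^(pᵉ)`, which forces `m = 1`. Next, `c^(pᵉ) = c` on `F` gives `q - 1 ∣ pᵉ - 1`, and the gcd
formula for numbers `pᵃ - 1` shows that `pᵉ` is a power of `q`. -/
theorem exists_eq_card_pow_of_one_add_X_pow {n : ℕ} (h : (1 + X : C[X]) ^ n = 1 + X ^ n)
    (hF : ∀ c : F, c ^ n = c) : ∃ j, n = Fintype.card F ^ j := by
  obtain ⟨p, hp⟩ := CharP.exists F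
  obtain ⟨f, hprime, hcard⟩ := FiniteField.card F p
  have : Fact p.Prime := ⟨hprime⟩
  have : CharP C p := charP_of_injective_algebraMap (algebraMap F C).injective p
  -- The exponent zero would give `1 = 1 + 1`.
  have hn : n ≠ 0 := by
    rintro rfl
    simp at h
  obtain ⟨e, m, hm, rfl⟩ := Nat.exists_eq_pow_mul_and_not_dvd hn p hprime.ne_one
  have hm1 : m = 1 := by
    by_contra hm1
    have hpe : p ^ e ≠ 0 := pow_ne_zero _ hprime.ne_zero
    have e1 := congrArg (fun f => f.coeff (p ^ e)) h
    have e2 : (1 + X : C[X]) ^ (p ^ e * m) = expand C (p ^ e) ((1 + X) ^ m) := by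
      rw [pow_mul, add_pow_char_pow]
      simp
    have e3 : p ^ e ≠ p ^ e * m := fun h => hm1 (Nat.eq_of_mul_eq_mul_left
      (Nat.pos_of_ne_zero hpe) (by rw [← h, mul_one]))
    have e4 : (expand C (p ^ e) ((1 + X) ^ m)).coeff (p ^ e) = m := by
      have := coeff_expand_mul (Nat.pos_of_ne_zero hpe) ((1 + X : C[X]) ^ m) 1
      rw [one_mul, coeff_one_add_X_pow] at this
      simpa using this
    simp only [e2, e4, coeff_add, coeff_one, coeff_X_pow, hpe, e3, if_false, add_zero] at e1
    exact hm ((CharP.cast_eq_zero_iff C p m).1 e1)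
  subst hm1
  rw [mul_one] at hF
  have h1 : Fintype.card F - 1 ∣ p ^ e - 1 := by
    rw [← FiniteField.forall_pow_eq_one_iff F]
    intro x
    have := hF x
    refine Units.ext ?_
    rw [Units.val_pow_eq_pow_val, Units.val_one]
    refine mul_right_cancel₀ x.ne_zero ?_
    rw [one_mul, ← pow_succ, Nat.sub_add_cancel (Nat.one_le_pow _ _ hprime.pos), this]
  rw [hcard] at h1 ⊢
  have h2 := Nat.pow_sub_one_gcd_pow_sub_one p f e
  rw [Nat.gcd_eq_left h1] at h2
  have h3 : p ^ (f : ℕ) = p ^ Nat.gcd f e := by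
    have a1 := Nat.one_le_pow f p hprime.pos
    have a2 := Nat.one_le_pow (Nat.gcd f e) p hprime.pos
    omega
  have h4 := Nat.pow_right_injective hprime.two_le h3
  obtain ⟨j, hj⟩ := Nat.gcd_eq_left_iff_dvd.1 h4.symm
  exact ⟨j, by rw [mul_one, hj, pow_mul]⟩

/-- The exponents of an additive, `F`-homogeneous polynomial are powers of `q = #F`. -/
theorem exists_eq_card_pow_of_coeff_ne_zero {g : C[X]}
    (hadd : ∀ x y : C[X][X], aeval (x + y) g = aeval x g + aeval y g)
    (hF : ∀ c : F, aeval (Polynomial.C (algebraMap F C c) * X : C[X]) g =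
      Polynomial.C (algebraMap F C c) * g) {n : ℕ} (hn : g.coeff n ≠ 0) :
    ∃ j, n = Fintype.card F ^ j := by
  refine exists_eq_card_pow_of_one_add_X_pow (F := F) (C := C) ?_ fun c => ?_
  -- Write `T` for the inner variable of `C[X][X]`. Additivity at `1 · X` and `T · X`, read at the
  -- coefficient of `Xⁿ`, becomes `gₙ (1 + T)ⁿ = gₙ (1 + Tⁿ)`.
  · have := congrArg (fun f => f.coeff n)
      (hadd (Polynomial.C 1 * X) (Polynomial.C X * X))
    simp only [← add_mul, ← map_add, coeff_add, aeval_C_mul_X_coeff] at this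
    rw [← mul_add, one_pow] at this
    exact mul_left_cancel₀ (by simpa using hn) this
  · have := congrArg (fun f => f.coeff n) (hF c)
    simp only [aeval_C_mul_X_coeff, coeff_C_mul] at this
    rw [mul_comm, ← map_pow] at this
    exact (algebraMap F C).injective (mul_right_cancel₀ hn this)

/-- Every natural `F`-linear endomorphism of `𝔾ₐ^d` is given by a matrix of twisted polynomials. -/
theorem exists_represents (ψ : ∀ R : CommAlgCat.{u} C, (Fin d → R) → (Fin d → R))
    (hadd : ∀ R v w, ψ R (v + w) = ψ R v + ψ R w)
    (hF : ∀ R (c : F) v, ψ R (algebraMap F C c • v) = algebraMap F C c • ψ R v)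
    (hnat : ∀ {R S : CommAlgCat.{u} C} (f : R ⟶ S) (v : Fin d → R) (i : Fin d),
      ψ S (fun k => f (v k)) i = f (ψ R v i)) :
    ∃ P : TauMatrix C d, P.Represents F ψ := by
  -- Yoneda: naturality makes `ψ` on the `k`-th axis the evaluation of the polynomials obtained at
  -- the generic point `X`.
  let g : Fin d → Fin d → C[X] := fun i k => ψ (CommAlgCat.of C C[X]) (Pi.single k X) i
  have hg : ∀ (R : CommAlgCat.{u} C) (r : R) (i k : Fin d),
      ψ R (Pi.single k r) i = aeval r (g i k) := by
    intro R r i k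
    rw [show aeval r (g i k) = (CommAlgCat.ofHom (aeval r : C[X] →ₐ[C] R)) (g i k) from rfl]
    refine Eq.trans ?_ (hnat _ _ _)
    congr 1
    funext l
    change _ = aeval r ((Pi.single k X : Fin d → C[X]) l)
    by_cases hl : l = k
    · subst hl; simp
    · simp [Pi.single_eq_of_ne hl]
  have hsum : ∀ (R : CommAlgCat.{u} C) (v : Fin d → R) (i : Fin d),
      ψ R v i = ∑ k, aeval (v k) (g i k) := by
    intro R v i
    let Ψ : (Fin d → R) →+ (Fin d → R) := AddMonoidHom.mk' (ψ R) (hadd R)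
    have : ψ R v = ∑ k, ψ R (Pi.single k (v k)) := by
      conv_lhs => rw [← Finset.univ_sum_single v]
      exact map_sum Ψ _ _
    rw [this, Finset.sum_apply]
    exact Finset.sum_congr rfl fun k _ => hg R _ _ _
  have hpow : ∀ (i k : Fin d) {n : ℕ}, (g i k).coeff n ≠ 0 → ∃ j, n = Fintype.card F ^ j := by
    intro i k n hn
    refine exists_eq_card_pow_of_coeff_ne_zero (fun x y => ?_) (fun c => ?_) hn
    · have := hadd (CommAlgCat.of C C[X][X]) (Pi.single k x) (Pi.single k y)
      rw [← Pi.single_add] at this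
      have := congrFun this i
      rw [Pi.add_apply] at this
      simpa only [hg] using this
    · have := congrFun (hF (CommAlgCat.of C C[X]) c (Pi.single k X)) i
      rw [← Pi.single_smul, Pi.smul_apply, hg, Polynomial.smul_eq_C_mul] at this
      rw [this]
      exact Polynomial.smul_eq_C_mul _
  -- A common bound for the powers of `τ`: a nonzero coefficient at `X^(qʲ)` gives `j < qʲ ≤ deg g`,
  -- and the sum of all the numbers `deg g + 1` dominates each of them.
  let N : ℕ := ∑ i, ∑ k, ((g i k).natDegree + 1)
  have hN : ∀ i k, (g i k).natDegree < N := fun i k =>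
    calc (g i k).natDegree + 1 ≤ ∑ k, ((g i k).natDegree + 1) :=
          Finset.single_le_sum (f := fun k => (g i k).natDegree + 1) (fun _ _ => Nat.zero_le _)
            (Finset.mem_univ k)
      _ ≤ N := Finset.single_le_sum (f := fun i => ∑ k, ((g i k).natDegree + 1))
            (fun _ _ => Nat.zero_le _) (Finset.mem_univ i)
  have hq : Function.Injective fun j : ℕ => Fintype.card F ^ j :=
    Nat.pow_right_injective Fintype.one_lt_card
  have hlt : ∀ (i k : Fin d) (j : ℕ), (g i k).coeff (Fintype.card F ^ j) ≠ 0 → j < N :=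
    fun i k j hj => (Nat.lt_pow_self Fintype.one_lt_card).trans
      ((le_natDegree_of_ne_zero hj).trans_lt (hN i k))
  have hexp : ∀ i k, g i k = ∑ j ∈ Finset.range N,
      Polynomial.C ((g i k).coeff (Fintype.card F ^ j)) * X ^ Fintype.card F ^ j := by
    intro i k
    ext n
    rw [Polynomial.finsetSum_coeff]
    simp only [coeff_C_mul, coeff_X_pow]
    by_cases hn : ∃ j, n = Fintype.card F ^ j
    · obtain ⟨j, rfl⟩ := hn
      simp only [hq.eq_iff]
      simp only [mul_ite, mul_one, mul_zero, Finset.sum_ite_eq, Finset.mem_range]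
      split_ifs with hj
      · rfl
      · by_contra h
        exact hj (hlt i k j h)
    · rw [Finset.sum_eq_zero]
      · by_contra h
        exact hn (hpow i k h)
      · intro j _
        rw [if_neg (fun h => hn ⟨j, h⟩), mul_zero]
  let P : TauMatrix C d := Finsupp.onFinset (Finset.range N)
    (fun j => Matrix.of fun i k => (g i k).coeff (Fintype.card F ^ j)) (by
      intro j hj
      rw [Finset.mem_range]
      by_contra h
      refine hj (Matrix.ext fun i k => ?_)
      by_contra h'
      exact h (hlt i k j h'))
  refine ⟨P, fun R v i => ?_⟩
  rw [hsum, Finsupp.sum_of_support_subset P Finsupp.support_onFinset_subset _ (by simp),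
    Finset.sum_comm]
  refine Finset.sum_congr rfl fun k _ => ?_
  conv_lhs => rw [hexp i k]
  simp only [map_sum, map_mul, aeval_C, map_pow, aeval_X]
  rfl

end Represents

/-! ## Intersections of admissible opens -/

section Inter

variable {C : Type u} [NormedField C]

-- Both conditions are encoded by all products of a member of `(g, f₁, …)` with a member of `(g',
-- f'₁, …)`, compared with `g g'`. These products generate the unit ideal, so `g g'` has no zero on
-- the resulting set, and the two original conditions follow by division.
open scoped Pointwise in
theorem IsRational.inter {S : Type u} {B : Subalgebra C (S → C)} {V V' : Set S}
    (hV : IsRational B V) (hV' : IsRational B V') : IsRational B (V ∩ V') := by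
  obtain ⟨n, f, g, h, rfl⟩ := hV
  obtain ⟨n', f', g', h', rfl⟩ := hV'
  let a : Fin (n + 1) → B := Fin.cons g f
  let a' : Fin (n' + 1) → B := Fin.cons g' f'
  have ha : Ideal.span (Set.range a) = ⊤ := by rw [Fin.range_cons]; exact h
  have ha' : Ideal.span (Set.range a') = ⊤ := by rw [Fin.range_cons]; exact h'
  let p : Fin ((n + 1) * (n' + 1)) → B :=
    fun k => a (finProdFinEquiv.symm k).1 * a' (finProdFinEquiv.symm k).2
  have hp : Ideal.span (insert (g * g') (Set.range p)) = ⊤ := by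
    have hmul : Ideal.span (Set.range a * Set.range a') = ⊤ := by
      rw [← Ideal.span_mul_span', ha, ha', Ideal.top_mul]
    rw [eq_top_iff, ← hmul]
    refine Ideal.span_mono ?_
    rintro _ ⟨_, ⟨i, rfl⟩, _, ⟨j, rfl⟩, rfl⟩
    exact Set.mem_insert_of_mem _ ⟨finProdFinEquiv (i, j), by simp only [p, Equiv.symm_apply_apply]⟩
  refine ⟨_, p, g * g', hp, ?_⟩
  ext s
  constructor
  · rintro ⟨h1, h2⟩ k
    have h3 : ∀ i, ‖(a i : S → C) s‖ ≤ ‖(g : S → C) s‖ := by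
      intro i
      refine Fin.cases ?_ (fun i => ?_) i
      · exact le_rfl
      · exact h1 i
    have h4 : ∀ i, ‖(a' i : S → C) s‖ ≤ ‖(g' : S → C) s‖ := by
      intro i
      refine Fin.cases ?_ (fun i => ?_) i
      · exact le_rfl
      · exact h2 i
    change ‖(a _ : S → C) s * (a' _ : S → C) s‖ ≤ ‖(g : S → C) s * (g' : S → C) s‖
    rw [norm_mul, norm_mul]
    exact mul_le_mul (h3 _) (h4 _) (norm_nonneg _) (norm_nonneg _)
  · intro hs
    have key : ∀ i j, ‖(a i : S → C) s‖ * ‖(a' j : S → C) s‖ ≤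
        ‖(g : S → C) s‖ * ‖(g' : S → C) s‖ := by
      intro i j
      have : ‖(p (finProdFinEquiv (i, j)) : S → C) s‖ ≤ ‖((g * g' : B) : S → C) s‖ := hs _
      simp only [p, Equiv.symm_apply_apply] at this
      rw [← norm_mul, ← norm_mul]
      exact this
    -- If `g g'` vanished at `s`, all the products would vanish there as well, and evaluation at `s`
    -- would kill the unit ideal.
    have hne : ‖(g : S → C) s‖ * ‖(g' : S → C) s‖ ≠ 0 := by
      intro h0
      let ev : B →+* C := (Pi.evalRingHom (fun _ : S => C) s).comp B.val.toRingHom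
      have hle : Ideal.span (insert (g * g') (Set.range p)) ≤ RingHom.ker ev := by
        rw [Ideal.span_le]
        rintro x (rfl | ⟨k, rfl⟩)
        · rw [SetLike.mem_coe, RingHom.mem_ker]
          change (g : S → C) s * (g' : S → C) s = 0
          rwa [← norm_eq_zero, norm_mul]
        · rw [SetLike.mem_coe, RingHom.mem_ker]
          have := hs k
          change _ ≤ ‖(g : S → C) s * (g' : S → C) s‖ at this
          rw [norm_mul, h0] at this
          exact norm_le_zero_iff.1 this
      rw [hp, top_le_iff] at hle
      exact RingHom.ker_ne_top ev hle
    have hg : 0 < ‖(g : S → C) s‖ := lt_of_le_of_ne (norm_nonneg _) (left_ne_zero_of_mul hne).symm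
    have hg' : 0 < ‖(g' : S → C) s‖ :=
      lt_of_le_of_ne (norm_nonneg _) (right_ne_zero_of_mul hne).symm
    -- The index `0` is the denominator itself, so the pair `(i + 1, 0)` isolates the condition on
    -- `fᵢ`, and `(0, j + 1)` the one on `f'ⱼ`.
    exact ⟨fun i => le_of_mul_le_mul_right (key i.succ 0) hg',
      fun j => le_of_mul_le_mul_left (key 0 j.succ) hg⟩

variable {F A : Type u} [Field F] [CommRing A] [Algebra F A] [Algebra F C]

theorem isNormPower_refl (F C : Type u) [Field F] [NormedField C] [Algebra F C] :
    IsNormPower (AlgEquiv.refl : C ≃ₐ[F] C) :=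
  ⟨1, one_pos, fun c => by simp⟩

/-- The two discs are nested, so the rational subset of the larger one is first restricted to the
smaller one. That restriction is the twist lemma applied to the identity automorphism. -/
theorem IsRationalSubdomain.inter_of_norm_le {c c' : C} (hc : c ≠ 0) (hcc' : ‖c‖ ≤ ‖c'‖)
    {W : Set (closedDisc (F := F) (A := A) c)} {W' : Set (closedDisc (F := F) (A := A) c')}
    (hW : IsRational (holSubalgebra (closedDisc c)) W)
    (hW' : IsRational (holSubalgebra (closedDisc c')) W') :
    IsRationalSubdomain (Subtype.val '' W ∩ Subtype.val '' W') := by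
  have hsub : ∀ x : Point F A C, x ∈ closedDisc c → x ∈ closedDisc c' :=
    fun x hx a => (hx a).trans (pow_le_pow_left₀ (norm_nonneg _) hcc' _)
  let e : closedDisc (F := F) (A := A) c → closedDisc (F := F) (A := A) c' :=
    fun x => ⟨x.1, hsub x.1 x.2⟩
  have hres : ∀ f ∈ holSubalgebra (F := F) (A := A) (closedDisc c'),
      (fun s => (AlgEquiv.refl : C ≃ₐ[F] C) (f (e s))) ∈
        holSubalgebra (F := F) (A := A) (closedDisc c) :=
    fun f hf Z φ hφ h => hf Z φ hφ fun z => hsub _ (h z)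
  refine ⟨c, hc, _, hW.inter (hW'.twist (isNormPower_refl F C) e hres), ?_⟩
  ext x
  constructor
  · rintro ⟨⟨y, hy, rfl⟩, y', hy', hyy'⟩
    refine ⟨y, ⟨hy, ?_⟩, rfl⟩
    rw [Set.mem_preimage]
    convert hy'
    exact Subtype.ext hyy'.symm
  · rintro ⟨y, ⟨hy, hy'⟩, rfl⟩
    exact ⟨⟨y, hy, rfl⟩, _, hy', rfl⟩

theorem IsRationalSubdomain.inter {V V' : Set (Point F A C)} (hV : IsRationalSubdomain V)
    (hV' : IsRationalSubdomain V') : IsRationalSubdomain (V ∩ V') := by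
  obtain ⟨c, hc, W, hW, rfl⟩ := hV
  obtain ⟨c', hc', W', hW', rfl⟩ := hV'
  rcases le_total ‖c‖ ‖c'‖ with h | h
  · exact IsRationalSubdomain.inter_of_norm_le hc h hW hW'
  · rw [Set.inter_comm]
    exact IsRationalSubdomain.inter_of_norm_le hc' h hW' hW

/-- Pairwise intersections serve both as the covering by rational subdomains and as the finite
refinements. The result allows costable opens to be intersected in the sheaf axiom. -/
theorem IsAdmissible.inter {U U' : Set (Point F A C)} (hU : IsAdmissible U)
    (hU' : IsAdmissible U') : IsAdmissible (U ∩ U') := by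
  obtain ⟨𝒱, hrat, rfl, hadm⟩ := hU
  obtain ⟨𝒱', hrat', rfl, hadm'⟩ := hU'
  refine ⟨Set.image2 (· ∩ ·) 𝒱 𝒱', ?_, ?_, ?_⟩
  · rintro _ ⟨V, hV, V', hV', rfl⟩
    exact (hrat V hV).inter (hrat' V' hV')
  · ext x
    constructor
    · rintro ⟨_, ⟨V, hV, V', hV', rfl⟩, hx, hx'⟩
      exact ⟨⟨V, hV, hx⟩, V', hV', hx'⟩
    · rintro ⟨⟨V, hV, hx⟩, V', hV', hx'⟩
      exact ⟨_, ⟨V, hV, V', hV', rfl⟩, hx, hx'⟩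
  · intro Z φ hφ hU
    obtain ⟨𝒲, hfin, hr, hun, href⟩ := hadm Z φ hφ fun z => (hU z).1
    obtain ⟨𝒲', hfin', hr', hun', href'⟩ := hadm' Z φ hφ fun z => (hU z).2
    refine ⟨Set.image2 (· ∩ ·) 𝒲 𝒲', hfin.image2 _ hfin', ?_, ?_, ?_⟩
    · rintro _ ⟨W, hW, W', hW', rfl⟩
      exact (hr W hW).inter (hr' W' hW')
    · rw [Set.eq_univ_iff_forall] at *
      intro z
      obtain ⟨W, hW, hz⟩ := hun z
      obtain ⟨W', hW', hz'⟩ := hun' z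
      exact ⟨_, ⟨W, hW, W', hW', rfl⟩, hz, hz'⟩
    · rintro _ ⟨W, hW, W', hW', rfl⟩
      obtain ⟨V, hV, hWV⟩ := href W hW
      obtain ⟨V', hV', hWV'⟩ := href' W' hW'
      exact ⟨_, ⟨V, hV, V', hV', rfl⟩, fun z hz => ⟨hWV z hz.1, hWV' z hz.2⟩⟩

/-- The intersection of two costable admissible opens. -/
def CostableOpen.inter [Fintype F] [IsAlgClosed C] (U V : CostableOpen F A C) :
    CostableOpen F A C where
  carrier := U.carrier ∩ V.carrier
  isAdmissible := U.isAdmissible.inter V.isAdmissible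
  costable := fun x hx => ⟨Point.twist (frob F C).symm x,
    ⟨U.twist_symm_mem x hx.1, V.twist_symm_mem x hx.2⟩, Point.twist_twist_symm _ x⟩

end Inter

/-! ## Restriction and Frobenius twist of meromorphic functions -/

section Mero

variable {F A C : Type u} [Field F] [CommRing A] [Algebra F A] [NormedField C] [Algebra F C]

theorem Mer.res_algebraMap {V U : AdmOpen F A C} (h : V ≤ U) (f : Hol U.carrier) :
    Mer.res h (algebraMap _ (Mer U) f) = algebraMap _ (Mer V) (Hol.res h f) :=
  IsLocalization.map_eq (regular_le_comap h) f

theorem Mer.res_refl (U : AdmOpen F A C) (m : Mer U) : Mer.res le_rfl m = m :=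
  IsLocalization.map_id (S := Mer U) m

theorem Mer.res_res {W V U : AdmOpen F A C} (h : W ≤ V) (h' : V ≤ U) (m : Mer U) :
    Mer.res h (Mer.res h' m) = Mer.res (h.trans h') m :=
  IsLocalization.map_map (regular_le_comap h') (regular_le_comap h) m

theorem Mer.res_smul_left {V U : AdmOpen F A C} (h : V ≤ U) (a : A) (m : Mer U) :
    Mer.res h (a • m) = a • Mer.res h m := by
  rw [Algebra.smul_def, Algebra.smul_def, map_mul]
  congr 1
  exact Mer.res_algebraMap h _

theorem Mer.res_smul {V U : AdmOpen F A C} (h : V ≤ U) (c : C) (m : Mer U) :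
    Mer.res h (c • m) = c • Mer.res h m := by
  rw [Algebra.smul_def, Algebra.smul_def, map_mul]
  congr 1
  exact Mer.res_algebraMap h _

theorem Mer.algebraMap_injective (U : AdmOpen F A C) :
    Function.Injective (algebraMap (Hol U.carrier) (Mer U)) := by
  refine IsLocalization.injective (M := regular U) (Mer U) fun b hb => ?_
  -- Elements of `regular U` are in particular non-zero-divisors on `U` itself.
  exact hb U le_rfl

instance (U : AdmOpen F A C) : SMulCommClass C A (Mer U) :=
  ⟨fun c a m => by rw [Algebra.smul_def a, Algebra.smul_def a, mul_smul_comm]⟩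

/-- `Mer.res` as a `C`-linear map. -/
def Mer.resₗ {V U : AdmOpen F A C} (h : V ≤ U) : Mer U →ₗ[C] Mer V where
  toFun := Mer.res h
  map_add' := map_add _
  map_smul' := Mer.res_smul h

variable [Fintype F] [IsAlgClosed C]

theorem Mer.frobTwist_algebraMap (U : CostableOpen F A C) (f : Hol U.carrier) :
    Mer.frobTwist U (algebraMap (Hol U.carrier) (Mer U.toAdmOpen) f) =
      algebraMap (Hol U.carrier) (Mer U.toAdmOpen) (Hol.frobTwist U f) :=
  IsLocalization.map_eq
    (Hol.twist_mem_regular (isNormPower_frob F C) U.toAdmOpen U.twist_symm_mem) f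

/-- Ring homomorphisms out of a localization are compared on analytic functions, where both sides
are given by the same pointwise formula. -/
theorem Mer.res_frobTwist {V U : CostableOpen F A C} (h : V.toAdmOpen ≤ U.toAdmOpen)
    (m : Mer U.toAdmOpen) :
    Mer.res h (Mer.frobTwist U m) = Mer.frobTwist V (Mer.res h m) := by
  have : (Mer.res h).comp (Mer.frobTwist U) = (Mer.frobTwist V).comp (Mer.res h) := by
    refine IsLocalization.ringHom_ext (regular U.toAdmOpen) (RingHom.ext fun f => ?_)
    simp only [RingHom.comp_apply, Mer.frobTwist_algebraMap, Mer.res_algebraMap]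
    rfl
  exact RingHom.congr_fun this m

theorem Hol.frobTwist_algebraMap (U : CostableOpen F A C) (a : A) :
    Hol.frobTwist U (algebraMap A (Hol U.carrier) a) = algebraMap A (Hol U.carrier) a :=
  Hol.ext fun x _ => (frob F C).apply_symm_apply (x a)

theorem Mer.frobTwist_smul (U : CostableOpen F A C) (c : C) (m : Mer U.toAdmOpen) :
    Mer.frobTwist U (c • m) = c ^ Fintype.card F • Mer.frobTwist U m := by
  rw [Algebra.smul_def, Algebra.smul_def, map_mul]
  congr 1
  exact Mer.frobTwist_algebraMap U _

theorem Mer.frobTwist_smul_left (U : CostableOpen F A C) (a : A) (m : Mer U.toAdmOpen) :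
    Mer.frobTwist U (a • m) = a • Mer.frobTwist U m := by
  rw [Algebra.smul_def, Algebra.smul_def, map_mul]
  congr 1
  exact (Mer.frobTwist_algebraMap U _).trans (congrArg _ (Hol.frobTwist_algebraMap U a))

theorem TauMatrix.act_eq_apply {d : ℕ} (P : TauMatrix C d) (U : CostableOpen F A C)
    (G : Fin d → Mer U.toAdmOpen) : P.act U G = P.apply (Mer.frobTwist U) G := rfl

end Mero

/-! ## The action on sections of a costable fractional sheaf -/

section Sections

variable {F A C : Type u} [Field F] [Fintype F] [CommRing A] [Algebra F A] [NormedField C]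
  [Algebra F C] [IsAlgClosed C] {L : FractionalSheaf F A C} {d : ℕ}

/-- The map `f ↦ f⁽¹⁾` on the sections of a costable fractional sheaf. -/
def FractionalSheaf.IsCostable.frobTwist (hL : L.IsCostable) (U : CostableOpen F A C) :
    L.sections U.toAdmOpen →+ L.sections U.toAdmOpen where
  toFun m := ⟨Mer.frobTwist U m, hL U m m.2⟩
  map_zero' := Subtype.ext (map_zero _)
  map_add' _ _ := Subtype.ext (map_add (Mer.frobTwist U) _ _)

theorem FractionalSheaf.IsCostable.frobTwist_smul (hL : L.IsCostable) (U : CostableOpen F A C)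
    (c : C) (m : L.sections U.toAdmOpen) :
    hL.frobTwist U (c • m) = c ^ Fintype.card F • hL.frobTwist U m :=
  Subtype.ext (Mer.frobTwist_smul U c m)

theorem FractionalSheaf.IsCostable.frobTwist_smul_left (hL : L.IsCostable)
    (U : CostableOpen F A C) (a : A) (m : L.sections U.toAdmOpen) :
    hL.frobTwist U (a • m) = a • hL.frobTwist U m :=
  Subtype.ext (Mer.frobTwist_smul_left U a m)

/-- The additive endomorphism of `𝓛(U)^d` defined by a matrix of twisted polynomials. -/
def FractionalSheaf.IsCostable.act (hL : L.IsCostable) (U : CostableOpen F A C)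
    (P : TauMatrix C d) (G : Fin d → L.sections U.toAdmOpen) : Fin d → L.sections U.toAdmOpen :=
  P.apply (hL.frobTwist U) G

theorem FractionalSheaf.IsCostable.coe_act (hL : L.IsCostable) (U : CostableOpen F A C)
    (P : TauMatrix C d) (G : Fin d → L.sections U.toAdmOpen) (i : Fin d) :
    (hL.act U P G i : Mer U.toAdmOpen) = P.act U (fun k => (G k : Mer U.toAdmOpen)) i :=
  P.apply_map (τ := hL.frobTwist U) (τ' := Mer.frobTwist U)
    ((L.sections U.toAdmOpen).subtype.restrictScalars C) (fun _ => rfl) G i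

theorem FractionalSheaf.IsCostable.act_comp (hL : L.IsCostable) (U : CostableOpen F A C)
    (P Q : TauMatrix C d) (G : Fin d → L.sections U.toAdmOpen) :
    hL.act U (TauMatrix.comp (Fintype.card F) P Q) G = hL.act U P (hL.act U Q G) :=
  TauMatrix.apply_comp P Q (hL.frobTwist U) (hL.frobTwist_smul U) G

theorem FractionalSheaf.IsCostable.act_one (hL : L.IsCostable) (U : CostableOpen F A C)
    (G : Fin d → L.sections U.toAdmOpen) :
    hL.act U (Finsupp.single 0 (1 : Matrix (Fin d) (Fin d) C)) G = G :=
  TauMatrix.apply_one _ G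

theorem FractionalSheaf.IsCostable.act_add (hL : L.IsCostable) (U : CostableOpen F A C)
    (P : TauMatrix C d) (G H : Fin d → L.sections U.toAdmOpen) :
    hL.act U P (G + H) = hL.act U P G + hL.act U P H :=
  TauMatrix.apply_add_right P (hL.frobTwist U) G H

theorem FractionalSheaf.IsCostable.act_add_left (hL : L.IsCostable) (U : CostableOpen F A C)
    (P Q : TauMatrix C d) (G : Fin d → L.sections U.toAdmOpen) :
    hL.act U (P + Q) G = hL.act U P G + hL.act U Q G :=
  TauMatrix.apply_add_left P Q (hL.frobTwist U) G

/-- The twist fixes the functions coming from `A`, and scalars from `C` and `A` commute. This is why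
the two factors of `A ⊗ A` can act simultaneously. -/
theorem FractionalSheaf.IsCostable.act_smul (hL : L.IsCostable) (U : CostableOpen F A C)
    (P : TauMatrix C d) (a : A) (G : Fin d → L.sections U.toAdmOpen) :
    hL.act U P (a • G) = a • hL.act U P G := by
  have h : ∀ (j : ℕ) (m : L.sections U.toAdmOpen),
      (hL.frobTwist U)^[j] (a • m) = a • (hL.frobTwist U)^[j] m := fun j m =>
    ((show Function.Commute (hL.frobTwist U) (a • ·) from
      hL.frobTwist_smul_left U a).iterate_left j) m
  have hs : ∀ (c : C) (m : L.sections U.toAdmOpen), c • a • m = a • c • m := fun c m =>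
    Subtype.ext (smul_comm c a (m : Mer U.toAdmOpen))
  funext i
  simp [FractionalSheaf.IsCostable.act, TauMatrix.apply, Finsupp.sum, h, hs, Finset.smul_sum]

end Sections

/-! ## The matrices attached to coordinates -/

section CoordinateMatrices

variable {F A C : Type u} [Field F] [Fintype F] [CommRing A] [Algebra F A] [NormedField C]
  [Algebra F C] {ℓ : A →ₐ[F] C} {d : ℕ} {E : AndersonModule ℓ d}

theorem Coordinates.symm_smul (κ : Coordinates F E.functor d) (R : CommAlgCat.{u} C) (r : F)
    (v : Fin d → R) :
    (κ.equiv R).symm (algebraMap F C r • v) = algebraMap F A r • (κ.equiv R).symm v := by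
  rw [AddEquiv.symm_apply_eq, κ.map_smul, AddEquiv.apply_symm_apply]

theorem Coordinates.symm_natural (κ : Coordinates F E.functor d) {R S : CommAlgCat.{u} C}
    (f : R ⟶ S) (v : Fin d → R) :
    (κ.equiv S).symm (fun k => f (v k)) = E.functor.map f ((κ.equiv R).symm v) := by
  rw [AddEquiv.symm_apply_eq]
  funext i
  rw [κ.natural, AddEquiv.apply_symm_apply]

theorem Coordinates.exists_action (κ : Coordinates F E.functor d) (b : A) :
    ∃ M : TauMatrix C d, M.Represents F (κ.action b) := by
  refine exists_represents _ (fun R v w => ?_) (fun R c v => ?_) (fun {R S} f v i => ?_)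
  · simp only [Coordinates.action, map_add, smul_add]
  · simp only [Coordinates.action]
    rw [κ.symm_smul, smul_comm, κ.map_smul]
  · simp only [Coordinates.action]
    rw [κ.symm_natural, ← (E.functor.map f).hom.map_smul]
    exact κ.natural f _ i

theorem Coordinates.exists_change (κ κ' : Coordinates F E.functor d) :
    ∃ M : TauMatrix C d, M.Represents F (κ.change κ') := by
  refine exists_represents _ (fun R v w => ?_) (fun R c v => ?_) (fun {R S} f v i => ?_)
  · simp only [Coordinates.change, map_add]
  · simp only [Coordinates.change]
    rw [κ.symm_smul, κ'.map_smul]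
  · simp only [Coordinates.change]
    rw [κ.symm_natural, κ'.natural]

/-- The matrix `φ_κ(b)` of twisted polynomials. -/
def Coordinates.actionMatrix (κ : Coordinates F E.functor d) (b : A) : TauMatrix C d :=
  (κ.exists_action b).choose

theorem Coordinates.actionMatrix_represents (κ : Coordinates F E.functor d) (b : A) :
    (κ.actionMatrix b).Represents F (κ.action b) :=
  (κ.exists_action b).choose_spec

/-- The matrix `κ' κ⁻¹` of twisted polynomials. -/
def Coordinates.changeMatrix (κ κ' : Coordinates F E.functor d) : TauMatrix C d :=
  (κ.exists_change κ').choose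

theorem Coordinates.changeMatrix_represents (κ κ' : Coordinates F E.functor d) :
    (κ.changeMatrix κ').Represents F (κ.change κ') :=
  (κ.exists_change κ').choose_spec

/-- Uniqueness of the representing matrix turns an identity of endomorphisms of `𝔾ₐ^d` into one of
matrices. The analogous statements below rest on the same principle. -/
theorem Coordinates.actionMatrix_mul (κ : Coordinates F E.functor d) (b b' : A) :
    κ.actionMatrix (b * b') =
      TauMatrix.comp (Fintype.card F) (κ.actionMatrix b) (κ.actionMatrix b') := by
  refine (κ.actionMatrix_represents _).unique ?_
  convert (κ.actionMatrix_represents b).comp (κ.actionMatrix_represents b') using 3 with R v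
  simp only [Coordinates.action, AddEquiv.symm_apply_apply, mul_smul]

theorem Coordinates.actionMatrix_add (κ : Coordinates F E.functor d) (b b' : A) :
    κ.actionMatrix (b + b') = κ.actionMatrix b + κ.actionMatrix b' := by
  refine (κ.actionMatrix_represents _).unique ?_
  convert (κ.actionMatrix_represents b).add (κ.actionMatrix_represents b') using 3 with R v
  simp only [Coordinates.action, add_smul, map_add]

theorem Coordinates.actionMatrix_one (κ : Coordinates F E.functor d) :
    κ.actionMatrix 1 = Finsupp.single 0 (1 : Matrix (Fin d) (Fin d) C) := by
  refine (κ.actionMatrix_represents _).unique ?_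
  convert TauMatrix.represents_one (F := F) (C := C) (d := d) using 3 with R v
  simp only [Coordinates.action, one_smul, AddEquiv.apply_symm_apply]

theorem Coordinates.actionMatrix_algebraMap (κ : Coordinates F E.functor d) (r : F) :
    κ.actionMatrix (algebraMap F A r) =
      Finsupp.single 0 (algebraMap F C r • (1 : Matrix (Fin d) (Fin d) C)) := by
  refine (κ.actionMatrix_represents _).unique ?_
  convert TauMatrix.represents_smul r using 3 with R v
  simp only [Coordinates.action, κ.map_smul, AddEquiv.apply_symm_apply]

theorem Coordinates.changeMatrix_self (κ : Coordinates F E.functor d) :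
    κ.changeMatrix κ = Finsupp.single 0 (1 : Matrix (Fin d) (Fin d) C) := by
  refine (κ.changeMatrix_represents _).unique ?_
  convert TauMatrix.represents_one (F := F) (C := C) (d := d) using 3 with R v
  simp only [Coordinates.change, AddEquiv.apply_symm_apply]

/-- The cocycle relation: it makes `κ'κ⁻¹` invertible with inverse `κ κ'⁻¹`, and makes the
transported identifications coherent. -/
theorem Coordinates.changeMatrix_comp (κ κ' κ'' : Coordinates F E.functor d) :
    TauMatrix.comp (Fintype.card F) (κ'.changeMatrix κ'') (κ.changeMatrix κ') =
      κ.changeMatrix κ'' := by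
  refine TauMatrix.Represents.unique ?_ (κ.changeMatrix_represents _)
  convert (κ'.changeMatrix_represents κ'').comp (κ.changeMatrix_represents κ') using 3 with R v
  simp only [Coordinates.change, AddEquiv.symm_apply_apply]

/-- Both products represent `v ↦ κ'(b · κ⁻¹ v)`. It guarantees that transported identifications
remain linear for the right factor. -/
theorem Coordinates.changeMatrix_actionMatrix (κ κ' : Coordinates F E.functor d) (b : A) :
    TauMatrix.comp (Fintype.card F) (κ.changeMatrix κ') (κ.actionMatrix b) =
      TauMatrix.comp (Fintype.card F) (κ'.actionMatrix b) (κ.changeMatrix κ') := by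
  refine TauMatrix.Represents.unique
    ((κ.changeMatrix_represents κ').comp (κ.actionMatrix_represents b)) ?_
  convert (κ'.actionMatrix_represents b).comp (κ.changeMatrix_represents κ') using 3 with R v
  simp only [Coordinates.change, Coordinates.action, AddEquiv.symm_apply_apply]

end CoordinateMatrices

/-! ## The Frobenius on `A ⊗ C` -/

section GaussTensor

variable {F A C : Type u} [Field F] [CommRing A] [Algebra F A] [NormedField C]
  [Algebra F C]

instance : Module A (GaussTensor F A C) := inferInstanceAs (Module A (A ⊗[F] C))

instance : Module C (GaussTensor F A C) :=
  (Algebra.TensorProduct.includeRight : C →ₐ[F] A ⊗[F] C).toRingHom.toAlgebra.toModule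

/-- The pure tensor `a ⊗ c`. -/
def GaussTensor.tmul (a : A) (c : C) : GaussTensor F A C := (a ⊗ₜ[F] c : A ⊗[F] C)

theorem GaussTensor.smul_tmul (c : C) (a : A) (x : C) :
    c • (GaussTensor.tmul a x : GaussTensor F A C) = GaussTensor.tmul a (c * x) := by
  change ((1 : A) ⊗ₜ[F] c : A ⊗[F] C) * (a ⊗ₜ[F] x) = _
  rw [Algebra.TensorProduct.tmul_mul_tmul, one_mul]
  rfl

theorem GaussTensor.tmul_sum (a : A) {ι : Type*} (s : Finset ι) (f : ι → C) :
    (GaussTensor.tmul a (∑ i ∈ s, f i) : GaussTensor F A C) =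
      ∑ i ∈ s, GaussTensor.tmul a (f i) :=
  TensorProduct.tmul_sum a s f

theorem GaussTensor.induction {p : GaussTensor F A C → Prop} (h0 : p 0)
    (h1 : ∀ (a : A) (c : C), p (GaussTensor.tmul a c)) (h2 : ∀ f g, p f → p g → p (f + g))
    (f : GaussTensor F A C) : p f :=
  TensorProduct.induction_on (motive := p) f h0 h1 h2

/-- The canonical map from `A ⊗ C` to the analytic functions on `U`, as a `C`-linear map. -/
def GaussTensor.toHol (U : Set (Point F A C)) : GaussTensor F A C →ₗ[C] Hol U where
  toFun f := Hol.ofTensor U f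
  map_add' f g := map_add (Hol.ofTensor U) f g
  map_smul' c f := by
    refine (map_mul (Hol.ofTensor U) ((1 : A) ⊗ₜ[F] c) f).trans ?_
    rw [RingHom.id_apply, Algebra.smul_def]
    congr 1
    change algebraMap A (Hol U) 1 * algebraMap C (Hol U) c = _
    rw [map_one, one_mul]

theorem GaussTensor.toHol_tmul (U : Set (Point F A C)) (a : A) (c : C) :
    GaussTensor.toHol U (GaussTensor.tmul a c) =
      algebraMap A (Hol U) a * algebraMap C (Hol U) c := rfl

theorem GaussTensor.toHol_smul_left (U : Set (Point F A C)) (a : A) (f : GaussTensor F A C) :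
    GaussTensor.toHol U (a • f) = a • GaussTensor.toHol U f :=
  map_smul (Hol.ofTensor U) a f

variable [Fintype F]

variable (F A C) in
/-- The map `a ⊗ c ↦ a ⊗ c ^ q` on `A ⊗ C`. -/
def GaussTensor.frob : GaussTensor F A C →+ GaussTensor F A C :=
  (LinearMap.lTensor A (FiniteField.frobeniusAlgHom F C).toLinearMap).toAddMonoidHom

theorem GaussTensor.frob_tmul (a : A) (c : C) :
    GaussTensor.frob F A C (GaussTensor.tmul a c) = GaussTensor.tmul a (c ^ Fintype.card F) :=
  rfl

theorem GaussTensor.frob_iterate_tmul (n : ℕ) (a : A) (c : C) :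
    (GaussTensor.frob F A C)^[n] (GaussTensor.tmul a c) =
      GaussTensor.tmul a (c ^ Fintype.card F ^ n) := by
  induction n generalizing c with
  | zero => rw [pow_zero, pow_one]; rfl
  | succ n ih =>
    rw [Function.iterate_succ_apply, GaussTensor.frob_tmul, ih, ← pow_mul, ← pow_succ']

theorem GaussTensor.toHol_frob [IsAlgClosed C] (U : CostableOpen F A C) (f : GaussTensor F A C) :
    GaussTensor.toHol U.carrier (GaussTensor.frob F A C f) =
      Hol.frobTwist U (GaussTensor.toHol U.carrier f) := by
  induction f using GaussTensor.induction with
  | h0 => simp only [map_zero]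
  | h1 a c =>
    rw [GaussTensor.frob_tmul, GaussTensor.toHol_tmul, GaussTensor.toHol_tmul, map_mul,
      Hol.frobTwist_algebraMap]
    rfl
  | h2 f g hf hg => rw [map_add, map_add, hf, hg, map_add, map_add]

variable {ℓ : A →ₐ[F] C} {d : ℕ} {E : AndersonModule ℓ d}

theorem TauMatrix.apply_tmul (P : TauMatrix C d) (a : A) (w : Fin d → C) (i : Fin d) :
    P.apply (GaussTensor.frob F A C) (fun k => GaussTensor.tmul a (w k)) i =
      GaussTensor.tmul a (P.sum fun j M => ∑ k, M i k * w k ^ Fintype.card F ^ j) := by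
  simp only [TauMatrix.apply, GaussTensor.frob_iterate_tmul, GaussTensor.smul_tmul, Finsupp.sum,
    GaussTensor.tmul_sum]

/-- The isomorphism `A ⊗ E(C) ≅ (A ⊗ C)^d` induced by `κ`, with values in the normed group. -/
def Coordinates.gauss (κ : Coordinates F E.functor d) :
    E.Tensor ≃+ (Fin d → GaussTensor F A C) := κ.tensor

theorem Coordinates.gauss_smul (κ : Coordinates F E.functor d) (a : A) (v : E.Tensor) :
    κ.gauss ((a ⊗ₜ[F] (1 : A) : A ⊗[F] A) • v) = a • κ.gauss v :=
  κ.tensor_smul a v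

theorem Coordinates.gauss_tmul (κ : Coordinates F E.functor d) (a : A) (e : E.Points) :
    κ.gauss (E.tmul a e) = fun i => GaussTensor.tmul a (κ.points e i) := rfl

/-- On a pure tensor this is the identity represented by `M`, taken on `C`-points; both sides are
additive. -/
theorem Coordinates.gauss_smul_right (κ : Coordinates F E.functor d) {b : A} {M : TauMatrix C d}
    (hM : M.Represents F (κ.action b)) (v : E.Tensor) :
    κ.gauss (((1 : A) ⊗ₜ[F] b : A ⊗[F] A) • v) =
      M.apply (GaussTensor.frob F A C) (κ.gauss v) := by
  induction v using E.tensor_induction with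
  | h0 => rw [smul_zero, map_zero, TauMatrix.apply_zero_right]
  | h1 a e =>
    rw [AndersonModule.tmul_smul_tmul, one_mul, Coordinates.gauss_tmul, Coordinates.gauss_tmul]
    funext i
    rw [TauMatrix.apply_tmul]
    congr 1
    refine Eq.trans ?_ (hM (CommAlgCat.of C C) (κ.points e) i)
    exact congrArg (fun e' => κ.equiv (CommAlgCat.of C C) (b • e') i)
      ((κ.equiv (CommAlgCat.of C C)).symm_apply_apply e).symm
  | h2 v w hv hw => rw [smul_add, map_add, hv, hw, map_add, TauMatrix.apply_add_right]

theorem Coordinates.gauss_change (κ κ' : Coordinates F E.functor d) {M : TauMatrix C d}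
    (hM : M.Represents F (κ.change κ')) (v : E.Tensor) :
    κ'.gauss v = M.apply (GaussTensor.frob F A C) (κ.gauss v) := by
  induction v using E.tensor_induction with
  | h0 => rw [map_zero, map_zero, TauMatrix.apply_zero_right]
  | h1 a e =>
    rw [Coordinates.gauss_tmul, Coordinates.gauss_tmul]
    funext i
    rw [TauMatrix.apply_tmul]
    congr 1
    refine Eq.trans ?_ (hM (CommAlgCat.of C C) (κ.points e) i)
    exact congrArg (fun e' => κ'.equiv (CommAlgCat.of C C) e' i)
      ((κ.equiv (CommAlgCat.of C C)).symm_apply_apply e).symm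
  | h2 v w hv hw => rw [map_add, hv, hw, map_add, TauMatrix.apply_add_right]

/-- The canonical map turns `a ⊗ c ↦ a ⊗ c ^ q` into the Frobenius twist of functions, so
`TauMatrix.apply_map` applies. This yields linearity of `ι` for the right factor. -/
theorem FractionalSheaf.IsCostable.ofTensor_apply [IsAlgClosed C] {L : FractionalSheaf F A C}
    (hL : L.IsCostable) (U : CostableOpen F A C) (P : TauMatrix C d)
    (v : Fin d → GaussTensor F A C) :
    L.ofTensor d U.toAdmOpen (P.apply (R := GaussTensor F A C) (GaussTensor.frob F A C) v) =
      hL.act U P (L.ofTensor d U.toAdmOpen v) := by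
  funext i
  refine Subtype.ext ?_
  rw [hL.coe_act]
  refine P.apply_map (R := GaussTensor F A C) (τ' := Mer.frobTwist U)
    ((Algebra.linearMap (Hol U.carrier) (Mer U.toAdmOpen)).restrictScalars C ∘ₗ
      GaussTensor.toHol U.carrier) (fun f => ?_) v i
  change algebraMap _ _ (GaussTensor.toHol U.carrier (GaussTensor.frob F A C f)) =
    Mer.frobTwist U (algebraMap _ _ (GaussTensor.toHol U.carrier f))
  rw [GaussTensor.toHol_frob, Mer.frobTwist_algebraMap]

end GaussTensor

/-! ## Identifications of a pair with the sections of a fractional sheaf -/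

section Comparisons

variable {F A C : Type u} [Field F] [Fintype F] [CommRing A] [Algebra F A] [NormedField C]
  [IsAlgClosed C] [Algebra F C] {ℓ : A →ₐ[F] C} {d : ℕ} {E : AndersonModule ℓ d}
  {L : FractionalSheaf F A C} {P P' : EPair E} {κ : Coordinates F E.functor d}

/-- The identification `ℰ(U) ≅ 𝓛(U)^d` as an additive isomorphism. -/
def Comparison.equiv (m : Comparison L P κ) (U : CostableOpen F A C) :
    P.presheaf.obj (Opposite.op U) ≃+ (Fin d → L.sections U.toAdmOpen) where
  toFun e := (m.iso U).hom e
  invFun G := (m.iso U).inv G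
  left_inv e := (m.iso U).hom_inv_id_apply e
  right_inv G := (m.iso U).inv_hom_id_apply G
  map_add' x y := (m.iso U).hom.hom.map_add x y

theorem Comparison.equiv_smul_left (m : Comparison L P κ) (U : CostableOpen F A C) (a : A)
    (e : P.presheaf.obj (Opposite.op U)) :
    m.equiv U ((a ⊗ₜ[F] (1 : A) : A ⊗[F] A) • e) = a • m.equiv U e :=
  (m.iso U).hom.hom.map_smul a e

theorem Comparison.equiv_smul_right (m : Comparison L P κ) (hL : L.IsCostable)
    (U : CostableOpen F A C) (b : A) (e : P.presheaf.obj (Opposite.op U)) :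
    m.equiv U (((1 : A) ⊗ₜ[F] b : A ⊗[F] A) • e) =
      hL.act U (κ.actionMatrix b) (m.equiv U e) := by
  funext i
  refine Subtype.ext ?_
  rw [hL.coe_act]
  exact m.iso_smul b _ (κ.actionMatrix_represents b) U e i

/-- Only the commutativity of the pushout square enters: in coordinates `ι` is the canonical map. -/
theorem Comparison.equiv_ι (m : Comparison L P κ) (U : CostableOpen F A C) (v : E.Tensor) :
    m.equiv U (P.ι U v) = L.ofTensor d U.toAdmOpen (κ.tensor v) := by
  have h1 := ConcreteCategory.congr_hom (m.isPushout U).w (κ.tensor v)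
  have h2 : κ.tensor.symm (κ.tensor v) = v := κ.tensor.symm_apply_apply v
  have h3 : P.ι U (κ.tensor.symm (κ.tensor v)) =
    (m.equiv U).symm (L.ofTensor d U.toAdmOpen (κ.tensor v)) := h1
  rw [h2] at h3
  rw [h3, AddEquiv.apply_symm_apply]

theorem Comparison.equiv_res (m : Comparison L P κ) {V U : CostableOpen F A C} (h : V ≤ U)
    (e : P.presheaf.obj (Opposite.op U)) (i : Fin d) :
    (m.equiv V (P.presheaf.map (homOfLE h).op e) i : Mer V.toAdmOpen) =
      Mer.res h (m.equiv U e i : Mer U.toAdmOpen) :=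
  m.res_iso h e i

theorem Comparison.ext_equiv {m m' : Comparison L P κ}
    (h : ∀ (U : CostableOpen F A C) (e : P.presheaf.obj (Opposite.op U)),
      m.equiv U e = m'.equiv U e) : m = m' := by
  have : m.iso = m'.iso := funext fun U => Iso.ext (ModuleCat.hom_ext (LinearMap.ext (h U)))
  cases m
  cases m'
  cases this
  rfl

instance Coordinates.isIso_invHom (κ : Coordinates F E.functor d) : IsIso κ.invHom := by
  let e : ((restrictLeft F A).obj (ModuleCat.of (A ⊗[F] A) E.Tensor)) ≃ₗ[A]
      (Fin d → A ⊗[F] C) :=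
    { κ.tensor with map_smul' := fun a v => κ.tensor_smul a v }
  have : κ.invHom = (e.symm.toModuleIso).hom := rfl
  rw [this]
  infer_instance

/-- An identification, constructed from additive isomorphisms. -/
def Comparison.ofEquiv (hL : L.IsCostable)
    (e : ∀ U : CostableOpen F A C,
      P.presheaf.obj (Opposite.op U) ≃+ (Fin d → L.sections U.toAdmOpen))
    (smul_left : ∀ U (a : A) x, e U ((a ⊗ₜ[F] (1 : A) : A ⊗[F] A) • x) = a • e U x)
    (smul_right : ∀ U (b : A) x, e U (((1 : A) ⊗ₜ[F] b : A ⊗[F] A) • x) =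
      hL.act U (κ.actionMatrix b) (e U x))
    (map_ι : ∀ U v, e U (P.ι U v) = L.ofTensor d U.toAdmOpen (κ.tensor v))
    (map_res : ∀ {V U : CostableOpen F A C} (h : V ≤ U) x (i : Fin d),
      (e V (P.presheaf.map (homOfLE h).op x) i : Mer V.toAdmOpen) =
        Mer.res h (e U x i : Mer U.toAdmOpen)) :
    Comparison L P κ where
  iso U :=
    let e' : ((restrictLeft F A).obj (P.presheaf.obj (Opposite.op U))) ≃ₗ[A]
        (Fin d → L.sections U.toAdmOpen) :=
      { e U with map_smul' := fun a x => smul_left U a x }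
    e'.toModuleIso
  isPushout U := by
    -- Both horizontal arrows are isomorphisms, so the square is a pushout as soon as it commutes.
    refine IsPushout.of_horiz_isIso ⟨ModuleCat.hom_ext (LinearMap.ext fun f => ?_)⟩
    change P.ι U (κ.tensor.symm f) = (e U).symm (L.ofTensor d U.toAdmOpen f)
    rw [AddEquiv.eq_symm_apply, map_ι, AddEquiv.apply_symm_apply]
  res_iso h x i := map_res h x i
  iso_smul b M hM U x i := by
    rw [hM.unique (κ.actionMatrix_represents b), ← hL.coe_act]
    exact congrArg (fun G : Fin d → L.sections U.toAdmOpen => (G i : Mer U.toAdmOpen))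
      (smul_right U b x)

theorem FractionalSheaf.IsCostable.res_act (hL : L.IsCostable) {V U : CostableOpen F A C}
    (h : V ≤ U) (M : TauMatrix C d) (G : Fin d → L.sections U.toAdmOpen)
    (H : Fin d → L.sections V.toAdmOpen)
    (hGH : ∀ i, (H i : Mer V.toAdmOpen) = Mer.res h (G i : Mer U.toAdmOpen)) (i : Fin d) :
    (hL.act V M H i : Mer V.toAdmOpen) = Mer.res h (hL.act U M G i : Mer U.toAdmOpen) := by
  rw [hL.coe_act, hL.coe_act]
  simp only [hGH]
  exact (M.apply_map (τ := Mer.frobTwist U) (τ' := Mer.frobTwist V) (Mer.resₗ h)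
    (fun m => Mer.res_frobTwist h m) (fun k => (G k : Mer U.toAdmOpen)) i).symm

theorem FractionalSheaf.IsCostable.ofTensor_gauss_change (hL : L.IsCostable)
    (κ κ' : Coordinates F E.functor d) (U : CostableOpen F A C) (v : E.Tensor) :
    L.ofTensor d U.toAdmOpen (κ'.tensor v) =
      hL.act U (κ.changeMatrix κ') (L.ofTensor d U.toAdmOpen (κ.tensor v)) := by
  refine Eq.trans ?_ (hL.ofTensor_apply U _ (κ.gauss v))
  exact congrArg _ (κ.gauss_change κ' (κ.changeMatrix_represents κ') v)

/-- The automorphism of `𝓛(U)^d` defined by `κ' κ⁻¹`. -/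
def FractionalSheaf.IsCostable.changeEquiv (hL : L.IsCostable) (κ κ' : Coordinates F E.functor d)
    (U : CostableOpen F A C) :
    (Fin d → L.sections U.toAdmOpen) ≃+ (Fin d → L.sections U.toAdmOpen) where
  toFun := hL.act U (κ.changeMatrix κ')
  invFun := hL.act U (κ'.changeMatrix κ)
  left_inv G := by
    rw [← hL.act_comp, Coordinates.changeMatrix_comp, Coordinates.changeMatrix_self, hL.act_one]
  right_inv G := by
    rw [← hL.act_comp, Coordinates.changeMatrix_comp, Coordinates.changeMatrix_self, hL.act_one]
  map_add' := hL.act_add U _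

/-- The identification for `κ'` deduced from the one for `κ` through `κ' κ⁻¹`. -/
def Comparison.change (m : Comparison L P κ) (hL : L.IsCostable)
    (κ' : Coordinates F E.functor d) : Comparison L P κ' :=
  Comparison.ofEquiv hL (fun U => (m.equiv U).trans (hL.changeEquiv κ κ' U))
    (fun U a x => by
      change hL.act U _ (m.equiv U _) = a • hL.act U _ (m.equiv U _)
      rw [m.equiv_smul_left, hL.act_smul])
    (fun U b x => by
      change hL.act U _ (m.equiv U _) = hL.act U _ (hL.act U _ (m.equiv U _))
      rw [m.equiv_smul_right hL, ← hL.act_comp, ← hL.act_comp,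
        Coordinates.changeMatrix_actionMatrix])
    (fun U v => by
      change hL.act U _ (m.equiv U _) = _
      rw [m.equiv_ι, hL.ofTensor_gauss_change κ κ'])
    (fun h x i => hL.res_act h _ _ _ (m.equiv_res h x) i)

theorem Comparison.change_equiv (m : Comparison L P κ) (hL : L.IsCostable)
    (κ' : Coordinates F E.functor d) (U : CostableOpen F A C)
    (e : P.presheaf.obj (Opposite.op U)) :
    (m.change hL κ').equiv U e = hL.act U (κ.changeMatrix κ') (m.equiv U e) := rfl

theorem ComparisonSystem.equiv_eq (s : ComparisonSystem L P) (hL : L.IsCostable)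
    (κ κ' : Coordinates F E.functor d) (U : CostableOpen F A C)
    (e : P.presheaf.obj (Opposite.op U)) :
    (s.comparison κ').equiv U e =
      hL.act U (κ.changeMatrix κ') ((s.comparison κ).equiv U e) := by
  funext i
  refine Subtype.ext ?_
  rw [hL.coe_act]
  exact s.coherent κ κ' _ (κ.changeMatrix_represents κ') U e i

/-- The coherent system generated by an identification. -/
def Comparison.system (m : Comparison L P κ) (hL : L.IsCostable) : ComparisonSystem L P where
  comparison := m.change hL
  coherent κ₁ κ₂ M hM U e i := by
    rw [hM.unique (κ₁.changeMatrix_represents κ₂)]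
    change ((m.change hL κ₂).equiv U e i : Mer U.toAdmOpen) =
      TauMatrix.act _ U (fun k => ((m.change hL κ₁).equiv U e k : Mer U.toAdmOpen)) i
    rw [← hL.coe_act, Comparison.change_equiv, Comparison.change_equiv, ← hL.act_comp,
      Coordinates.changeMatrix_comp]

/-- Coherence with `κ` dictates every other identification as the transport by `κ'κ⁻¹`, and the
cocycle relation makes these transports coherent. -/
theorem Comparison.existsUnique_system (m : Comparison L P κ) (hL : L.IsCostable) :
    ∃! s : ComparisonSystem L P, s.comparison κ = m := by
  refine ⟨m.system hL, Comparison.ext_equiv fun U e => ?_, fun s hs => ?_⟩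
  · change (m.change hL κ).equiv U e = _
    rw [Comparison.change_equiv, Coordinates.changeMatrix_self, hL.act_one]
  · have : s.comparison = (m.system hL).comparison := by
      funext κ'
      refine Comparison.ext_equiv fun U e => ?_
      rw [s.equiv_eq hL κ κ', hs]
      rfl
    cases s
    cases this
    rfl

/-! ### Uniqueness of the pair -/

/-- In coordinates the two factors act by formulas that depend on `κ` and not on the pair, so
passing from one pair to the other is linear. -/
theorem Comparison.equiv_smul_eq (m : Comparison L P κ) (m' : Comparison L P' κ)
    (hL : L.IsCostable) (U : CostableOpen F A C) (r : A ⊗[F] A)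
    (e : P.presheaf.obj (Opposite.op U)) :
    (m'.equiv U).symm (m.equiv U (r • e)) = r • (m'.equiv U).symm (m.equiv U e) := by
  rw [AddEquiv.symm_apply_eq]
  induction r using TensorProduct.induction_on generalizing e with
  | zero => rw [zero_smul, zero_smul, map_zero, map_zero]
  | tmul a b =>
    have : (a ⊗ₜ[F] b : A ⊗[F] A) = (a ⊗ₜ[F] (1 : A)) * ((1 : A) ⊗ₜ[F] b) := by simp
    rw [this, mul_smul, mul_smul, m.equiv_smul_left, m'.equiv_smul_left,
      m.equiv_smul_right hL, m'.equiv_smul_right hL, AddEquiv.apply_symm_apply]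
  | add r r' h h' => rw [add_smul, add_smul, map_add, map_add, h, h']

/-- The isomorphism between two pairs deduced from identifications for the same coordinates. -/
def Comparison.presheafIso (m : Comparison L P κ) (m' : Comparison L P' κ) (hL : L.IsCostable) :
    P.presheaf ≅ P'.presheaf :=
  NatIso.ofComponents
    (fun U => LinearEquiv.toModuleIso
      { (m.equiv U.unop).trans (m'.equiv U.unop).symm with
        map_smul' := fun r e => m.equiv_smul_eq m' hL U.unop r e })
    (fun {U V} f => by
      refine ModuleCat.hom_ext (LinearMap.ext fun e => ?_)
      obtain ⟨h⟩ : Nonempty (V.unop ≤ U.unop) := ⟨leOfHom f.unop⟩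
      have hf : f = (homOfLE h).op := rfl
      rw [hf]
      change (m'.equiv V.unop).symm (m.equiv V.unop (P.presheaf.map (homOfLE h).op e)) =
        P'.presheaf.map (homOfLE h).op ((m'.equiv U.unop).symm (m.equiv U.unop e))
      rw [AddEquiv.symm_apply_eq]
      funext i
      refine Subtype.ext ?_
      rw [m.equiv_res]
      refine Eq.trans ?_ (m'.equiv_res h _ i).symm
      rw [AddEquiv.apply_symm_apply])

theorem Comparison.equiv_presheafIso (m : Comparison L P κ) (m' : Comparison L P' κ)
    (hL : L.IsCostable) (U : CostableOpen F A C) (e : P.presheaf.obj (Opposite.op U)) :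
    m'.equiv U ((m.presheafIso m' hL).hom.app (Opposite.op U) e) = m.equiv U e :=
  (m'.equiv U).apply_symm_apply _

/-- One `κ` determines the map, and coherence carries its compatibility to every other `κ'`. It
respects `ι` because both maps `ι` become the same canonical map in coordinates. -/
theorem ComparisonSystem.existsUnique_iso (hL : L.IsCostable) (s : ComparisonSystem L P)
    (s' : ComparisonSystem L P') :
    ∃! f : P.presheaf ≅ P'.presheaf,
      (∀ U : CostableOpen F A C, P.ι U ≫ f.hom.app (Opposite.op U) = P'.ι U) ∧
      ∀ (κ : Coordinates F E.functor d) (U : CostableOpen F A C)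
        (e : P.presheaf.obj (Opposite.op U)),
        ((s'.comparison κ).iso U).hom (f.hom.app (Opposite.op U) e) =
          ((s.comparison κ).iso U).hom e := by
  obtain ⟨κ⟩ := E.exists_coordinates
  refine ⟨(s.comparison κ).presheafIso (s'.comparison κ) hL, ⟨fun U => ?_, fun κ' U e => ?_⟩,
    fun f hf => ?_⟩
  · refine ModuleCat.hom_ext (LinearMap.ext fun v => ((s'.comparison κ).equiv U).injective ?_)
    refine ((s.comparison κ).equiv_presheafIso _ hL U _).trans ?_
    exact ((s.comparison κ).equiv_ι U v).trans ((s'.comparison κ).equiv_ι U v).symm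
  · change (s'.comparison κ').equiv U _ = (s.comparison κ').equiv U e
    rw [s'.equiv_eq hL κ κ', s.equiv_eq hL κ κ', Comparison.equiv_presheafIso]
  · refine Iso.ext (NatTrans.ext (funext fun U => ModuleCat.hom_ext (LinearMap.ext fun e => ?_)))
    refine ((s'.comparison κ).equiv U.unop).injective ?_
    exact (hf.2 κ U.unop e).trans ((s.comparison κ).equiv_presheafIso _ hL U.unop e).symm

/-! ### Existence of the pair -/

/-- The `A ⊗ A`-module `𝓛(U)^d`, on which `1 ⊗ b` acts through `φ_κ(b)`. -/
def EVal (_ : L.IsCostable) (_ : Coordinates F E.functor d) (U : CostableOpen F A C) : Type u :=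
  Fin d → L.sections U.toAdmOpen

instance (hL : L.IsCostable) (κ : Coordinates F E.functor d) (U : CostableOpen F A C) :
    AddCommGroup (EVal hL κ U) :=
  inferInstanceAs (AddCommGroup (Fin d → L.sections U.toAdmOpen))

/-- The action of `A` on `𝓛(U)^d` through `φ_κ`. -/
def EVal.actionHom (hL : L.IsCostable) (κ : Coordinates F E.functor d) (U : CostableOpen F A C) :
    A →+* Module.End A (Fin d → L.sections U.toAdmOpen) where
  toFun b :=
    { toFun := hL.act U (κ.actionMatrix b)
      map_add' := hL.act_add U _
      map_smul' := hL.act_smul U _ }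
  map_one' := LinearMap.ext fun G => by
    change hL.act U (κ.actionMatrix 1) G = G
    rw [κ.actionMatrix_one, hL.act_one]
  map_mul' b b' := LinearMap.ext fun G => by
    change hL.act U (κ.actionMatrix (b * b')) G = hL.act U _ (hL.act U _ G)
    rw [κ.actionMatrix_mul, hL.act_comp]
  map_zero' := LinearMap.ext fun G => by
    change hL.act U (κ.actionMatrix 0) G = 0
    -- Additivity gives `φ_κ(0) = φ_κ(0) + φ_κ(0)`, hence the zero matrix.
    have h := κ.actionMatrix_add 0 0
    rw [add_zero, left_eq_add] at h
    rw [h]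
    rfl
  map_add' b b' := LinearMap.ext fun G => by
    change hL.act U (κ.actionMatrix (b + b')) G = hL.act U _ G + hL.act U _ G
    rw [κ.actionMatrix_add, hL.act_add_left]

/-- The two copies of `F` in `A ⊗ A` have to act alike: `κ` is `F`-linear, so `φ_κ(r)` is the scalar
matrix `r`, and points are `F`-algebra maps, so the constants from `A` and from `C` are the same
functions. -/
theorem EVal.actionHom_algebraMap (hL : L.IsCostable) (κ : Coordinates F E.functor d)
    (U : CostableOpen F A C) (r : F) :
    EVal.actionHom hL κ U (algebraMap F A r) =
      algebraMap A (Module.End A (Fin d → L.sections U.toAdmOpen)) (algebraMap F A r) := by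
  refine LinearMap.ext fun G => ?_
  change hL.act U (κ.actionMatrix (algebraMap F A r)) G = algebraMap F A r • G
  rw [κ.actionMatrix_algebraMap]
  funext i
  refine Subtype.ext ?_
  have h : algebraMap C (Hol U.carrier) (algebraMap F C r) =
      algebraMap A (Hol U.carrier) (algebraMap F A r) :=
    Hol.ext fun x _ => (x.commutes r).symm
  rw [hL.coe_act, TauMatrix.act_eq_apply, TauMatrix.apply_single]
  simp only [Matrix.smul_apply, Matrix.one_apply, smul_eq_mul, mul_ite,
    mul_one, mul_zero, ite_smul, zero_smul, Finset.sum_ite_eq, Finset.mem_univ, if_true,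
    Function.iterate_zero, id_eq, Pi.smul_apply]
  change _ = algebraMap F A r • (G i : Mer U.toAdmOpen)
  rw [Algebra.smul_def, Algebra.smul_def]
  exact congrArg (fun f => algebraMap (Hol U.carrier) (Mer U.toAdmOpen) f * (G i).1) h

/-- The action of `A ⊗ A` on `𝓛(U)^d`. -/
def EVal.tensorHom (hL : L.IsCostable) (κ : Coordinates F E.functor d) (U : CostableOpen F A C) :
    A ⊗[F] A →+* Module.End A (Fin d → L.sections U.toAdmOpen) :=
  letI : Algebra F (Module.End A (Fin d → L.sections U.toAdmOpen)) :=
    Algebra.compHom _ (algebraMap F A)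
  haveI : IsScalarTower F A (Module.End A (Fin d → L.sections U.toAdmOpen)) :=
    IsScalarTower.of_algebraMap_eq fun _ => rfl
  (Algebra.TensorProduct.lift (S := A)
    (Algebra.ofId A (Module.End A (Fin d → L.sections U.toAdmOpen)))
    { EVal.actionHom hL κ U with
      commutes' := EVal.actionHom_algebraMap hL κ U }
    fun a b => Algebra.commutes a (EVal.actionHom hL κ U b)).toRingHom

instance (hL : L.IsCostable) (κ : Coordinates F E.functor d) (U : CostableOpen F A C) :
    Module (A ⊗[F] A) (EVal hL κ U) :=
  Module.compHom (Fin d → L.sections U.toAdmOpen) (EVal.tensorHom hL κ U)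

/-- A vector of sections as an element of `EVal`. -/
def EVal.of (hL : L.IsCostable) (κ : Coordinates F E.functor d) (U : CostableOpen F A C)
    (G : Fin d → L.sections U.toAdmOpen) : EVal hL κ U := G

theorem EVal.tmul_smul (hL : L.IsCostable) (κ : Coordinates F E.functor d)
    (U : CostableOpen F A C) (a b : A) (G : Fin d → L.sections U.toAdmOpen) :
    (a ⊗ₜ[F] b : A ⊗[F] A) • EVal.of hL κ U G =
      EVal.of hL κ U (a • hL.act U (κ.actionMatrix b) G) := rfl

theorem EVal.left_smul (hL : L.IsCostable) (κ : Coordinates F E.functor d)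
    (U : CostableOpen F A C) (a : A) (G : Fin d → L.sections U.toAdmOpen) :
    (a ⊗ₜ[F] (1 : A) : A ⊗[F] A) • EVal.of hL κ U G = EVal.of hL κ U (a • G) := by
  rw [EVal.tmul_smul, κ.actionMatrix_one, hL.act_one]

theorem EVal.right_smul (hL : L.IsCostable) (κ : Coordinates F E.functor d)
    (U : CostableOpen F A C) (b : A) (G : Fin d → L.sections U.toAdmOpen) :
    ((1 : A) ⊗ₜ[F] b : A ⊗[F] A) • EVal.of hL κ U G =
      EVal.of hL κ U (hL.act U (κ.actionMatrix b) G) := by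
  rw [EVal.tmul_smul, one_smul]

/-- A map out of an `A ⊗ A`-module is linear if it is additive and compatible with the actions of
the two factors. -/
theorem map_tensor_smul {M N : Type*} [AddCommGroup M] [AddCommGroup N] [Module (A ⊗[F] A) M]
    [Module (A ⊗[F] A) N] (f : M →+ N)
    (hl : ∀ (a : A) x, f ((a ⊗ₜ[F] (1 : A) : A ⊗[F] A) • x) = (a ⊗ₜ[F] (1 : A) : A ⊗[F] A) • f x)
    (hr : ∀ (b : A) x, f (((1 : A) ⊗ₜ[F] b : A ⊗[F] A) • x) = ((1 : A) ⊗ₜ[F] b : A ⊗[F] A) • f x)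
    (r : A ⊗[F] A) (x : M) : f (r • x) = r • f x := by
  induction r using TensorProduct.induction_on generalizing x with
  | zero => rw [zero_smul, zero_smul, map_zero]
  | tmul a b =>
    have : (a ⊗ₜ[F] b : A ⊗[F] A) = (a ⊗ₜ[F] (1 : A)) * ((1 : A) ⊗ₜ[F] b) := by simp
    rw [this, mul_smul, mul_smul, hl, hr]
  | add r r' h h' => rw [add_smul, add_smul, map_add, h, h']

/-- The restriction map `𝓛(U)^d → 𝓛(V)^d`. -/
def FractionalSheaf.resPi (L : FractionalSheaf F A C) (d : ℕ) {V U : AdmOpen F A C} (h : V ≤ U) :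
    (Fin d → L.sections U) →+ (Fin d → L.sections V) where
  toFun G i := ⟨Mer.res h (G i : Mer U), L.res_mem h _ (G i).2⟩
  map_zero' := funext fun _ => Subtype.ext (map_zero (Mer.res h))
  map_add' _ _ := funext fun _ => Subtype.ext (map_add (Mer.res h) _ _)

/-- The restriction map `𝓛(U)^d → 𝓛(V)^d`, as an `A ⊗ A`-linear map. -/
def EVal.res (hL : L.IsCostable) (κ : Coordinates F E.functor d) {V U : CostableOpen F A C}
    (h : V ≤ U) : EVal hL κ U →ₗ[A ⊗[F] A] EVal hL κ V where
  toFun G := EVal.of hL κ V (L.resPi d h G)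
  map_add' := (L.resPi d h).map_add
  map_smul' := map_tensor_smul (M := EVal hL κ U) (N := EVal hL κ V) (L.resPi d h)
    (fun a G => by
      refine (congrArg (L.resPi d h) (EVal.left_smul hL κ U a G)).trans ?_
      refine Eq.trans ?_ (EVal.left_smul hL κ V a _).symm
      exact funext fun i => Subtype.ext (Mer.res_smul_left h a _))
    (fun b G => by
      refine (congrArg (L.resPi d h) (EVal.right_smul hL κ U b G)).trans ?_
      refine Eq.trans ?_ (EVal.right_smul hL κ V b _).symm
      exact funext fun i => Subtype.ext
        (hL.res_act h (κ.actionMatrix b) G (L.resPi d h G) (fun _ => rfl) i).symm)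

/-- The canonical map `A ⊗ E(C) → 𝓛(U)^d`. -/
def EVal.ι (hL : L.IsCostable) (κ : Coordinates F E.functor d) (U : CostableOpen F A C) :
    E.Tensor →ₗ[A ⊗[F] A] EVal hL κ U :=
  let f : E.Tensor →+ (Fin d → L.sections U.toAdmOpen) :=
    (L.ofTensor d U.toAdmOpen).toAddMonoidHom.comp κ.tensor.toAddMonoidHom
  { toFun := f
    map_add' := f.map_add
    map_smul' := map_tensor_smul (N := EVal hL κ U) f
      (fun a v => by
        refine Eq.trans ?_ (EVal.left_smul hL κ U a _).symm
        exact (congrArg (L.ofTensor d U.toAdmOpen) (κ.tensor_smul a v)).trans (map_smul _ _ _))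
      (fun b v => by
        refine Eq.trans ?_ (EVal.right_smul hL κ U b _).symm
        exact (congrArg (L.ofTensor d U.toAdmOpen)
          (κ.gauss_smul_right (κ.actionMatrix_represents b) v)).trans
            (hL.ofTensor_apply U _ (κ.gauss v))) }

/-- The pair formed by `𝓛^d` and `A ⊗ E(C) ≅ (A ⊗ C)^d → 𝓛(U)^d`. -/
def EPair.ofCoordinates (hL : L.IsCostable) (κ : Coordinates F E.functor d) : EPair E where
  presheaf :=
    { obj := fun U => ModuleCat.of (A ⊗[F] A) (EVal hL κ U.unop)
      map := fun f => ModuleCat.ofHom (EVal.res hL κ (leOfHom f.unop))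
      map_id := fun _ => ModuleCat.hom_ext (LinearMap.ext fun _ =>
        funext fun _ => Subtype.ext (Mer.res_refl _ _))
      map_comp := fun _ _ => ModuleCat.hom_ext (LinearMap.ext fun _ =>
        funext fun _ => Subtype.ext (Mer.res_res _ _ _).symm) }
  ι U := ModuleCat.ofHom (EVal.ι hL κ U)

/-- The tautological identification. -/
def EPair.comparison (hL : L.IsCostable) (κ : Coordinates F E.functor d) :
    Comparison L (EPair.ofCoordinates hL κ) κ :=
  Comparison.ofEquiv hL (fun U => AddEquiv.refl (Fin d → L.sections U.toAdmOpen))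
    (fun U a G => EVal.left_smul hL κ U a G) (fun U b G => EVal.right_smul hL κ U b G)
    (fun _ _ => rfl) (fun _ _ _ => rfl)

/-- Gluing is done componentwise in `𝓛`. The difference between the two sheaf axioms lies in the
overlaps: that of `𝓛` tests all admissible opens, the costable one only costable opens. -/
theorem EPair.isCostableSheaf (hL : L.IsCostable) (κ : Coordinates F E.functor d) :
    IsCostableSheaf (EPair.ofCoordinates hL κ).presheaf := by
  intro U 𝒰 h𝒰 x hx
  have hle : ∀ V ∈ 𝒰, V ≤ U := fun V hV => h𝒰.1 _ ⟨V, hV, rfl⟩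
  let s : ∀ V, V ∈ 𝒰 → Fin d → L.sections V.toAdmOpen :=
    fun V hV => x (homOfLE (hle V hV)) hV
  have hs : ∀ (V V' : CostableOpen F A C) (hV : V ∈ 𝒰) (hV' : V' ∈ 𝒰) (i : Fin d)
      (W : AdmOpen F A C) (hW : W ≤ V.toAdmOpen) (hW' : W ≤ V'.toAdmOpen),
      Mer.res hW (s V hV i : Mer V.toAdmOpen) = Mer.res hW' (s V' hV' i : Mer V'.toAdmOpen) := by
    intro V V' hV hV' i W hW hW'
    -- `W` need not be costable, but it lies in the costable open `V ∩ V'`, where compatibility is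
    -- available; restrict from there.
    have h1 : V.inter V' ≤ V := fun _ h => h.1
    have h2 : V.inter V' ≤ V' := fun _ h => h.2
    have h3 : W ≤ (V.inter V').toAdmOpen := fun _ h => ⟨hW h, hW' h⟩
    have h4 : EVal.res hL κ h1 (s V hV) = EVal.res hL κ h2 (s V' hV') :=
      hx (homOfLE h1) (homOfLE h2) hV hV' (Subsingleton.elim _ _)
    have h5 : Mer.res h1 (s V hV i : Mer V.toAdmOpen) =
        Mer.res h2 (s V' hV' i : Mer V'.toAdmOpen) :=
      congrArg (fun G : Fin d → L.sections (V.inter V').toAdmOpen =>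
        (G i : Mer (V.inter V').toAdmOpen)) h4
    have h6 := congrArg (Mer.res h3) h5
    rwa [Mer.res_res, Mer.res_res] at h6
  have hmem : ∀ V : CostableOpen.toAdmOpen '' 𝒰, ∃ V' ∈ 𝒰, V'.toAdmOpen = V.1 := fun V => V.2
  -- A member of the image covering is lifted to a costable open. The lift equals it only
  -- propositionally, hence the restriction along this equality below.
  choose v hv hv' using hmem
  have hex : ∀ i : Fin d, ∃! m : Mer U.toAdmOpen, m ∈ L.sections U.toAdmOpen ∧
      ∀ V (hV : V ∈ 𝒰), Mer.res (hle V hV) m = (s V hV i : Mer V.toAdmOpen) := by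
    intro i
    obtain ⟨m, ⟨hm, hm'⟩, huniq⟩ := L.glue U.toAdmOpen (CostableOpen.toAdmOpen '' 𝒰) h𝒰
      (fun V => Mer.res (hv' V).ge (s (v V) (hv V) i : Mer (v V).toAdmOpen))
      (fun V => L.res_mem _ _ (s (v V) (hv V) i).2)
      (fun V V' W hW hW' => by
        rw [Mer.res_res, Mer.res_res]
        exact hs _ _ _ _ i W _ _)
    refine ⟨m, ⟨hm, fun V hV => ?_⟩, fun m' h => huniq m' ⟨h.1, fun V => ?_⟩⟩
    · have := hm' ⟨V.toAdmOpen, V, hV, rfl⟩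
      refine this.trans ?_
      refine (hs _ _ _ hV i _ _ le_rfl).trans (Mer.res_refl _ _)
    · rw [← h.2 (v V) (hv V), Mer.res_res]
  choose m hm huniq using hex
  refine ⟨fun i => ⟨m i, (hm i).1⟩, ?_, fun t ht => ?_⟩
  · intro V f hV
    exact funext fun i => Subtype.ext ((hm i).2 V hV)
  · funext i
    refine Subtype.ext (huniq i _ ⟨(t i).2, fun V hV => ?_⟩)
    exact congrArg (fun G : Fin d → L.sections V.toAdmOpen => (G i : Mer V.toAdmOpen))
      (ht (homOfLE (hle V hV)) hV)

theorem EPair.isEValuedSheaf (hL : L.IsCostable) (κ : Coordinates F E.functor d) :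
    IsEValuedSheaf L (EPair.ofCoordinates hL κ) :=
  ⟨EPair.isCostableSheaf hL κ, fun κ' => ⟨(EPair.comparison hL κ).change hL κ'⟩⟩

end Comparisons

/-! ## Continuity for the Gauss norm -/

theorem TauMatrix.continuous_apply {C : Type u} [NormedField C] {d : ℕ} {R : Type*}
    [AddCommGroup R] [Module C R] [TopologicalSpace R] [ContinuousAdd R]
    [ContinuousConstSMul C R] {τ : R → R} (hτ : Continuous τ) (P : TauMatrix C d) :
    Continuous (P.apply τ) := by
  refine continuous_pi fun i => ?_
  refine continuous_finsetSum _ fun j _ => continuous_finsetSum _ fun k _ => ?_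
  exact ((hτ.iterate j).comp (_root_.continuous_apply k)).const_smul _

section Gauss

variable {F A C : Type u} [Field F] [CommRing A] [Algebra F A] [NormedField C] [Algebra F C]

theorem GaussTensor.norm_le {f : GaussTensor F A C} {r : ℝ}
    (h : HasRepresentation (F := F) (A := A) (C := C) f r) : ‖f‖ ≤ r :=
  csInf_le (bddBelow_hasRepresentation _) h

theorem GaussTensor.hasRepresentation {f : GaussTensor F A C} {r : ℝ} (h : ‖f‖ < r) :
    HasRepresentation (F := F) (A := A) (C := C) f r := by
  obtain ⟨s, ⟨hs, n, a, c, hf, hc⟩, hsr⟩ := exists_lt_of_csInf_lt (exists_hasRepresentation _) h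
  exact ⟨hs.trans hsr.le, n, a, c, hf, fun i => (hc i).trans hsr.le⟩

theorem GaussTensor.norm_le_of_forall_lt {f : GaussTensor F A C} {B : ℝ}
    (h : ∀ r, B < r → HasRepresentation (F := F) (A := A) (C := C) f r) : ‖f‖ ≤ B :=
  le_of_forall_gt_imp_ge_of_dense fun r hr => GaussTensor.norm_le (h r hr)

theorem GaussTensor.sum_tmul_eq {n : ℕ} (a : Fin n → A) (c : Fin n → C) :
    (∑ i, a i ⊗ₜ[F] c i : A ⊗[F] C) = ∑ i, (GaussTensor.tmul (a i) (c i) : GaussTensor F A C) :=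
  rfl

/-- An additive map of `A ⊗ C` which acts on pure tensors through a map of `C` that is bounded by
`ψ` is bounded by `ψ`. -/
theorem GaussTensor.hasRepresentation_map (h : GaussTensor F A C →+ GaussTensor F A C)
    (α : A → A) (β : C → C) (hβ : ∀ a c, h (GaussTensor.tmul a c) = GaussTensor.tmul (α a) (β c))
    {r s : ℝ} (hs : 0 ≤ s) (hr : ∀ c, ‖c‖ ≤ r → ‖β c‖ ≤ s) {f : GaussTensor F A C}
    (hf : HasRepresentation (F := F) (A := A) (C := C) f r) :
    HasRepresentation (F := F) (A := A) (C := C) (h f) s := by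
  obtain ⟨-, n, a, c, rfl, hc⟩ := hf
  refine ⟨hs, n, fun i => α (a i), fun i => β (c i), ?_, fun i => hr _ (hc i)⟩
  rw [GaussTensor.sum_tmul_eq]
  refine Eq.trans ?_ (GaussTensor.sum_tmul_eq _ _).symm
  simp only [map_sum, hβ]
  rfl

theorem GaussTensor.norm_smul_le (c : C) (f : GaussTensor F A C) : ‖c • f‖ ≤ ‖c‖ * ‖f‖ := by
  refine le_of_forall_pos_le_add fun ε hε => ?_
  -- The Gauss norm is an infimum that need not be attained, so a margin is needed; dividing by `‖c‖
  -- + 1` also covers `c = 0`.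
  have hpos : 0 < ‖c‖ + 1 := by positivity
  have h1 : ‖f‖ < ‖f‖ + ε / (‖c‖ + 1) := lt_add_of_pos_right _ (div_pos hε hpos)
  have h2 := GaussTensor.norm_le (GaussTensor.hasRepresentation_map
    (DistribSMul.toAddMonoidHom (GaussTensor F A C) c) id (c * ·)
    (fun a x => GaussTensor.smul_tmul c a x)
    (s := ‖c‖ * (‖f‖ + ε / (‖c‖ + 1))) (by positivity)
    (fun x hx => by rw [norm_mul]; exact mul_le_mul_of_nonneg_left hx (norm_nonneg _))
    (GaussTensor.hasRepresentation h1))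
  refine h2.trans ?_
  rw [mul_add]
  have : ‖c‖ * (ε / (‖c‖ + 1)) ≤ ε := by
    rw [mul_div_assoc', div_le_iff₀ hpos]
    nlinarith [norm_nonneg c]
  linarith

theorem GaussTensor.norm_smul_left_le (a : A) (f : GaussTensor F A C) : ‖a • f‖ ≤ ‖f‖ := by
  refine GaussTensor.norm_le_of_forall_lt fun r hr => ?_
  refine GaussTensor.hasRepresentation_map (DistribSMul.toAddMonoidHom (GaussTensor F A C) a)
    (a * ·) id (fun b c => ?_) ((norm_nonneg _).trans hr.le) (fun _ h => h)
    (GaussTensor.hasRepresentation hr)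
  exact TensorProduct.smul_tmul' a b c

instance : ContinuousConstSMul C (GaussTensor F A C) :=
  ⟨fun c => AddMonoidHomClass.continuous_of_bound
    (DistribSMul.toAddMonoidHom (GaussTensor F A C) c) ‖c‖ (GaussTensor.norm_smul_le c)⟩

instance : ContinuousConstSMul A (GaussTensor F A C) :=
  ⟨fun a => AddMonoidHomClass.continuous_of_bound
    (DistribSMul.toAddMonoidHom (GaussTensor F A C) a) 1
      (fun f => by rw [one_mul]; exact GaussTensor.norm_smul_left_le a f)⟩

/-- An `F`-linear endomorphism of `A` acting on `A ⊗ C`. -/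
def GaussTensor.mapLeft (T : A →ₗ[F] A) : GaussTensor F A C →+ GaussTensor F A C :=
  (LinearMap.rTensor C T).toAddMonoidHom

theorem GaussTensor.continuous_mapLeft (T : A →ₗ[F] A) :
    Continuous (GaussTensor.mapLeft T : GaussTensor F A C →+ GaussTensor F A C) :=
  AddMonoidHomClass.continuous_of_bound _ 1 fun f => by
    rw [one_mul]
    exact GaussTensor.norm_le_of_forall_lt fun r hr =>
      GaussTensor.hasRepresentation_map _ T id (fun _ _ => rfl) ((norm_nonneg _).trans hr.le)
        (fun _ h => h) (GaussTensor.hasRepresentation hr)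

/-- The map `c ↦ a ⊗ c`. -/
def GaussTensor.tmulHom (a : A) : C →+ GaussTensor F A C :=
  (TensorProduct.mk F A C a).toAddMonoidHom

theorem GaussTensor.continuous_tmulHom (a : A) :
    Continuous (GaussTensor.tmulHom a : C →+ GaussTensor F A C) :=
  AddMonoidHomClass.continuous_of_bound _ 1 fun c => by
    rw [one_mul]
    exact GaussTensor.norm_le ⟨norm_nonneg _, 1, fun _ => a, fun _ => c, by simp; rfl,
      fun _ => le_rfl⟩

variable [Fintype F]

/-- The map is additive, so continuity at zero suffices. For coefficients of norm at most one, the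
`q`-th power does not increase the norm. -/
theorem GaussTensor.continuous_frob : Continuous (GaussTensor.frob F A C) := by
  refine continuous_of_continuousAt_zero _ ?_
  rw [ContinuousAt, map_zero, Metric.tendsto_nhds_nhds]
  intro ε hε
  -- The bound `1` ensures `|c ^ q| ≤ |c|`, and `ε / 2` keeps the final inequality strict.
  refine ⟨min 1 (ε / 2), lt_min one_pos (half_pos hε), fun f hf => ?_⟩
  rw [dist_zero_right] at hf ⊢
  have h0 : 0 ≤ min 1 (ε / 2) := le_min zero_le_one (half_pos hε).le
  have h := GaussTensor.norm_le (GaussTensor.hasRepresentation_map (GaussTensor.frob F A C) id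
    (· ^ Fintype.card F) GaussTensor.frob_tmul (s := min 1 (ε / 2)) h0 (fun c hc => by
      rw [norm_pow]
      refine le_trans ?_ hc
      exact pow_le_of_le_one (norm_nonneg _) (hc.trans (min_le_left _ _)) Fintype.card_ne_zero)
    (GaussTensor.hasRepresentation hf))
  linarith [min_le_right 1 (ε / 2)]

variable {ℓ : A →ₐ[F] C} {d : ℕ} {E : AndersonModule ℓ d}

theorem TauMatrix.uniformContinuous_apply_frob (M : TauMatrix C d) :
    UniformContinuous (M.apply (GaussTensor.frob F A C)) :=
  uniformContinuous_addMonoidHom_of_continuous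
    (f := AddMonoidHom.mk' (M.apply (GaussTensor.frob F A C))
      (M.apply_add_right (GaussTensor.frob F A C)))
    (M.continuous_apply GaussTensor.continuous_frob)

theorem Coordinates.uniformSpace_eq_comap (κ : Coordinates F E.functor d) :
    κ.uniformSpace = UniformSpace.comap κ.gauss inferInstance := rfl

/-- The two embeddings in `(A ⊗ C)^d` differ by the uniformly continuous map `κ'κ⁻¹`. This compares
the structures one way, and exchanging the coordinates compares them the other way. -/
theorem Coordinates.uniformSpace_eq (κ κ' : Coordinates F E.functor d) :
    κ.uniformSpace = κ'.uniformSpace := by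
  have key : ∀ κ κ' : Coordinates F E.functor d, κ.uniformSpace ≤ κ'.uniformSpace := by
    intro κ κ'
    have h : (κ'.gauss : E.Tensor → Fin d → GaussTensor F A C) =
        (κ.changeMatrix κ').apply (GaussTensor.frob F A C) ∘ κ.gauss :=
      funext fun v => κ.gauss_change κ' (κ.changeMatrix_represents κ') v
    rw [κ.uniformSpace_eq_comap, κ'.uniformSpace_eq_comap, h, UniformSpace.comap_comap]
    exact UniformSpace.comap_mono
      (uniformContinuous_iff_le_comap.1 (TauMatrix.uniformContinuous_apply_frob _))
  exact le_antisymm (key κ κ') (key κ' κ)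

/-- The isometry `A ⊗ E(C) → (A ⊗ C)^d` defined by `κ`. -/
def Coordinates.gaussHom (κ : Coordinates F E.functor d) :
    κ.MetricTensor →+ (Fin d → GaussTensor F A C) := κ.gauss.toAddMonoidHom

theorem Coordinates.isometry_gaussHom (κ : Coordinates F E.functor d) : Isometry κ.gaussHom :=
  AddMonoidHomClass.isometry_of_norm _ fun _ => rfl

theorem Coordinates.gaussHom_mulMap_left (κ : Coordinates F E.functor d) (a : A)
    (v : κ.MetricTensor) :
    κ.gaussHom (κ.mulMap (a ⊗ₜ[F] (1 : A)) v) = a • κ.gaussHom v :=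
  κ.gauss_smul a v

theorem Coordinates.gaussHom_mulMap_right (κ : Coordinates F E.functor d) (b : A)
    (v : κ.MetricTensor) :
    κ.gaussHom (κ.mulMap ((1 : A) ⊗ₜ[F] b) v) =
      (κ.actionMatrix b).apply (GaussTensor.frob F A C) (κ.gaussHom v) :=
  κ.gauss_smul_right (κ.actionMatrix_represents b) v

theorem Coordinates.mulMap_mul (κ : Coordinates F E.functor d) (r r' : A ⊗[F] A) :
    κ.mulMap (r * r') = κ.mulMap r ∘ κ.mulMap r' :=
  funext fun v => mul_smul r r' (show E.Tensor from v)

theorem Coordinates.mulMap_add (κ : Coordinates F E.functor d) (r r' : A ⊗[F] A) :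
    κ.mulMap (r + r') = κ.mulMap r + κ.mulMap r' :=
  funext fun v => add_smul r r' (show E.Tensor from v)

theorem Coordinates.mulMap_zero (κ : Coordinates F E.functor d) : κ.mulMap 0 = 0 :=
  funext fun v => zero_smul (A ⊗[F] A) (show E.Tensor from v)

/-- It is enough to treat `a ⊗ 1` and `1 ⊗ b`. Through the isometry to `(A ⊗ C)^d` they become
multiplication by `a`, of norm at most one, and the matrix `φ_κ(b)`. -/
theorem Coordinates.uniformContinuous_mulMap (κ : Coordinates F E.functor d) (r : A ⊗[F] A) :
    UniformContinuous (κ.mulMap r) := by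
  induction r using TensorProduct.induction_on with
  | zero => rw [κ.mulMap_zero]; exact uniformContinuous_const
  | tmul a b =>
    have : (a ⊗ₜ[F] b : A ⊗[F] A) = (a ⊗ₜ[F] (1 : A)) * ((1 : A) ⊗ₜ[F] b) := by simp
    rw [this, κ.mulMap_mul]
    refine UniformContinuous.comp ?_ ?_
    · rw [κ.isometry_gaussHom.isUniformInducing.uniformContinuous_iff]
      have h : κ.gaussHom ∘ κ.mulMap (a ⊗ₜ[F] (1 : A)) =
          (DistribSMul.toAddMonoidHom (Fin d → GaussTensor F A C) a) ∘ κ.gaussHom :=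
        funext fun v => κ.gaussHom_mulMap_left a v
      rw [h]
      refine UniformContinuous.comp ?_ κ.isometry_gaussHom.uniformContinuous
      exact uniformContinuous_addMonoidHom_of_continuous (continuous_const_smul a)
    · rw [κ.isometry_gaussHom.isUniformInducing.uniformContinuous_iff]
      have h : κ.gaussHom ∘ κ.mulMap ((1 : A) ⊗ₜ[F] b) =
          (κ.actionMatrix b).apply (GaussTensor.frob F A C) ∘ κ.gaussHom :=
        funext fun v => κ.gaussHom_mulMap_right b v
      rw [h]
      exact (TauMatrix.uniformContinuous_apply_frob _).comp κ.isometry_gaussHom.uniformContinuous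
  | add r r' h h' => rw [κ.mulMap_add]; exact h.add h'

end Gauss

/-! ## Points over the algebraic closure of the finite field -/

section AlgebraicPoints

variable {F A C : Type u} [Field F] [CommRing A] [Algebra F A]

/-- An element of a reduced algebra of finite type over an algebraically closed field which vanishes
at all points is zero. -/
theorem eq_zero_of_forall_algHom {k R : Type*} [Field k] [IsAlgClosed k] [CommRing R] [Algebra k R]
    [Algebra.FiniteType k R] [IsReduced R] {r : R} (h : ∀ x : R →ₐ[k] k, x r = 0) : r = 0 := by
  have : IsJacobsonRing R := isJacobsonRing_of_finiteType (A := k)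
  have hrad : (⊥ : Ideal R).jacobson = ⊥ := by
    rw [← Ideal.radical_eq_jacobson]
    exact nilradical_eq_zero R
  rw [← Ideal.mem_bot, ← hrad, Ideal.jacobson, Submodule.mem_sInf]
  rintro M ⟨-, hM⟩
  -- `R` is Jacobson, so residue fields at maximal ideals are finite over `k`, hence equal to `k`,
  -- and each maximal ideal is the kernel of a point.
  let _ : Field (R ⧸ M) := Ideal.Quotient.field M
  have hfin : Module.Finite k (R ⧸ M) := finite_of_finite_type_of_isJacobsonRing k (R ⧸ M)
  let e : k ≃ₐ[k] R ⧸ M := AlgEquiv.ofBijective (Algebra.ofId k (R ⧸ M))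
    IsAlgClosed.algebraMap_bijective_of_isIntegral
  have h1 : e.symm (Ideal.Quotient.mkₐ k M r) = 0 :=
    h (e.symm.toAlgHom.comp (Ideal.Quotient.mkₐ k M))
  rw [map_eq_zero_iff _ e.symm.injective] at h1
  exact Ideal.Quotient.eq_zero_iff_mem.1 h1

variable {k : Type*} [Field k] [IsAlgClosed k] [Algebra F k] [Algebra.FiniteType F A]
  [IsReduced (k ⊗[F] A)]

/-- The vectors of values of distinct basis elements of `A` at the `k`-points of `A` span the
whole space. -/
theorem span_range_eval_eq_top {ι ι' : Type*} [Fintype ι] (b : Module.Basis ι' F A) {e : ι → ι'}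
    (he : Function.Injective e) :
    Submodule.span k (Set.range fun (x : A →ₐ[F] k) (i : ι) => x (b (e i))) = ⊤ := by
  classical
  let a : ι → A := fun i => b (e i)
  by_contra hne
  obtain ⟨f, hf, hle⟩ := Submodule.exists_le_ker_of_lt_top _ (lt_top_iff_ne_top.2 hne)
  apply hf
  -- A linear form killing all the vectors of values is an element of `k ⊗ A` vanishing at every
  -- point, hence zero; independence of the basis elements after base change then kills its
  -- coefficients.
  have hz : ∑ i, (f (Pi.single i 1) ⊗ₜ[F] a i : k ⊗[F] A) = 0 := by
    refine eq_zero_of_forall_algHom (k := k) fun x => ?_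
    have h1 : f (fun i => x (1 ⊗ₜ[F] a i)) = 0 :=
      hle (Submodule.subset_span ⟨(x.restrictScalars F).comp
        Algebra.TensorProduct.includeRight, rfl⟩)
    rw [map_sum, ← h1]
    conv_rhs => rw [← Finset.univ_sum_single (fun i => x (1 ⊗ₜ[F] a i)), map_sum]
    refine Finset.sum_congr rfl fun i _ => ?_
    have h2 : (f (Pi.single i 1) ⊗ₜ[F] a i : k ⊗[F] A) =
        f (Pi.single i 1) • ((1 : k) ⊗ₜ[F] a i) := by
      rw [TensorProduct.smul_tmul', smul_eq_mul, mul_one]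
    have h3 : (Pi.single i (x (1 ⊗ₜ[F] a i)) : ι → k) = x (1 ⊗ₜ[F] a i) • Pi.single i 1 := by
      rw [← Pi.single_smul, smul_eq_mul, mul_one]
    rw [h2, map_smul, h3, map_smul, smul_eq_mul, smul_eq_mul, mul_comm]
  have hli : LinearIndependent k fun i => ((1 : k) ⊗ₜ[F] a i : k ⊗[F] A) := by
    have := (b.baseChange k).linearIndependent.comp e he
    simpa only [Function.comp_def, Module.Basis.baseChange_apply] using this
  have hc := Fintype.linearIndependent_iff.1 hli (fun i => f (Pi.single i 1)) (by
    rw [← hz]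
    refine Finset.sum_congr rfl fun i _ => ?_
    rw [TensorProduct.smul_tmul', smul_eq_mul, mul_one])
  refine LinearMap.pi_ext' fun i => LinearMap.ext_ring ?_
  exact hc i

end AlgebraicPoints

/-! ### The Gauss norm as a supremum over points of the disk -/

section Norm

variable {F A C : Type u} [Field F] [Fintype F] [CommRing A] [Algebra F A] [NormedField C]
  [Algebra F C]

/-- A nonzero `z` generates a finite field over `F`, so it is a root of unity, and its image has
norm one. -/
theorem norm_le_one_of_isAlgebraic {k : Type*} [Field k] [Algebra F k]
    [Algebra.IsAlgebraic F k] (j : k →ₐ[F] C) (z : k) : ‖j z‖ ≤ 1 := by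
  by_cases hz : z = 0
  · simp [hz]
  have hfin : Module.Finite F (IntermediateField.adjoin F {z}) :=
    IntermediateField.adjoin.finiteDimensional (Algebra.IsAlgebraic.isAlgebraic z).isIntegral
  have : Finite (IntermediateField.adjoin F {z}) := Module.finite_of_finite F
  let w : (IntermediateField.adjoin F {z})ˣ :=
    Units.mk0 ⟨z, IntermediateField.mem_adjoin_simple_self F z⟩ fun h => hz (congrArg Subtype.val h)
  have h1 : IsOfFinOrder w := isOfFinOrder_of_finite w
  obtain ⟨n, hn, hw⟩ := isOfFinOrder_iff_pow_eq_one.1 h1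
  have h2 : z ^ n = 1 := congrArg (fun u : (IntermediateField.adjoin F {z})ˣ => (u.1 : k)) hw
  have h3 : IsOfFinOrder (j z) :=
    isOfFinOrder_iff_pow_eq_one.2 ⟨n, hn, by rw [← map_pow, h2, map_one]⟩
  exact h3.norm_eq_one.le

theorem norm_algebraMap_le_one (r : F) : ‖algebraMap F C r‖ ≤ 1 :=
  norm_le_one_of_isAlgebraic (Algebra.ofId F C) r

theorem mem_disk_iff [IsAlgClosed C] {x : Point F A C} :
    x ∈ (disk F A C).carrier ↔ ∀ a, ‖x a‖ ≤ 1 := by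
  change (∀ a, ‖x a‖ ≤ ‖(1 : C)‖ ^ _) ↔ _
  simp only [norm_one, one_pow]

variable [IsUltrametricDist C]

theorem GaussTensor.norm_toHol_le [IsAlgClosed C] (f : GaussTensor F A C) (x : Point F A C)
    (hx : x ∈ (disk F A C).carrier) :
    ‖(GaussTensor.toHol (disk F A C).carrier f).eval x hx‖ ≤ ‖f‖ := by
  refine le_of_forall_gt_imp_ge_of_dense fun r hr => ?_
  obtain ⟨hr, n, a, c, hf, hc⟩ := GaussTensor.hasRepresentation hr
  have hf' : f = ∑ i, (GaussTensor.tmul (a i) (c i) : GaussTensor F A C) := hf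
  let ev : Hol (disk F A C).carrier →+ C :=
    { toFun := fun g => g.eval x hx, map_zero' := rfl, map_add' := fun _ _ => rfl }
  change ‖ev _‖ ≤ r
  rw [hf', map_sum, map_sum]
  refine IsUltrametricDist.norm_sum_le_of_forall_le_of_nonneg hr fun i _ => ?_
  change ‖x (a i) * c i‖ ≤ r
  rw [norm_mul]
  exact (mul_le_mul (mem_disk_iff.1 hx _) (hc i) (norm_nonneg _) zero_le_one).trans_eq (one_mul r)

variable {k : Type*} [Field k] [IsAlgClosed k] [Algebra F k] [Algebra.IsAlgebraic F k]
  [Algebra.FiniteType F A] [IsReduced (k ⊗[F] A)]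

/-- The vectors of values span over `k`, so each `cᵢ` is a `k`-combination of the given sums. The
multipliers have norm at most one, and the ultrametric inequality absorbs the summation. -/
theorem norm_le_of_forall_sum_le (j : k →ₐ[F] C) {ι ι' : Type*} [Fintype ι]
    (b : Module.Basis ι' F A) {e : ι → ι'} (he : Function.Injective e) (c : ι → C)
    {B : ℝ} (hB : 0 ≤ B) (h : ∀ x : A →ₐ[F] k, ‖∑ i, j (x (b (e i))) * c i‖ ≤ B) (i : ι) : ‖c i‖ ≤ B := by
  classical
  have hmem : (Pi.single i 1 : ι → k) ∈
      Submodule.span k (Set.range fun (x : A →ₐ[F] k) (i : ι) => x (b (e i))) := by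
    rw [span_range_eval_eq_top b he]
    exact Submodule.mem_top
  obtain ⟨l, hl⟩ := Finsupp.mem_span_range_iff_exists_finsupp.1 hmem
  -- The coefficients `l` express the `i`-th unit vector through vectors of values, so pairing with
  -- `c` extracts `cᵢ`.
  have key : c i = ∑ x ∈ l.support, j (l x) * ∑ i', j (x (b (e i'))) * c i' := by
    have h1 : ∀ i', j ((Pi.single i 1 : ι → k) i') =
        ∑ x ∈ l.support, j (l x) * j (x (b (e i'))) := by
      intro i'
      rw [← hl, Finsupp.sum, Finset.sum_apply, map_sum]
      simp
    simp only [Finset.mul_sum]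
    rw [Finset.sum_comm]
    simp only [← mul_assoc, ← Finset.sum_mul, ← h1]
    rw [Finset.sum_eq_single i]
    · simp
    · intro i' _ hi'
      simp [Pi.single_eq_of_ne hi']
    · simp
  rw [key]
  refine IsUltrametricDist.norm_sum_le_of_forall_le_of_nonneg hB fun x _ => ?_
  rw [norm_mul]
  exact (mul_le_mul (norm_le_one_of_isAlgebraic j _) (h x) (norm_nonneg _) zero_le_one).trans_eq
    (one_mul B)

theorem comp_mem_disk [IsAlgClosed C] (j : k →ₐ[F] C) (x : A →ₐ[F] k) :
    j.comp x ∈ (disk F A C).carrier :=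
  mem_disk_iff.2 fun a => norm_le_one_of_isAlgebraic j (x a)

/-- The Gauss norm is bounded by the supremum over the points of the disk with algebraic
coordinates. -/
theorem GaussTensor.norm_le_of_forall_eval_le [IsAlgClosed C] (j : k →ₐ[F] C)
    (f : GaussTensor F A C) {B : ℝ} (hB : 0 ≤ B)
    (h : ∀ x : A →ₐ[F] k,
      ‖(GaussTensor.toHol (disk F A C).carrier f).eval (j.comp x) (comp_mem_disk j x)‖ ≤ B) :
    ‖f‖ ≤ B := by
  let b := Module.Basis.ofVectorSpace F A
  obtain ⟨c, hc⟩ := TensorProduct.eq_repr_basis_left b (f : A ⊗[F] C)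
  have hf : f = ∑ i : c.support, (GaussTensor.tmul (b i) (c i) : GaussTensor F A C) := by
    rw [Finset.sum_coe_sort c.support fun i => (GaussTensor.tmul (b i) (c i) : GaussTensor F A C)]
    exact hc.symm
  have hle : ∀ i : c.support, ‖c i‖ ≤ B := by
    refine norm_le_of_forall_sum_le j b (e := fun i : c.support => i.1)
      Subtype.val_injective _ hB fun x => ?_
    refine le_trans (le_of_eq ?_) (h x)
    congr 1
    let ev : Hol (disk F A C).carrier →+ C :=
      { toFun := fun g => g.eval (j.comp x) (comp_mem_disk j x)
        map_zero' := rfl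
        map_add' := fun _ _ => rfl }
    change _ = ev _
    conv_rhs => rw [hf, map_sum, map_sum]
    rfl
  let e := Fintype.equivFin c.support
  refine GaussTensor.norm_le ⟨hB, _, fun i => b (e.symm i), fun i => c (e.symm i), ?_,
    fun i => hle _⟩
  refine Eq.trans ?_ (GaussTensor.sum_tmul_eq _ _).symm
  rw [e.symm.sum_comp fun i : c.support => (GaussTensor.tmul (b i) (c i) : GaussTensor F A C)]
  exact hf

end Norm

/-! ## The algebra of the unit disk -/

section Disk

variable {F A C : Type u} [Field F] [CommRing A] [Algebra F A] [NormedField C] [Algebra F C]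

theorem AffinoidSet.mem_functions_of_forall_exists (Z : AffinoidSet C) {f : Z.carrier → C}
    (h : ∀ ε : ℝ, 0 < ε → ∃ g ∈ Z.functions, ∀ z, ‖f z - g z‖ ≤ ε) : f ∈ Z.functions := by
  intro ε hε
  obtain ⟨g, hg, hfg⟩ := h (ε / 2) (half_pos hε)
  obtain ⟨p, hp⟩ := hg (ε / 2) (half_pos hε)
  refine ⟨p, fun z => ?_⟩
  have := norm_sub_le_norm_sub_add_norm_sub (f z) (g z) (MvPolynomial.eval z.1 p)
  linarith [hfg z, hp z]

/-- Pullback preserves uniform approximation, and affinoid algebras are uniformly closed; this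
supplies completeness of the algebra of the disk. -/
theorem mem_holSubalgebra_of_forall_exists {U : Set (Point F A C)} {f : U → C}
    (h : ∀ ε : ℝ, 0 < ε → ∃ g : Hol U, ∀ x : U, ‖f x - g.eval x.1 x.2‖ ≤ ε) :
    f ∈ holSubalgebra U := by
  intro Z φ hφ hU
  refine Z.mem_functions_of_forall_exists fun ε hε => ?_
  obtain ⟨g, hg⟩ := h ε hε
  exact ⟨_, g.2 Z φ hφ hU, fun z => hg _⟩

/-- The element of `A ⊗ C` obtained from a polynomial over `C` by substituting elements of `A`. -/
def tensorOfPolynomial {n : ℕ} (t : Fin n → A) :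
    MvPolynomial (Fin n) C →+* A ⊗[F] C :=
  MvPolynomial.eval₂Hom (Algebra.TensorProduct.includeRight : C →ₐ[F] A ⊗[F] C).toRingHom
    fun i => t i ⊗ₜ[F] 1

theorem toHol_tensorOfPolynomial_eval {n : ℕ} (t : Fin n → A) (p : MvPolynomial (Fin n) C)
    {U : Set (Point F A C)} (x : Point F A C) (hx : x ∈ U) :
    (GaussTensor.toHol U (tensorOfPolynomial t p)).eval x hx =
      MvPolynomial.eval (fun i => x (t i)) p := by
  let ev : Hol U →+* C := (Pi.evalRingHom (fun _ : U => C) ⟨x, hx⟩).comp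
    (holSubalgebra U).val.toRingHom
  have : (ev.comp (Hol.ofTensor U).toRingHom).comp (tensorOfPolynomial t) =
      MvPolynomial.eval fun i => x (t i) := by
    refine MvPolynomial.ringHom_ext (fun c => ?_) (fun i => ?_)
    · rw [MvPolynomial.eval_C, RingHom.comp_apply, tensorOfPolynomial, MvPolynomial.coe_eval₂Hom,
        MvPolynomial.eval₂_C]
      change x 1 * c = c
      rw [map_one, one_mul]
    · rw [MvPolynomial.eval_X, RingHom.comp_apply, tensorOfPolynomial, MvPolynomial.coe_eval₂Hom,
        MvPolynomial.eval₂_X]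
      change x (t i) * 1 = _
      rw [mul_one]
  exact RingHom.congr_fun this p

variable [Fintype F] [IsAlgClosed C]

/-- It sends the whole zero locus in the polydisc into the disk: elements of `A` are polynomials
over `F` in the generators, and `F` has norm at most one. -/
theorem norm_aeval_le_one [IsUltrametricDist C] {n : ℕ} {z : Fin n → C} (hz : ∀ i, ‖z i‖ ≤ 1)
    (p : MvPolynomial (Fin n) F) : ‖MvPolynomial.aeval z p‖ ≤ 1 := by
  induction p using MvPolynomial.induction_on with
  | C a => simpa using norm_algebraMap_le_one a
  | add p q hp hq =>
    rw [map_add]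
    exact (IsUltrametricDist.norm_add_le_max _ _).trans (max_le hp hq)
  | mul_X p i hp =>
    rw [map_mul, MvPolynomial.aeval_X, norm_mul]
    exact mul_le_one₀ hp (norm_nonneg _) (hz i)

theorem eval_map_algebraMap_eq_aeval {n : ℕ} (z : Fin n → C) (p : MvPolynomial (Fin n) F) :
    MvPolynomial.eval z (p.map (algebraMap F C)) = MvPolynomial.aeval z p := by
  rw [MvPolynomial.eval_map, MvPolynomial.aeval_def]

variable (C) in
/-- The zero locus in the polydisc of an ideal of `F[t₁,…,tₙ]`. -/
def affinoidOfIdeal {n : ℕ}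
    (I : Ideal (MvPolynomial (Fin n) F)) : AffinoidSet C where
  dim := n
  carrier := {z | z ∈ polydisc C n ∧ ∀ p ∈ I, MvPolynomial.aeval z p = 0}
  isAnalytic := by
    refine ⟨(fun (p : MvPolynomial (Fin n) F) (z : polydisc C n) =>
      MvPolynomial.aeval z.1 p) '' I, ?_, ?_⟩
    · rintro _ ⟨p, -, rfl⟩ ε hε
      refine ⟨p.map (algebraMap F C), fun z => ?_⟩
      refine le_trans (le_of_eq ?_) hε.le
      rw [norm_eq_zero, sub_eq_zero]
      exact (eval_map_algebraMap_eq_aeval z.1 p).symm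
    · ext z
      constructor
      · rintro ⟨hz, h⟩
        refine ⟨hz, ?_⟩
        rintro _ ⟨p, hp, rfl⟩
        exact h p hp
      · rintro ⟨hz, h⟩
        exact ⟨hz, fun p hp => h _ ⟨p, hp, rfl⟩⟩

variable [Algebra.FiniteType F A] [IsUltrametricDist C]

/-- Analytic functions on the unit disk are uniform limits of elements of `A ⊗ C`. -/
theorem Hol.exists_norm_sub_toHol_le (f : Hol (disk F A C).carrier) {ε : ℝ} (hε : 0 < ε) :
    ∃ v : GaussTensor F A C, ∀ x hx,
      ‖f.eval x hx - (GaussTensor.toHol (disk F A C).carrier v).eval x hx‖ ≤ ε := by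
  obtain ⟨n, π, hπ⟩ := Algebra.FiniteType.iff_quotient_mvPolynomial''.1 ‹Algebra.FiniteType F A›
  -- Generators of `A` realise the disk as the zero locus of their relations in a polydisc.
  -- Analyticity of `f`, tested on this parametrization, gives a polynomial approximation, which is
  -- then read in `A ⊗ C`.
  let Z := affinoidOfIdeal C (RingHom.ker π)
  have hex : ∀ z : Z.carrier, ∃ x : Point F A C, ∀ p, x (π p) = MvPolynomial.aeval z.1 p := by
    intro z
    let g : (MvPolynomial (Fin n) F ⧸ RingHom.ker π) →ₐ[F] C :=
      Ideal.Quotient.liftₐ _ (MvPolynomial.aeval z.1) z.2.2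
    refine ⟨g.comp (Ideal.quotientKerAlgEquivOfSurjective hπ).symm.toAlgHom, fun p => ?_⟩
    have : (Ideal.quotientKerAlgEquivOfSurjective hπ).symm (π p) = Ideal.Quotient.mk _ p := by
      rw [AlgEquiv.symm_apply_eq]
      rfl
    change g ((Ideal.quotientKerAlgEquivOfSurjective hπ).symm (π p)) = _
    rw [this]
    rfl
  choose φ hφ using hex
  have hmor : IsMorphism Z φ := by
    intro a ε hε
    obtain ⟨p, rfl⟩ := hπ a
    refine ⟨p.map (algebraMap F C), fun z => ?_⟩
    have : φ z (π p) = MvPolynomial.eval z.1 (p.map (algebraMap F C)) :=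
      (hφ z p).trans (eval_map_algebraMap_eq_aeval z.1 p).symm
    refine le_trans (le_of_eq ?_) hε.le
    rw [norm_eq_zero, sub_eq_zero]
    exact this
  have hdisk : ∀ z, φ z ∈ (disk F A C).carrier := by
    intro z
    rw [mem_disk_iff]
    intro a
    obtain ⟨p, rfl⟩ := hπ a
    rw [hφ]
    exact norm_aeval_le_one z.2.1 p
  obtain ⟨(p : MvPolynomial (Fin n) C), hp⟩ := f.2 Z φ hmor hdisk ε hε
  refine ⟨tensorOfPolynomial (fun i => π (MvPolynomial.X i)) p, fun x hx => ?_⟩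
  -- Every point of the disk is reached: its values at the generators lie in the zero locus.
  have hz : (fun i => x (π (MvPolynomial.X i))) ∈ Z.carrier := by
    have h : ∀ q, MvPolynomial.aeval (fun i => x (π (MvPolynomial.X i))) q = x (π q) := fun q =>
      (AlgHom.congr_fun (MvPolynomial.aeval_unique (x.comp π)) q).symm
    refine ⟨fun i => mem_disk_iff.1 hx _, fun q hq => ?_⟩
    rw [h, show π q = 0 from hq, map_zero]
  have hx' : φ ⟨_, hz⟩ = x := by
    refine AlgHom.ext fun a => ?_
    obtain ⟨q, rfl⟩ := hπ a
    rw [hφ]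
    exact (AlgHom.congr_fun (MvPolynomial.aeval_unique (x.comp π)) q).symm
  have h := hp ⟨_, hz⟩
  rw [toHol_tensorOfPolynomial_eval (fun i => π (MvPolynomial.X i)) (p : MvPolynomial (Fin n) C)]
  refine le_trans (le_of_eq ?_) h
  congr 2
  exact congrArg f.1 (Subtype.ext hx'.symm)

theorem Hol.bddAbove_norm (f : Hol (disk F A C).carrier) :
    BddAbove (Set.range fun x : (disk F A C).carrier => ‖f.eval x.1 x.2‖) := by
  obtain ⟨v, hv⟩ := f.exists_norm_sub_toHol_le one_pos
  refine ⟨1 + ‖v‖, ?_⟩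
  rintro _ ⟨x, rfl⟩
  have h1 := norm_add_le (f.eval x.1 x.2 - (GaussTensor.toHol (disk F A C).carrier v).eval x.1 x.2)
    ((GaussTensor.toHol (disk F A C).carrier v).eval x.1 x.2)
  rw [sub_add_cancel] at h1
  exact h1.trans (add_le_add (hv _ _) (v.norm_toHol_le _ _))

variable (F A C) in
/-- The supremum norm on the algebra of the unit disk. -/
def supNorm : AddGroupNorm (Hol (disk F A C).carrier) where
  toFun f := ⨆ x : (disk F A C).carrier, ‖f.eval x.1 x.2‖
  map_zero' := by
    have : ∀ x : (disk F A C).carrier,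
        ‖(0 : Hol (disk F A C).carrier).eval x.1 x.2‖ = 0 := fun x => norm_zero
    simp only [this, Real.iSup_const_zero]
  add_le' f g := Real.iSup_le (fun x => (norm_add_le (f.eval x.1 x.2) (g.eval x.1 x.2)).trans
    (add_le_add (le_ciSup f.bddAbove_norm x) (le_ciSup g.bddAbove_norm x)))
    (add_nonneg (Real.iSup_nonneg fun _ => norm_nonneg _) (Real.iSup_nonneg fun _ => norm_nonneg _))
  neg' f := by
    have : ∀ x : (disk F A C).carrier, ‖(-f).eval x.1 x.2‖ = ‖f.eval x.1 x.2‖ :=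
      fun x => norm_neg (f.eval x.1 x.2)
    simp only [this]
  eq_zero_of_map_eq_zero' f hf := Hol.ext fun x hx =>
    norm_le_zero_iff.1 ((le_ciSup f.bddAbove_norm ⟨x, hx⟩).trans_eq hf)

instance : NormedAddCommGroup (Hol (disk F A C).carrier) :=
  AddGroupNorm.toNormedAddCommGroup (supNorm F A C)

theorem Hol.norm_eval_le (f : Hol (disk F A C).carrier) (x : Point F A C)
    (hx : x ∈ (disk F A C).carrier) : ‖f.eval x hx‖ ≤ ‖f‖ :=
  le_ciSup f.bddAbove_norm ⟨x, hx⟩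

theorem Hol.norm_le (f : Hol (disk F A C).carrier) {B : ℝ} (hB : 0 ≤ B)
    (h : ∀ x hx, ‖f.eval x hx‖ ≤ B) : ‖f‖ ≤ B :=
  Real.iSup_le (fun x => h x.1 x.2) hB

/-- Evaluation of analytic functions at a point of the disk. -/
def Hol.evalHom (x : Point F A C) (hx : x ∈ (disk F A C).carrier) :
    Hol (disk F A C).carrier →+ C where
  toFun f := f.eval x hx
  map_zero' := rfl
  map_add' _ _ := rfl

theorem Hol.eval_sub (f g : Hol (disk F A C).carrier) (x : Point F A C)
    (hx : x ∈ (disk F A C).carrier) : (f - g).eval x hx = f.eval x hx - g.eval x hx := rfl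

/-- A Cauchy sequence converges pointwise, the Cauchy estimate makes the convergence uniform, and
uniform limits of analytic functions are analytic. -/
instance [CompleteSpace C] : CompleteSpace (Hol (disk F A C).carrier) := by
  refine Metric.complete_of_cauchySeq_tendsto fun s hs => ?_
  have hlim : ∀ x : (disk F A C).carrier, ∃ c, Filter.Tendsto (fun n => (s n).eval x.1 x.2)
      Filter.atTop (nhds c) := by
    intro x
    have h : UniformContinuous (Hol.evalHom x.1 x.2) :=
      uniformContinuous_addMonoidHom_of_continuous
        (AddMonoidHomClass.continuous_of_bound _ 1
          fun f => by rw [one_mul]; exact f.norm_eval_le x.1 x.2)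
    exact cauchySeq_tendsto_of_complete (h.comp_cauchySeq hs)
  choose g hg using hlim
  have hunif : ∀ ε : ℝ, 0 < ε → ∃ N, ∀ n ≥ N, ∀ x, ‖g x - (s n).eval x.1 x.2‖ ≤ ε := by
    intro ε hε
    obtain ⟨N, hN⟩ := Metric.cauchySeq_iff.1 hs ε hε
    refine ⟨N, fun n hn x => ?_⟩
    refine le_of_tendsto ((hg x).sub_const _).norm ?_
    filter_upwards [Filter.eventually_ge_atTop N] with m hm
    have := hN m hm n hn
    rw [dist_eq_norm] at this
    rw [← Hol.eval_sub]
    exact (Hol.norm_eval_le _ _ _).trans this.le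
  have hmem : g ∈ holSubalgebra (disk F A C).carrier :=
    mem_holSubalgebra_of_forall_exists fun ε hε => by
      obtain ⟨N, hN⟩ := hunif ε hε
      exact ⟨s N, hN N le_rfl⟩
  let G : Hol (disk F A C).carrier := ⟨g, hmem⟩
  refine ⟨G, Metric.tendsto_atTop.2 fun ε hε => ?_⟩
  obtain ⟨N, hN⟩ := hunif (ε / 2) (half_pos hε)
  refine ⟨N, fun n hn => ?_⟩
  rw [dist_comm, dist_eq_norm]
  refine (Hol.norm_le _ (half_pos hε).le fun x hx => ?_).trans_lt (half_lt_self hε)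
  exact hN n hn ⟨x, hx⟩

instance : ContinuousConstSMul C (Hol (disk F A C).carrier) :=
  ⟨fun c => AddMonoidHomClass.continuous_of_bound
    (DistribSMul.toAddMonoidHom (Hol (disk F A C).carrier) c) ‖c‖ fun f => by
      refine Hol.norm_le _ (by positivity) fun x hx => ?_
      have : (c • f).eval x hx = c * f.eval x hx := rfl
      rw [DistribSMul.toAddMonoidHom_apply, this, norm_mul]
      exact mul_le_mul_of_nonneg_left (f.norm_eval_le x hx) (norm_nonneg c)⟩

theorem Hol.eval_smul_left (a : A) (f : Hol (disk F A C).carrier) (x : Point F A C)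
    (hx : x ∈ (disk F A C).carrier) : (a • f).eval x hx = x a * f.eval x hx := by
  rw [Algebra.smul_def]
  rfl

instance : ContinuousConstSMul A (Hol (disk F A C).carrier) :=
  ⟨fun a => AddMonoidHomClass.continuous_of_bound
    (DistribSMul.toAddMonoidHom (Hol (disk F A C).carrier) a) 1 fun f => by
      refine Hol.norm_le _ (by positivity) fun x hx => ?_
      rw [DistribSMul.toAddMonoidHom_apply, Hol.eval_smul_left, norm_mul]
      exact mul_le_mul (mem_disk_iff.1 hx a) (f.norm_eval_le x hx) (norm_nonneg _) zero_le_one⟩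

theorem Hol.continuous_frobTwist : Continuous (Hol.frobTwist (disk F A C)) := by
  refine continuous_of_continuousAt_zero (Hol.frobTwist (disk F A C)) ?_
  rw [ContinuousAt, map_zero, Metric.tendsto_nhds_nhds]
  intro ε hε
  refine ⟨min 1 (ε / 2), lt_min one_pos (half_pos hε), fun f hf => ?_⟩
  rw [dist_zero_right] at hf ⊢
  have h0 : 0 ≤ min 1 (ε / 2) := le_min zero_le_one (half_pos hε).le
  refine (Hol.norm_le _ h0 fun x hx => ?_).trans_lt
    ((min_le_right _ _).trans_lt (half_lt_self hε))
  let y := f.eval (Point.twist (frob F C).symm x) ((disk F A C).twist_symm_mem x hx)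
  have hy : ‖y‖ ≤ min 1 (ε / 2) := (f.norm_eval_le _ _).trans hf.le
  change ‖y ^ Fintype.card F‖ ≤ _
  rw [norm_pow]
  exact (pow_le_of_le_one (norm_nonneg _) (hy.trans (min_le_left _ _))
    Fintype.card_ne_zero).trans hy

end Disk

/-! ## The completion of `A ⊗ C` -/

/-- The extension is an isometry from a complete space, so its image is closed; it contains a dense
subset. -/
theorem bijective_extension {N H : Type*} [SeminormedAddCommGroup N] [NormedAddCommGroup H]
    [CompleteSpace H] (θ : N →+ H) (hθ : Isometry θ) (hd : DenseRange θ) :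
    Function.Bijective (θ.extension hθ.continuous) := by
  have hiso : Isometry (θ.extension hθ.continuous) := hθ.completion_extension
  refine ⟨hiso.injective, ?_⟩
  rw [← Set.range_eq_univ, ← hiso.isClosedEmbedding.isClosed_range.closure_eq]
  refine Set.eq_univ_of_univ_subset ?_
  rw [← hd.closure_range]
  refine closure_mono ?_
  rintro _ ⟨v, rfl⟩
  exact ⟨v, θ.extension_coe hθ.continuous v⟩

section CompletedTensor

variable {F A C : Type u} [Field F] [Fintype F] [CommRing A] [Algebra F A] [NormedField C]
  [IsAlgClosed C] [Algebra F C] [Algebra.FiniteType F A]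
  [IsReduced (AlgebraicClosure F ⊗[F] A)] [IsUltrametricDist C]

variable (F A C) in
/-- The canonical map from `A ⊗ C` to the algebra of the unit disk. -/
def toDisk : GaussTensor F A C →+ Hol (disk F A C).carrier :=
  (GaussTensor.toHol (disk F A C).carrier).toAddMonoidHom

/-- One inequality is the ultrametric bound on values. The other already uses only points with
values in the algebraic closure of `F`. -/
theorem norm_toDisk (f : GaussTensor F A C) : ‖toDisk F A C f‖ = ‖f‖ := by
  refine le_antisymm (Hol.norm_le _ (norm_nonneg _) fun x hx => f.norm_toHol_le x hx) ?_
  exact f.norm_le_of_forall_eval_le (IsAlgClosed.lift : AlgebraicClosure F →ₐ[F] C)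
    (norm_nonneg _) fun x => Hol.norm_eval_le (toDisk F A C f) _ _

theorem isometry_toDisk : Isometry (toDisk F A C) :=
  AddMonoidHomClass.isometry_of_norm _ norm_toDisk

theorem denseRange_toDisk : DenseRange (toDisk F A C) := by
  intro f
  rw [Metric.mem_closure_iff]
  intro ε hε
  obtain ⟨v, hv⟩ := f.exists_norm_sub_toHol_le (half_pos hε)
  refine ⟨_, ⟨v, rfl⟩, ?_⟩
  rw [dist_eq_norm]
  exact (Hol.norm_le _ (half_pos hε).le hv).trans_lt (half_lt_self hε)

/-- A function on the disk which vanishes at the points with algebraic coordinates is zero. -/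
theorem Hol.eq_zero_of_forall_eval_eq_zero (f : Hol (disk F A C).carrier)
    (h : ∀ x : A →ₐ[F] AlgebraicClosure F,
      f.eval ((IsAlgClosed.lift : AlgebraicClosure F →ₐ[F] C).comp x) (comp_mem_disk _ x) = 0) :
    f = 0 := by
  rw [← norm_le_zero_iff]
  refine le_of_forall_pos_le_add fun ε hε => ?_
  obtain ⟨v, hv⟩ := f.exists_norm_sub_toHol_le (half_pos hε)
  have h1 : ‖f - toDisk F A C v‖ ≤ ε / 2 := Hol.norm_le _ (half_pos hε).le hv
  -- At these points `v` is as small as the approximation error, and they control its Gauss norm.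
  have h2 : ‖v‖ ≤ ε / 2 := by
    refine v.norm_le_of_forall_eval_le (IsAlgClosed.lift : AlgebraicClosure F →ₐ[F] C)
      (half_pos hε).le fun x => ?_
    have := hv _ (comp_mem_disk (IsAlgClosed.lift : AlgebraicClosure F →ₐ[F] C) x)
    rwa [h x, zero_sub, norm_neg] at this
  have h3 := norm_add_le (f - toDisk F A C v) (toDisk F A C v)
  rw [sub_add_cancel, norm_toDisk] at h3
  linarith

variable [CompleteSpace C] {ℓ : A →ₐ[F] C} {d : ℕ} {E : AndersonModule ℓ d}

variable (F A C) in
theorem isometry_compLeft_toDisk (d : ℕ) : Isometry ((toDisk F A C).compLeft (Fin d)) := by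
  refine AddMonoidHomClass.isometry_of_norm _ fun v => ?_
  rw [Pi.norm_def, Pi.norm_def]
  congr 2
  funext i
  exact NNReal.eq (norm_toDisk (v i))

variable (F A C) in
theorem denseRange_compLeft_toDisk (d : ℕ) : DenseRange ((toDisk F A C).compLeft (Fin d)) :=
  DenseRange.piMap fun _ : Fin d => denseRange_toDisk (F := F) (A := A) (C := C)

/-- The canonical map from `A ⊗ E(C)` to `𝒪_𝔛(𝔇)^d`. -/
def Coordinates.toDisk (κ : Coordinates F E.functor d) :
    κ.MetricTensor →+ (Fin d → Hol (disk F A C).carrier) :=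
  ((CostableSite.toDisk F A C).compLeft (Fin d)).comp κ.gaussHom

theorem Coordinates.isometry_toDisk (κ : Coordinates F E.functor d) : Isometry κ.toDisk :=
  (isometry_compLeft_toDisk F A C d).comp κ.isometry_gaussHom

theorem Coordinates.denseRange_toDisk (κ : Coordinates F E.functor d) : DenseRange κ.toDisk := by
  have h := DenseRange.comp (denseRange_compLeft_toDisk F A C d)
    (κ.gauss.surjective : Function.Surjective κ.gaussHom).denseRange
    (isometry_compLeft_toDisk F A C d).continuous
  exact h

/-- The isomorphism `A ⊗̂ E(C) ≅ 𝒪_𝔛(𝔇)^d`. -/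
def Coordinates.completedToDisk (κ : Coordinates F E.functor d) :
    κ.CompletedTensor ≃+ (Fin d → Hol (disk F A C).carrier) :=
  AddEquiv.ofBijective (κ.toDisk.extension κ.isometry_toDisk.continuous)
    (bijective_extension κ.toDisk κ.isometry_toDisk κ.denseRange_toDisk)

theorem Coordinates.continuous_completedToDisk (κ : Coordinates F E.functor d) :
    Continuous κ.completedToDisk :=
  κ.toDisk.continuous_extension κ.isometry_toDisk.continuous

theorem Coordinates.completedToDisk_coe (κ : Coordinates F E.functor d) (v : κ.MetricTensor) :
    κ.completedToDisk (v : κ.CompletedTensor) = κ.toDisk v :=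
  κ.toDisk.extension_coe κ.isometry_toDisk.continuous v

/-- Multiplication by `r ∈ A ⊗ A` on `A ⊗̂ E(C)`. -/
def Coordinates.completedMul (κ : Coordinates F E.functor d) (r : A ⊗[F] A) :
    κ.CompletedTensor → κ.CompletedTensor :=
  UniformSpace.Completion.map (κ.mulMap r)

theorem Coordinates.completedMul_coe (κ : Coordinates F E.functor d) (r : A ⊗[F] A)
    (v : κ.MetricTensor) :
    κ.completedMul r (v : κ.CompletedTensor) = (κ.mulMap r v : κ.MetricTensor) :=
  UniformSpace.Completion.map_coe (κ.uniformContinuous_mulMap r) v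

theorem Coordinates.continuous_completedMul (κ : Coordinates F E.functor d) (r : A ⊗[F] A) :
    Continuous (κ.completedMul r) :=
  UniformSpace.Completion.continuous_map

theorem Coordinates.completedMul_zero (κ : Coordinates F E.functor d) (y : κ.CompletedTensor) :
    κ.completedMul 0 y = 0 := by
  induction y using UniformSpace.Completion.induction_on with
  | hp => exact isClosed_eq (κ.continuous_completedMul 0) continuous_const
  | ih v => rw [κ.completedMul_coe, κ.mulMap_zero]; rfl

theorem Coordinates.completedMul_add (κ : Coordinates F E.functor d) (r r' : A ⊗[F] A)
    (y : κ.CompletedTensor) :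
    κ.completedMul (r + r') y = κ.completedMul r y + κ.completedMul r' y := by
  induction y using UniformSpace.Completion.induction_on with
  | hp =>
    exact isClosed_eq (κ.continuous_completedMul _)
      ((κ.continuous_completedMul r).add (κ.continuous_completedMul r'))
  | ih v =>
    rw [κ.completedMul_coe, κ.completedMul_coe, κ.completedMul_coe, κ.mulMap_add,
      ← UniformSpace.Completion.coe_add]
    rfl

theorem Coordinates.completedMul_mul (κ : Coordinates F E.functor d) (r r' : A ⊗[F] A)
    (y : κ.CompletedTensor) :
    κ.completedMul (r * r') y = κ.completedMul r (κ.completedMul r' y) := by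
  induction y using UniformSpace.Completion.induction_on with
  | hp =>
    exact isClosed_eq (κ.continuous_completedMul _)
      ((κ.continuous_completedMul r).comp (κ.continuous_completedMul r'))
  | ih v => rw [κ.completedMul_coe, κ.completedMul_coe, κ.completedMul_coe, κ.mulMap_mul]; rfl

theorem Coordinates.completedToDisk_left (κ : Coordinates F E.functor d) (a : A)
    (y : κ.CompletedTensor) :
    κ.completedToDisk (κ.completedMul (a ⊗ₜ[F] (1 : A)) y) = a • κ.completedToDisk y := by
  induction y using UniformSpace.Completion.induction_on with
  | hp =>
    exact isClosed_eq (κ.continuous_completedToDisk.comp (κ.continuous_completedMul _))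
      (κ.continuous_completedToDisk.const_smul a)
  | ih v =>
    rw [κ.completedMul_coe, κ.completedToDisk_coe, κ.completedToDisk_coe]
    funext i
    change GaussTensor.toHol _ (κ.gaussHom _ i) = a • GaussTensor.toHol _ (κ.gaussHom v i)
    rw [κ.gaussHom_mulMap_left, ← GaussTensor.toHol_smul_left]
    rfl

/-- Both sides are continuous and agree on the dense image of `A ⊗ E(C)`, where the formula is
algebraic. -/
theorem Coordinates.completedToDisk_right (κ : Coordinates F E.functor d) (b : A)
    (y : κ.CompletedTensor) :
    κ.completedToDisk (κ.completedMul ((1 : A) ⊗ₜ[F] b) y) =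
      (κ.actionMatrix b).apply (Hol.frobTwist (disk F A C)) (κ.completedToDisk y) := by
  induction y using UniformSpace.Completion.induction_on with
  | hp =>
    exact isClosed_eq (κ.continuous_completedToDisk.comp (κ.continuous_completedMul _))
      ((TauMatrix.continuous_apply Hol.continuous_frobTwist _).comp κ.continuous_completedToDisk)
  | ih v =>
    rw [κ.completedMul_coe, κ.completedToDisk_coe, κ.completedToDisk_coe]
    funext i
    change GaussTensor.toHol _ (κ.gaussHom _ i) = _
    rw [κ.gaussHom_mulMap_right]
    exact TauMatrix.apply_map _ (GaussTensor.toHol (disk F A C).carrier)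
      (GaussTensor.toHol_frob (disk F A C)) _ i

end CompletedTensor

/-! ## Functions on the disk modulo the ideal of a point -/

section Decomposition

variable {F A C : Type u} [Field F] [CommRing A] [Algebra F A]

/-- The kernel of a point of `A` with values in an algebraic extension of `F` is finitely generated
and of finite codimension, so that `A` splits accordingly. -/
theorem exists_linear_splitting [Algebra.FiniteType F A] {k : Type*} [Field k] [Algebra F k]
    [Algebra.IsAlgebraic F k] (x : A →ₐ[F] k) :
    ∃ (n m : ℕ) (s : Fin n → A) (l : Fin n → A →ₗ[F] F) (a : Fin m → A)
      (T : Fin m → A →ₗ[F] A), (∀ i, x (a i) = 0) ∧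
      ∀ t, t = ∑ j, l j t • s j + ∑ i, a i * T i t := by
  have : IsNoetherianRing A := Algebra.FiniteType.isNoetherianRing F A
  have : Algebra.FiniteType F x.range :=
    Algebra.FiniteType.of_surjective x.rangeRestrict x.rangeRestrict_surjective
  have : Algebra.IsIntegral F x.range :=
    Algebra.IsIntegral.of_injective x.range.val Subtype.val_injective
  have hfin : Module.Finite F x.range := Algebra.IsIntegral.finite
  let e := Module.finBasis F x.range
  choose s hs using fun j => x.rangeRestrict_surjective (e j)
  obtain ⟨m, a, ha⟩ := Submodule.fg_iff_exists_fin_generating_family.1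
    (IsNoetherian.noetherian (RingHom.ker x))
  -- The forms `l` are the coordinates of `x t` in the finite-dimensional image of `x`, and `s`
  -- lifts the basis. So `p` maps into the kernel of `x`, and an `F`-linear section of `σ` writes
  -- the remainder on generators of that kernel.
  let l : Fin (Module.finrank F x.range) → A →ₗ[F] F :=
    fun j => (e.coord j).comp x.rangeRestrict.toLinearMap
  let σ : (Fin m → A) →ₗ[F] A := (Fintype.linearCombination A a).restrictScalars F
  let p : A →ₗ[F] A := LinearMap.id - ∑ j, (l j).smulRight (s j)
  have hp : ∀ t, p t = t - ∑ j, l j t • s j := fun t => by simp [p]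
  have hmem : ∀ t, p t ∈ LinearMap.range σ := by
    intro t
    have h1 : p t ∈ RingHom.ker x := by
      have h2 : x.rangeRestrict (p t) = 0 := by
        rw [hp, map_sub, map_sum, sub_eq_zero]
        refine (e.sum_repr (x.rangeRestrict t)).symm.trans (Finset.sum_congr rfl fun j _ => ?_)
        rw [map_smul, hs]
        rfl
      exact congrArg Subtype.val h2
    rw [← ha, ← Fintype.range_linearCombination] at h1
    exact h1
  obtain ⟨g, hg⟩ := σ.rangeRestrict.exists_rightInverse_of_surjective
    (LinearMap.range_rangeRestrict σ)
  refine ⟨_, m, s, l, a, fun i => (LinearMap.proj i).comp (g.comp (p.codRestrict _ hmem)),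
    fun i => ?_, fun t => ?_⟩
  · have : a i ∈ RingHom.ker x := ha ▸ Submodule.subset_span ⟨i, rfl⟩
    exact this
  · have h1 : σ (g (p.codRestrict _ hmem t)) = p t :=
      congrArg Subtype.val (LinearMap.congr_fun hg (p.codRestrict _ hmem t))
    have h2 : σ (g (p.codRestrict _ hmem t)) =
        ∑ i, a i * g (p.codRestrict _ hmem t) i := by
      simp [σ, Fintype.linearCombination_apply, mul_comm]
    rw [h1, hp] at h2
    exact (sub_eq_iff_eq_add'.1 h2)

variable [Fintype F] [NormedField C] [Algebra F C]

/-- A linear form on `A` acting on `A ⊗ C`, with values in `C`. -/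
def GaussTensor.linearForm (l : A →ₗ[F] F) : GaussTensor F A C →+ C :=
  ((TensorProduct.lid F C).toLinearMap ∘ₗ LinearMap.rTensor C l).toAddMonoidHom

theorem GaussTensor.linearForm_tmul (l : A →ₗ[F] F) (a : A) (c : C) :
    GaussTensor.linearForm l (GaussTensor.tmul a c : GaussTensor F A C) = l a • c :=
  TensorProduct.lid_tmul c (l a)

theorem GaussTensor.continuous_linearForm [IsUltrametricDist C] (l : A →ₗ[F] F) :
    Continuous (GaussTensor.linearForm l : GaussTensor F A C →+ C) :=
  AddMonoidHomClass.continuous_of_bound _ 1 fun f => by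
    rw [one_mul]
    refine le_of_forall_gt_imp_ge_of_dense fun r hr => ?_
    obtain ⟨hr, n, a, c, hf, hc⟩ := GaussTensor.hasRepresentation hr
    have hf' : f = ∑ i, (GaussTensor.tmul (a i) (c i) : GaussTensor F A C) := hf
    rw [hf', map_sum]
    refine IsUltrametricDist.norm_sum_le_of_forall_le_of_nonneg hr fun i _ => ?_
    rw [GaussTensor.linearForm_tmul, Algebra.smul_def, norm_mul]
    exact (mul_le_mul (norm_algebraMap_le_one _) (hc i) (norm_nonneg _) zero_le_one).trans_eq
      (one_mul r)

/-- The splitting of `A` is tensored with `C`. All the operators involved are bounded for the Gauss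
norm, so the identity survives passage to limits. -/
theorem GaussTensor.eq_sum_of_splitting {n m : ℕ} {s : Fin n → A} {l : Fin n → A →ₗ[F] F}
    {a : Fin m → A} {T : Fin m → A →ₗ[F] A} (h : ∀ t, t = ∑ j, l j t • s j + ∑ i, a i * T i t)
    (f : GaussTensor F A C) :
    f = ∑ j, GaussTensor.tmulHom (s j) (GaussTensor.linearForm (l j) f) +
      ∑ i, a i • GaussTensor.mapLeft (T i) f := by
  induction f using GaussTensor.induction with
  | h0 => simp
  | h1 t c =>
    have h1 : ∀ j, GaussTensor.tmulHom (s j) (GaussTensor.linearForm (l j)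
        (GaussTensor.tmul t c : GaussTensor F A C)) =
          (GaussTensor.tmul (l j t • s j) c : GaussTensor F A C) := by
      intro j
      rw [GaussTensor.linearForm_tmul]
      exact (TensorProduct.smul_tmul (l j t) (s j) c).symm
    have h2 : ∀ i, a i • GaussTensor.mapLeft (T i) (GaussTensor.tmul t c : GaussTensor F A C) =
        (GaussTensor.tmul (a i * T i t) c : GaussTensor F A C) := fun i => rfl
    simp only [h1, h2]
    have h3 : (GaussTensor.tmul t c : GaussTensor F A C) =
        (TensorProduct.mk F A C).flip c t := rfl
    rw [h3]
    conv_lhs => rw [h t]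
    refine (map_add ((TensorProduct.mk F A C).flip c) _ _).trans ?_
    congr 1
    · exact map_sum ((TensorProduct.mk F A C).flip c) _ _
    · exact map_sum ((TensorProduct.mk F A C).flip c) _ _
  | h2 f g hf hg =>
    conv_lhs => rw [hf, hg]
    simp only [map_add, smul_add, Finset.sum_add_distrib]
    abel

variable [IsAlgClosed C] [Algebra.FiniteType F A] [IsReduced (AlgebraicClosure F ⊗[F] A)]
  [IsUltrametricDist C] [CompleteSpace C]

/-- Modulo the ideal of a point with algebraic coordinates, every analytic function on the disk is
congruent to an element of `A ⊗ C`. -/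
theorem Hol.exists_decomposition {k : Type*} [Field k] [Algebra F k] [Algebra.IsAlgebraic F k]
    (x : A →ₐ[F] k) :
    ∃ (m : ℕ) (a : Fin m → A), (∀ i, x (a i) = 0) ∧ ∀ f : Hol (disk F A C).carrier,
      ∃ (v : GaussTensor F A C) (g : Fin m → Hol (disk F A C).carrier),
        f = toDisk F A C v + ∑ i, a i • g i := by
  obtain ⟨n, m, s, l, a, T, ha, h⟩ := exists_linear_splitting x
  refine ⟨m, a, ha, fun f => ?_⟩
  obtain ⟨v, hv, hlim⟩ := mem_closure_iff_seq_limit.1 (denseRange_toDisk f)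
  choose w hw using hv
  obtain rfl : (fun n => toDisk F A C (w n)) = v := funext hw
  -- The approximating tensors are Cauchy because the map to functions is an isometry; the forms `l`
  -- and the operators `T` then yield convergent sequences.
  have hcauchy : CauchySeq w := by
    have := hlim.cauchySeq
    change Cauchy (Filter.map (toDisk F A C ∘ w) Filter.atTop) at this
    rw [← Filter.map_map] at this
    exact isometry_toDisk.isUniformInducing.cauchy_map_iff.1 this
  have hc : ∀ j, ∃ c, Filter.Tendsto (fun n => GaussTensor.linearForm (l j) (w n))
      Filter.atTop (nhds c) := fun j =>
    cauchySeq_tendsto_of_complete ((uniformContinuous_addMonoidHom_of_continuous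
      (GaussTensor.continuous_linearForm (A := A) (C := C) (l j))).comp_cauchySeq hcauchy)
  have hg : ∀ i, ∃ g, Filter.Tendsto (fun n => toDisk F A C (GaussTensor.mapLeft (T i) (w n)))
      Filter.atTop (nhds g) := fun i =>
    cauchySeq_tendsto_of_complete ((isometry_toDisk.uniformContinuous.comp
      (uniformContinuous_addMonoidHom_of_continuous
        (GaussTensor.continuous_mapLeft (T i)))).comp_cauchySeq hcauchy)
  choose c hc using hc
  choose g hg using hg
  -- The part outside the ideal involves only the finitely many fixed `sⱼ`, so its limit is still a
  -- tensor; no completion is needed for it.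
  refine ⟨∑ j, GaussTensor.tmulHom (s j) (c j), g, tendsto_nhds_unique hlim ?_⟩
  have hdec : ∀ n, toDisk F A C (w n) =
      toDisk F A C (∑ j, GaussTensor.tmulHom (s j) (GaussTensor.linearForm (l j) (w n))) +
        ∑ i, a i • toDisk F A C (GaussTensor.mapLeft (T i) (w n)) := by
    intro n
    conv_lhs => rw [GaussTensor.eq_sum_of_splitting h (w n), map_add, map_sum (toDisk F A C)
      fun i => a i • GaussTensor.mapLeft (T i) (w n)]
    exact congrArg _ (Finset.sum_congr rfl fun i _ => GaussTensor.toHol_smul_left _ _ _)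
  simp only [hdec]
  refine Filter.Tendsto.add ?_ ?_
  · refine (isometry_toDisk.continuous.tendsto _).comp (tendsto_finsetSum _ fun j _ => ?_)
    exact ((GaussTensor.continuous_tmulHom (s j)).tendsto _).comp (hc j)
  · exact tendsto_finsetSum _ fun i _ => (hg i).const_smul (a i)

end Decomposition

/-! ## Sections on the unit disk -/

section Disk

variable {F A C : Type u} [Field F] [Fintype F] [CommRing A] [Algebra F A] [NormedField C]
  [IsAlgClosed C] [Algebra F C] {ℓ : A →ₐ[F] C} {d : ℕ} {E : AndersonModule ℓ d}
  {L : FractionalSheaf F A C} {P : EPair E} {κ : Coordinates F E.functor d}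

/-- The inclusion of the analytic functions in the sections of `𝓛`. -/
def FractionalSheaf.ofHol (L : FractionalSheaf F A C) (U : AdmOpen F A C) (d : ℕ) :
    (Fin d → Hol U.carrier) →+ (Fin d → L.sections U) where
  toFun h i := ⟨algebraMap (Hol U.carrier) (Mer U) (h i), L.effective U _⟩
  map_zero' := funext fun _ => Subtype.ext (map_zero _)
  map_add' _ _ := funext fun _ => Subtype.ext (map_add _ _ _)

theorem FractionalSheaf.ofHol_injective (U : AdmOpen F A C) :
    Function.Injective (L.ofHol U d) := fun _ _ h =>
  funext fun i => Mer.algebraMap_injective U (congrArg Subtype.val (congrFun h i))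

theorem FractionalSheaf.ofHol_smul (U : AdmOpen F A C) (a : A) (h : Fin d → Hol U.carrier) :
    L.ofHol U d (a • h) = a • L.ofHol U d h := by
  funext i
  refine Subtype.ext ?_
  change algebraMap (Hol U.carrier) (Mer U) (a • h i) =
    a • algebraMap (Hol U.carrier) (Mer U) (h i)
  rw [Algebra.smul_def, map_mul, ← IsScalarTower.algebraMap_apply, Algebra.smul_def]

theorem FractionalSheaf.IsCostable.act_ofHol (hL : L.IsCostable) (U : CostableOpen F A C)
    (M : TauMatrix C d) (h : Fin d → Hol U.carrier) :
    hL.act U M (L.ofHol U.toAdmOpen d h) =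
      L.ofHol U.toAdmOpen d (M.apply (Hol.frobTwist U) h) := by
  funext i
  refine Subtype.ext ?_
  rw [hL.coe_act]
  exact (M.apply_map (τ := Hol.frobTwist U) (τ' := Mer.frobTwist U)
    (IsScalarTower.toAlgHom C (Hol U.carrier) (Mer U.toAdmOpen)).toLinearMap
    (fun f => (Mer.frobTwist_algebraMap U f).symm) h i).symm

theorem mem_range_ofHol {U : AdmOpen F A C} {G : Fin d → L.sections U} :
    G ∈ Set.range (L.ofHol U d) ↔ ∀ i, ∃ f : Hol U.carrier,
      algebraMap (Hol U.carrier) (Mer U) f = (G i : Mer U) := by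
  refine ⟨?_, fun h => ?_⟩
  · rintro ⟨h, rfl⟩ i
    exact ⟨h i, rfl⟩
  · choose f hf using h
    exact ⟨f, funext fun i => Subtype.ext (hf i)⟩

theorem IsDiskMap.mem_range_iff {m : Comparison L P κ}
    {c : κ.CompletedTensor →+ P.presheaf.obj (Opposite.op (disk F A C))} (hc : IsDiskMap m c)
    (e : P.presheaf.obj (Opposite.op (disk F A C))) :
    e ∈ Set.range c ↔ m.equiv (disk F A C) e ∈ Set.range (L.ofHol (disk F A C).toAdmOpen d) := by
  rw [hc.range_eq, mem_range_ofHol]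
  rfl

/-- If all sections are analytic, the condition describing the image holds for every element. -/
theorem IsDiskMap.bijective {m : Comparison L P κ}
    {c : κ.CompletedTensor →+ P.presheaf.obj (Opposite.op (disk F A C))} (hc : IsDiskMap m c)
    (h : ∀ x ∈ L.sections (disk F A C).toAdmOpen, ∃ f : Hol (disk F A C).carrier,
      algebraMap (Hol (disk F A C).carrier) (Mer (disk F A C).toAdmOpen) f = x) :
    Function.Bijective c :=
  ⟨hc.injective, fun e => (hc.mem_range_iff e).2
    (mem_range_ofHol.2 fun i => h _ (m.equiv (disk F A C) e i).2)⟩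

variable [Algebra.FiniteType F A] [IsReduced (AlgebraicClosure F ⊗[F] A)] [IsUltrametricDist C]
  [CompleteSpace C]

/-- The map `A ⊗̂ E(C) → ℰ(𝔇)`. -/
def Comparison.diskMap (m : Comparison L P κ) :
    κ.CompletedTensor →+ P.presheaf.obj (Opposite.op (disk F A C)) :=
  ((m.equiv (disk F A C)).symm.toAddMonoidHom.comp (L.ofHol (disk F A C).toAdmOpen d)).comp
    κ.completedToDisk.toAddMonoidHom

theorem Comparison.equiv_diskMap (m : Comparison L P κ) (y : κ.CompletedTensor) :
    m.equiv (disk F A C) (m.diskMap y) =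
      L.ofHol (disk F A C).toAdmOpen d (κ.completedToDisk y) :=
  (m.equiv (disk F A C)).apply_symm_apply _

theorem Comparison.diskMap_smul (m : Comparison L P κ) (hL : L.IsCostable) (r : A ⊗[F] A)
    (y : κ.CompletedTensor) : m.diskMap (κ.completedMul r y) = r • m.diskMap y := by
  induction r using TensorProduct.induction_on generalizing y with
  | zero => rw [κ.completedMul_zero, map_zero, zero_smul]
  | tmul a b =>
    have : (a ⊗ₜ[F] b : A ⊗[F] A) = (a ⊗ₜ[F] (1 : A)) * ((1 : A) ⊗ₜ[F] b) := by simp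
    refine (m.equiv (disk F A C)).injective ?_
    rw [this, κ.completedMul_mul, mul_smul, m.equiv_smul_left, m.equiv_smul_right hL,
      m.equiv_diskMap, m.equiv_diskMap, κ.completedToDisk_left, κ.completedToDisk_right,
      L.ofHol_smul, hL.act_ofHol]
  | add r r' hr hr' => rw [κ.completedMul_add, map_add, add_smul, hr, hr']

theorem Comparison.isDiskMap (m : Comparison L P κ) (hL : L.IsCostable) :
    IsDiskMap m m.diskMap where
  extends_ι v := by
    refine (m.equiv (disk F A C)).injective ?_
    rw [m.equiv_diskMap, m.equiv_ι]
    exact congrArg (L.ofHol (disk F A C).toAdmOpen d) (κ.completedToDisk_coe v)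
  map_smul r y := m.diskMap_smul hL r y
  injective := (m.equiv (disk F A C)).symm.injective.comp
    ((FractionalSheaf.ofHol_injective _).comp κ.completedToDisk.injective)
  range_eq := by
    ext e
    refine Iff.trans ?_ (mem_range_ofHol (G := m.equiv (disk F A C) e))
    refine ⟨?_, ?_⟩
    · rintro ⟨y, rfl⟩
      exact ⟨_, (m.equiv_diskMap y).symm⟩
    · rintro ⟨h, hh⟩
      refine ⟨κ.completedToDisk.symm h, (m.equiv (disk F A C)).injective ?_⟩
      rw [m.equiv_diskMap, AddEquiv.apply_symm_apply, hh]

theorem Coordinates.exists_decomposition (κ : Coordinates F E.functor d)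
    {k : Type*} [Field k] [Algebra F k] [Algebra.IsAlgebraic F k] (x : A →ₐ[F] k) :
    ∃ (n : ℕ) (a : Fin n → A), (∀ i, x (a i) = 0) ∧ ∀ y : κ.CompletedTensor,
      ∃ (v : E.Tensor) (z : Fin n → κ.CompletedTensor),
        y = κ.toCompletion v + ∑ i, κ.completedMul (a i ⊗ₜ[F] (1 : A)) (z i) := by
  obtain ⟨n, a, ha, h⟩ := Hol.exists_decomposition (C := C) x
  refine ⟨n, a, ha, fun y => ?_⟩
  choose v g hvg using fun j => h (κ.completedToDisk y j)
  refine ⟨κ.gauss.symm v, fun i => κ.completedToDisk.symm fun j => g j i,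
    κ.completedToDisk.injective ?_⟩
  rw [map_add, map_sum]
  simp only [κ.completedToDisk_left, AddEquiv.apply_symm_apply]
  have h1 : κ.completedToDisk (κ.toCompletion (κ.gauss.symm v)) =
      fun j => CostableSite.toDisk F A C (v j) :=
    (κ.completedToDisk_coe _).trans
      (funext fun j =>
        congrArg (fun w => CostableSite.toDisk F A C (w j)) (κ.gauss.apply_symm_apply v))
  rw [h1]
  funext j
  simpa using hvg j

/-- Both images lie in `𝒪(𝔇)^d`, so the difference can be evaluated at points, which is not possible
for general sections of `𝓛`. -/
theorem IsDiskMap.exists_sub_eq {m : Comparison L P κ}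
    {c c' : κ.CompletedTensor →+ P.presheaf.obj (Opposite.op (disk F A C))}
    (hc : IsDiskMap m c) (hc' : IsDiskMap m c') (y : κ.CompletedTensor) :
    ∃ h : Fin d → Hol (disk F A C).carrier,
      m.equiv (disk F A C) (c y - c' y) = L.ofHol (disk F A C).toAdmOpen d h := by
  obtain ⟨h, hh⟩ := (hc.mem_range_iff (c y)).1 ⟨y, rfl⟩
  obtain ⟨h', hh'⟩ := (hc'.mem_range_iff (c' y)).1 ⟨y, rfl⟩
  exact ⟨h - h', by rw [map_sub, map_sub, hh, hh']⟩

/-- Density is not enough, since continuity is not part of the hypotheses. Instead the difference is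
shown to vanish at each point over the algebraic closure of `F`, by linearity and the decomposition
modulo the ideal of the point. -/
theorem IsDiskMap.unique {m : Comparison L P κ}
    {c c' : κ.CompletedTensor →+ P.presheaf.obj (Opposite.op (disk F A C))}
    (hc : IsDiskMap m c) (hc' : IsDiskMap m c') : c = c' := by
  choose h hh using hc.exists_sub_eq hc'
  have hzero : ∀ y, h y = 0 := by
    intro y
    funext j
    refine Hol.eq_zero_of_forall_eval_eq_zero _ fun x => ?_
    obtain ⟨n, a, ha, hdec⟩ := κ.exists_decomposition x
    obtain ⟨v, z, hy⟩ := hdec y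
    have hsmul : ∀ i, c (κ.completedMul (a i ⊗ₜ[F] (1 : A)) (z i)) -
        c' (κ.completedMul (a i ⊗ₜ[F] (1 : A)) (z i)) =
          (a i ⊗ₜ[F] (1 : A) : A ⊗[F] A) • (c (z i) - c' (z i)) := fun i => by
      rw [smul_sub, ← hc.map_smul, ← hc'.map_smul]
      rfl
    -- Both maps extend `ι`, so the tensor part of `y` cancels and only multiples of the `aᵢ`, which
    -- vanish at `x`, remain.
    have h1 : h y = ∑ i, a i • h (z i) := by
      refine FractionalSheaf.ofHol_injective (L := L) (disk F A C).toAdmOpen ?_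
      rw [← hh y, map_sum]
      conv_lhs => rw [hy, map_add, map_add, map_sum, map_sum, hc.extends_ι, hc'.extends_ι,
        add_sub_add_left_eq_sub, ← Finset.sum_sub_distrib, map_sum]
      refine Finset.sum_congr rfl fun i _ => ?_
      rw [hsmul, m.equiv_smul_left, hh, L.ofHol_smul]
    rw [h1]
    let ev := Hol.evalHom ((IsAlgClosed.lift : AlgebraicClosure F →ₐ[F] C).comp x)
      (comp_mem_disk _ x)
    change ev ((∑ i, a i • h (z i)) j) = 0
    rw [Finset.sum_apply, map_sum]
    refine Finset.sum_eq_zero fun i _ => ?_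
    refine (Hol.eval_smul_left (a i) (h (z i) j) _ _).trans ?_
    rw [AlgHom.comp_apply, ha, map_zero, zero_mul]
  refine AddMonoidHom.ext fun y => sub_eq_zero.1 ((m.equiv (disk F A C)).injective ?_)
  rw [hh, hzero, map_zero, map_zero]

end Disk

end CostableSite

end

theorem proposition1p1 {F A K C : Type u} [Field F] [Fintype F] [CommRing A] [Algebra F A]
    [Field K] [Algebra A K] [IsFractionRing A K] (place : ValuationSubring K)
    (hA : IsPuncturedCurve F A place)
    [NormedField C] [CompleteSpace C] [IsAlgClosed C] [IsUltrametricDist C] [Algebra F C]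
    (ℓ : A →ₐ[F] C) (hC : IsCInfty place ℓ)
    {d : ℕ} (E : AndersonModule ℓ d) (L : FractionalSheaf F A C) (hL : L.IsCostable) :
    -- existence of the pair `(ℰ, ι)`
    (∃ P : EPair E, IsEValuedSheaf L P) ∧
    -- the identification for one choice of coordinates determines those for all the others
    (∀ P : EPair E, IsEValuedSheaf L P →
      ∀ (κ : Coordinates F E.functor d) (m : Comparison L P κ),
        ∃! s : ComparisonSystem L P, s.comparison κ = m) ∧
    -- uniqueness of the pair up to canonical isomorphism
    (∀ P P' : EPair E, IsEValuedSheaf L P → IsEValuedSheaf L P' →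
      ∀ (s : ComparisonSystem L P) (s' : ComparisonSystem L P'),
        ∃! f : P.presheaf ≅ P'.presheaf,
          (∀ U : CostableOpen F A C, P.ι U ≫ f.hom.app (Opposite.op U) = P'.ι U) ∧
          ∀ (κ : Coordinates F E.functor d) (U : CostableOpen F A C)
            (e : P.presheaf.obj (Opposite.op U)),
            ((s'.comparison κ).iso U).hom (f.hom.app (Opposite.op U) e) =
              ((s.comparison κ).iso U).hom e) ∧
    -- the metric on `A ⊗ E(C)` is independent of the coordinates, and `A ⊗ A` acts continuously
    (∀ κ κ' : Coordinates F E.functor d, κ.uniformSpace = κ'.uniformSpace) ∧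
    (∀ (κ : Coordinates F E.functor d) (r : A ⊗[F] A), UniformContinuous (κ.mulMap r)) ∧
    -- on the unit disk one recovers the completed tensor product
    (∀ P : EPair E, IsEValuedSheaf L P →
      ∀ (κ : Coordinates F E.functor d) (m : Comparison L P κ),
        ∃! c : κ.CompletedTensor →+ P.presheaf.obj (Opposite.op (disk F A C)), IsDiskMap m c) ∧
    ((∀ x ∈ L.sections (disk F A C).toAdmOpen, ∃ f : Hol (disk F A C).carrier,
        algebraMap (Hol (disk F A C).carrier) (Mer (disk F A C).toAdmOpen) f = x) →
      ∀ P : EPair E, IsEValuedSheaf L P →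
        ∀ (κ : Coordinates F E.functor d) (m : Comparison L P κ)
          (c : κ.CompletedTensor →+ P.presheaf.obj (Opposite.op (disk F A C))),
          IsDiskMap m c → Function.Bijective c) := by
  -- Finite type presents the disk as an affinoid zero locus; reducedness over the algebraic closure
  -- feeds the Nullstellensatz.
  have : Algebra.Smooth F A := hA.smooth
  have : Algebra.FinitePresentation F A := inferInstance
  have : Algebra.FiniteType F A := inferInstance
  have : IsDomain (AlgebraicClosure F ⊗[F] A) := hA.geometrically_integral
  have : IsReduced (AlgebraicClosure F ⊗[F] A) := inferInstance
  obtain ⟨κ₀⟩ := E.exists_coordinates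
  exact ⟨⟨EPair.ofCoordinates hL κ₀, EPair.isEValuedSheaf hL κ₀⟩,
    fun P _ κ m => m.existsUnique_system hL,
    fun P P' _ _ s s' => ComparisonSystem.existsUnique_iso hL s s',
    fun κ κ' => Coordinates.uniformSpace_eq κ κ',
    fun κ r => κ.uniformContinuous_mulMap r,
    fun P _ κ m => ⟨m.diskMap, m.isDiskMap hL, fun c hc => hc.unique (m.isDiskMap hL)⟩,
    fun h P _ κ m c hc => hc.bijective h⟩
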